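/- **Conventions.** A *folding string* is a nonempty finite sequence $S=(a_1,\dots,a_{m-1})$ with $a_k\in\{-1,+1\}$; put $\overline S=(-a_{m-1},\dots,-a_1)$. For folding strings $S$ and $T=(t_1,\dots,t_{n-1})$, the *folding convolution* is $S\ast T=(S,t_1,\overline S,t_2,S,t_3,\overline S,\dots)$, with $n$ blocks alternately equal to $S$ and $\overline S$. Let $S^{\ast 1}=S$, $S^{\ast(n+1)}=S^{\ast n}\ast S$; each $S^{\ast n}$ is an initial part of $S^{\ast(n+1)}$, and $S^{\ast\infty}=(s_k)_{k\ge 1}$ is their union. For $\varepsilon=\pm1$, $(\overline{S}^{\ast\infty},\varepsilon,S^{\ast\infty})$ is the sequence $(b_k)_{k\in\mathbb Z}$ with $b_0=\varepsilon$, $b_k=s_k$ and $b_{-k}=-s_k$ for $k\ge1$. A *curve associated to* a sequence $(a_k)$ of $\pm1$'s, indexed by $\mathbb N^\ast$ or $\mathbb Z$, is a sequence of oriented segments $C_k=[x_k,x_k+\varepsilon_k]$ with $x_k\in\mathbb Z+i\mathbb Z$, $\varepsilon_k\in\{1,-1,i,-i\}$, $x_{k+1}=x_k+\varepsilon_k$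 and $\varepsilon_{k+1}=i^{a_k}\varepsilon_k$; it is rounded at its vertices, so that it is *self-avoiding* if and only if no two of its segments have the same support. Two-sided curves are called *complete*, and are considered up to a shift of the indices. A set of curves *covers* the plane (resp. a square $\{x+u+iv\mid u,v\in[0,m]\}$ with $x\in\mathbb Z+i\mathbb Z$, $m\in\mathbb N^\ast$) if each nonoriented interval $[z,z+\varepsilon]$ with $z\in\mathbb Z+i\mathbb Z$ and $\varepsilon\in\{1,i\}$ (resp. each such interval contained in the square) is the support of exactly one segment of one curve of the set. A complete curve is an *$S$-folding curve* if it is associated to a sequence $(b_k)_{k\in\mathbb Z}$ such that each $(b_{k+1},\dots,b_{k+l})$ occurs as a block of consecutive terms of $S^{\ast\infty}$. A *covering by $S$-folding curves* is a set $\mathcal C$ of such curves which covers the plane. It satisfies the *local isomorphism property* if, for each finite set $F$ of (oriented) segments of curves of $\mathcal C$, there exists $r\in\mathbb N$ such that each square of side $r$ with vertices in $\mathbb Z+i\mathbb Z$ contains a translate $F+u$, $u\in\mathbb Z+i\mathbb Z$, which consists of segments of curves of $\mathcal C$ and is such that, for all $A,B\in F$, $A+u,B+u$ are consecutive segments of a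 curve of $\mathcal C$ if and only if $A,B$ are. **Theorem 2.** Let $S$ be a folding string such that 1. each curve associated to $S^{\ast\infty}$ is self-avoiding; 2. each curve associated to $S^{\ast\infty}$ covers arbitrarily large squares; 3. $S$ is not perfect, i.e. it is not true that, for each curve $C$ associated to $S^{\ast\infty}$, the plane is covered by the four curves obtained from $C$ by the rotations of angles $0,\pi/2,\pi,3\pi/2$ around its origin. Let $\mathcal C$ be a covering by $S$-folding curves which satisfies the local isomorphism property and contains a curve associated to $(\overline{S}^{\ast\infty},+1,S^{\ast\infty})$ or to $(\overline{S}^{\ast\infty},-1,S^{\ast\infty})$. Then $\mathcal C$ contains exactly $6$ curves. -/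

import Mathlib

namespace Folding

/-! ### Folding strings and the folding convolution -/

/-- A folding string `(a₁, …, a_{m-1})` with entries `±1` (entry `a_k` is stored at index `k - 1`). -/
abbrev FoldingString := List ℤˣ

/-- The string `S̄ = (-a_{m-1}, …, -a₁)`, i.e. the turns of the curve of `S` run backwards. -/
def bar (S : FoldingString) : FoldingString := (S.map (fun a => -a)).reverse

/-- The folding convolution `S ∗ T = S t₁ S̄ t₂ S t₃ S̄ …`, with copies of `S` and `S̄` alternating
(note that the bar of `S̄` is `S`). -/
def conv : FoldingString → FoldingString → FoldingString
  | S, [] => S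
  | S, t :: T => S ++ t :: conv (bar S) T

/-- The power `S^{∗n}`: `S^{∗0}` is the empty string, which is neutral for `∗`, so that
`S^{∗1} = S` and `S^{∗(n+1)} = S^{∗n} ∗ S`. -/
def convPow (S : FoldingString) : ℕ → FoldingString
  | 0 => []
  | n + 1 => conv (convPow S n) S

/-- The infinite sequence `S^{∗∞} = ⋃ₙ S^{∗n}` for a nonempty `S`. The index starts at `0`: the
value at `k` is the `(k+1)`-st term. By `convPow_getElem?` below it extends every `S^{∗n}`. -/
def infPow (S : FoldingString) (k : ℕ) : ℤˣ := (convPow S (k + 1)).getD k 1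

theorem prefix_conv (S T : FoldingString) : S <+: conv S T := by
  cases T with
  | nil => simp [conv]
  | cons t T => exact ⟨_, by rw [conv]⟩

theorem length_bar (S : FoldingString) : (bar S).length = S.length := by
  simp [bar]

theorem length_conv (S T : FoldingString) :
    (conv S T).length = S.length + T.length * (S.length + 1) := by
  induction T generalizing S with
  | nil => simp [conv]
  | cons t T ih => simp only [conv, List.length_append, List.length_cons, ih, length_bar]; ring

theorem conv_nil_left (T : FoldingString) : conv [] T = T := by
  induction T with
  | nil => rfl
  | cons t T ih => simp [conv, bar, ih]

theorem convPow_one (S : FoldingString) : convPow S 1 = S := by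
  simp [convPow, conv_nil_left]

theorem convPow_prefix (S : FoldingString) {m n : ℕ} (h : m ≤ n) :
    convPow S m <+: convPow S n := by
  induction n, h using Nat.le_induction with
  | base => exact List.prefix_rfl
  | succ n _ ih => exact ih.trans (prefix_conv _ _)

theorem le_length_convPow {S : FoldingString} (hS : S ≠ []) (n : ℕ) :
    n ≤ (convPow S n).length := by
  induction n with
  | zero => simp
  | succ n ih =>
    have h : 1 ≤ S.length := List.length_pos_iff.2 hS
    simp only [convPow, length_conv]
    nlinarith

theorem convPow_getElem? {S : FoldingString} (hS : S ≠ []) {n k : ℕ}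
    (hk : k < (convPow S n).length) : (convPow S n)[k]? = some (infPow S k) := by
  have h1 : k < (convPow S (k + 1)).length := le_length_convPow hS (k + 1)
  have key : (convPow S n)[k]? = (convPow S (k + 1))[k]? := by
    rcases le_total n (k + 1) with h | h
    · obtain ⟨t, ht⟩ := convPow_prefix S h
      rw [← ht, List.getElem?_append_left hk]
    · obtain ⟨t, ht⟩ := convPow_prefix S h
      rw [← ht, List.getElem?_append_left h1]
  rw [key, infPow, List.getD_eq_getElem?_getD, List.getElem?_eq_getElem h1]
  rfl

/-- The two-sided sequence `(ā, ε, a)` built from `a = (a₁, a₂, …)`, where `ā = (…, -a₂, -a₁)`: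
its term of index `0` is `ε`, the one of index `k ≥ 1` is `a_k`, the one of index `-k` is `-a_k`. -/
def twoSided (a : ℕ → ℤˣ) (ε : ℤˣ) (k : ℤ) : ℤˣ :=
  if k = 0 then ε else if 0 < k then a (k.natAbs - 1) else -a (k.natAbs - 1)

/-- `b` is a complete `S`-folding sequence: `S^{∗∞}` contains a copy of each
`(b_{k+1}, …, b_{k+l})`. -/
def IsCompleteFoldingSeq (S : FoldingString) (b : ℤ → ℤˣ) : Prop :=
  ∀ (k : ℤ) (l : ℕ), ∃ j : ℕ, ∀ i < l, b (k + 1 + i) = infPow S (j + i)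

/-! ### Segments and curves -/

/-- The Gaussian integer `i^a` for `a = ±1`. -/
def iPow (a : ℤˣ) : GaussianInt := ⟨0, (a : ℤ)⟩

/-- An oriented segment `[x, x + ε]` with `x ∈ ℤ + iℤ` and `ε ∈ {1, -1, i, -i}`, the units of
`ℤ + iℤ`. -/
@[ext]
structure Segment where
  start : GaussianInt
  dir : GaussianInt
  isUnit_dir : IsUnit dir

/-- The terminal point of a segment. -/
def Segment.endPt (A : Segment) : GaussianInt := A.start + A.dir

/-- The support of a segment: the nonoriented interval, given by its two endpoints. -/
def Segment.support (A : Segment) : Sym2 GaussianInt := s(A.start, A.endPt)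

/-- The translate of a segment by `u`. -/
def Segment.translate (u : GaussianInt) (A : Segment) : Segment :=
  ⟨A.start + u, A.dir, A.isUnit_dir⟩

theorem isUnit_iPow (a : ℤˣ) : IsUnit (iPow a) := by
  refine IsUnit.of_mul_eq_one (iPow (-a)) ?_
  rcases Int.units_eq_one_or a with rfl | rfl <;> ext <;> simp [iPow]

/-- The image of a segment under the rotation of centre `o` and angle `jπ/2`. -/
def Segment.rotate (o : GaussianInt) (j : ℕ) (A : Segment) : Segment :=
  ⟨o + iPow 1 ^ j * (A.start - o), iPow 1 ^ j * A.dir, ((isUnit_iPow 1).pow j).mul A.isUnit_dir⟩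

/-- `B` follows `A` in a curve, with turn `a` at their common vertex. -/
def Follows (a : ℤˣ) (A B : Segment) : Prop :=
  B.start = A.endPt ∧ B.dir = iPow a * A.dir

/-- `c` is a curve with first segment `c 0`, associated to the one-sided sequence `a`. -/
def IsRayOf (a : ℕ → ℤˣ) (c : ℕ → Segment) : Prop :=
  ∀ k, Follows (a k) (c k) (c (k + 1))

/-- `c` is a complete curve associated to the two-sided sequence `a`. -/
def IsCompleteCurveOf (a : ℤ → ℤˣ) (c : ℤ → Segment) : Prop :=
  ∀ k, Follows (a k) (c k) (c (k + 1))

/-- `c` is a complete `S`-folding curve. -/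
def IsCompleteFoldingCurve (S : FoldingString) (c : ℤ → Segment) : Prop :=
  ∃ b, IsCompleteFoldingSeq S b ∧ IsCompleteCurveOf b c

/-- A curve is self-avoiding if no interval is the support of two of its segments. (Curves are
rounded at their vertices, and they turn by a right angle at each of them, so that two passages
through a vertex meet only if they share a segment.) -/
def SelfAvoiding {ι : Type} (c : ι → Segment) : Prop :=
  Function.Injective fun k => (c k).support

/-! ### Coverings -/

/-- The unit intervals `[z, z + 1]` and `[z, z + i]` with `z ∈ ℤ + iℤ`. -/
def unitIntervals : Set (Sym2 GaussianInt) :=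
  {e | ∃ z : GaussianInt, e = s(z, z + 1) ∨ e = s(z, z + iPow 1)}

/-- The Gaussian integers in the square `{x + u + iv | u, v ∈ [0, m]}`. -/
def square (x : GaussianInt) (m : ℕ) : Set GaussianInt :=
  {z | x.re ≤ z.re ∧ z.re ≤ x.re + m ∧ x.im ≤ z.im ∧ z.im ≤ x.im + m}

/-- Each interval in `E` is the support of exactly one segment of one curve of `𝒞`. -/
def Covers {ι : Type} (𝒞 : Set (ι → Segment)) (E : Set (Sym2 GaussianInt)) : Prop :=
  ∀ e ∈ E, ∃! p : (ι → Segment) × ι, p.1 ∈ 𝒞 ∧ (p.1 p.2).support = e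

/-- The curves of `𝒞` cover the plane. -/
def CoversPlane {ι : Type} (𝒞 : Set (ι → Segment)) : Prop :=
  Covers 𝒞 unitIntervals

/-- The curves of `𝒞` cover the square `{x + u + iv | u, v ∈ [0, m]}`. -/
def CoversSquare {ι : Type} (𝒞 : Set (ι → Segment)) (x : GaussianInt) (m : ℕ) : Prop :=
  Covers 𝒞 {e ∈ unitIntervals | ∀ z ∈ e, z ∈ square x m}

/-- A covering of the plane by complete `S`-folding curves. Two parametrizations of one curve
cannot both belong to `𝒞`, since a segment must have a unique curve and index. -/
def IsFoldingCovering (S : FoldingString) (𝒞 : Set (ℤ → Segment)) : Prop :=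
  (∀ c ∈ 𝒞, IsCompleteFoldingCurve S c) ∧ CoversPlane 𝒞

/-- `A` is a segment of a curve of `𝒞`. -/
def IsSegmentOf (𝒞 : Set (ℤ → Segment)) (A : Segment) : Prop :=
  ∃ c ∈ 𝒞, ∃ k, c k = A

/-- `A` and `B` are consecutive segments of a curve of `𝒞`. -/
def Consecutive (𝒞 : Set (ℤ → Segment)) (A B : Segment) : Prop :=
  ∃ c ∈ 𝒞, ∃ k, c k = A ∧ c (k + 1) = B

/-- The local isomorphism property: for each bounded pattern of `𝒞` (a finite set `F` of segments
of curves of `𝒞`, with the connections between them) there is `r` such that each square of side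
`r` contains a translate of that pattern which is again a pattern of `𝒞`. -/
def LocalIsomorphismProperty (𝒞 : Set (ℤ → Segment)) : Prop :=
  ∀ F : Set Segment, F.Finite → (∀ A ∈ F, IsSegmentOf 𝒞 A) →
    ∃ r : ℕ, ∀ x : GaussianInt, ∃ u : GaussianInt,
      (∀ A ∈ F, IsSegmentOf 𝒞 (A.translate u) ∧
        (A.translate u).start ∈ square x r ∧ (A.translate u).endPt ∈ square x r) ∧
      ∀ A ∈ F, ∀ B ∈ F,
        (Consecutive 𝒞 (A.translate u) (B.translate u) ↔ Consecutive 𝒞 A B)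

/-! ### The three properties of a folding string -/

/-- `S^{∗∞}` is self-avoiding. -/
def IsSelfAvoidingString (S : FoldingString) : Prop :=
  ∀ c, IsRayOf (infPow S) c → SelfAvoiding c

/-- Each curve associated to `S^{∗∞}` covers arbitrarily large squares. -/
def IsPlaneFilling (S : FoldingString) : Prop :=
  ∀ c, IsRayOf (infPow S) c → ∀ m : ℕ, 0 < m → ∃ x, CoversSquare {c} x m

/-- `S` is perfect: for each curve `c` associated to `S^{∗∞}`, the plane is covered by the four
curves obtained from `c` by the rotations of angles `0, π/2, π, 3π/2` around its origin. -/
def IsPerfect (S : FoldingString) : Prop :=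
  ∀ c, IsRayOf (infPow S) c →
    CoversPlane (Set.range fun (j : Fin 4) (k : ℕ) => (c k).rotate (c 0).start j)

end Folding

open Folding

namespace Folding

/-! ### Gaussian integers -/

/-! Write `a` for the sequence $S^{\ast\infty}$, $m=|S|+1$ and $N=m^n$. In doubled coordinates an
edge is given by its middle, an odd Gaussian integer. The even ones, called nodes, are the vertices
and the centres of the faces. An edge is regarded as the small square whose corners are the four
nodes next to it.

The curve is self-similar: its blocks of $N$ segments are images of the first block, the tile of
level $n$, under motions $y\mapsto uy+2Qe$ with $u$ a unit, $e$ even and $Q$ the end of the first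
block. As the curve avoids itself and fills large squares, the images of the tile under all motions
partition the edges (`TurnRule.isTiling`). By local isomorphism, any two edges can be moved,
together with a long initial part of the ray contained in the given curve, into this ray. Hence each
tile of each level, placed relative to the origin of the ray, lies in one curve of the covering
(`linkSystem_of_covering`).

So the four rays obtained by rotation around the origin lie in curves of the covering, and the
pairing at the origin joins them into two curves. A vertex other than the origin is not an end of
tiles of high level. Therefore distinct edges outside the rays are in the same curve if and only if
they are in the same tile at high levels (`LinkSystem.eventually_sameTile`). At high levels all
these edges lie in four tiles exchanged by the rotations (`LinkSystem.exists_spoke`). Since $S$ is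
not perfect there is such an edge, and its four rotated images represent four more curves: $2+4=6$.

The four tiles are found by a planarity argument. The quotient of the plane by the motions is a
sphere with three cone points: $0$ and $2Q$, of order $4$, and $(1+i)Q$, of order $2$. The tile is a
chain of $N$ squares strung at the vertices of the curve. Its contour of $4N$ sides is glued in
pairs, and an Euler count (`IsTiling.le_ncard_nodeOrbits`, `IsTiling.le_ncard_labels`) shows that
the glued contour is a tree. So the pairs do not cross (`contour_disjoint`), and the motion of each
pair is known from the arcs, among the three cut by the cone points, which contain its two sides
(`IsTiling.contact_motion`). A contact which leaves a ray near the origin joins that place to the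
farthest arc; since no other contact crosses it, few motions remain for the later segments
(`IsTiling.contact_later`). -/

theorem gaussianInt_ext_iff {z w : GaussianInt} : z = w ↔ z.re = w.re ∧ z.im = w.im :=
  Zsqrtd.ext_iff

/-- The unit `i^a` of `ℤ + iℤ`. -/
def iUnit (a : ℤˣ) : GaussianIntˣ where
  val := iPow a
  inv := iPow (-a)
  val_inv := by
    rcases Int.units_eq_one_or a with rfl | rfl <;> ext <;> simp [iPow]
  inv_val := by
    rcases Int.units_eq_one_or a with rfl | rfl <;> ext <;> simp [iPow]

@[simp] theorem val_iUnit (a : ℤˣ) : (iUnit a : GaussianInt) = iPow a := rfl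

theorem iUnit_inv (a : ℤˣ) : (iUnit a)⁻¹ = iUnit (-a) := Units.ext rfl

theorem iUnit_neg (a : ℤˣ) : iUnit (-a) = -iUnit a := by
  apply Units.ext; ext <;> simp [iPow]

theorem iUnit_mul_self (a : ℤˣ) : iUnit a * iUnit a = -1 := by
  apply Units.ext
  rcases Int.units_eq_one_or a with rfl | rfl <;> ext <;> simp [iPow]

theorem iPow_mul_self (a : ℤˣ) : iPow a * iPow a = -1 :=
  congrArg Units.val (iUnit_mul_self a)

theorem iPow_neg (a : ℤˣ) : iPow (-a) = -iPow a := by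
  ext <;> simp [iPow]

theorem norm_unit (u : GaussianIntˣ) : Zsqrtd.norm (u : GaussianInt) = 1 :=
  (Zsqrtd.norm_eq_one_iff' (by norm_num) _).2 u.isUnit

theorem norm_def' (z : GaussianInt) : Zsqrtd.norm z = z.re * z.re + z.im * z.im := by
  simp [Zsqrtd.norm_def]

theorem isUnit_cases {z : GaussianInt} (h : IsUnit z) :
    z = 1 ∨ z = -1 ∨ z = iPow 1 ∨ z = iPow (-1) := by
  have h1 := (Zsqrtd.norm_eq_one_iff' (by norm_num) _).2 h
  rw [norm_def'] at h1
  have h2 : -1 ≤ z.re := by nlinarith [mul_self_nonneg z.im]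
  have h3 : z.re ≤ 1 := by nlinarith [mul_self_nonneg z.im]
  have h4 : -1 ≤ z.im := by nlinarith [mul_self_nonneg z.re]
  have h5 : z.im ≤ 1 := by nlinarith [mul_self_nonneg z.re]
  obtain ⟨x, y⟩ := z
  simp only at h1 h2 h3 h4 h5
  simp only [gaussianInt_ext_iff, iPow]
  interval_cases x <;> interval_cases y <;> simp_all

theorem unit_cases (u : GaussianIntˣ) :
    u = 1 ∨ u = -1 ∨ u = iUnit 1 ∨ u = iUnit (-1) := by
  rcases isUnit_cases u.isUnit with h | h | h | h
  · exact Or.inl (Units.ext h)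
  · exact Or.inr (Or.inl (Units.ext h))
  · exact Or.inr (Or.inr (Or.inl (Units.ext h)))
  · exact Or.inr (Or.inr (Or.inr (Units.ext h)))

/-- Relative to a unit `v`, each unit is one of `v`, `-v`, `iv`, `-iv`. -/
theorem unit_cases_mul (u v : GaussianIntˣ) (a : ℤˣ) :
    u = v ∨ u = -v ∨ u = iUnit a * v ∨ u = -(iUnit a * v) := by
  have h := unit_cases (u * v⁻¹)
  have e : u = (u * v⁻¹) * v := by simp
  have : u = 1 * v ∨ u = -1 * v ∨ u = iUnit 1 * v ∨ u = iUnit (-1) * v := by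
    rcases h with h | h | h | h <;> rw [h] at e <;> simp [← e]
  rcases Int.units_eq_one_or a with rfl | rfl
  · simpa [iUnit_neg] using this
  · rcases this with h | h | h | h <;> simp [h, iUnit_neg]

/-- `z` is even if it is divisible by `1 + i`, i.e. if the sum of its coordinates is even. -/
def IsEven (z : GaussianInt) : Prop := Even (z.re + z.im)

theorem IsEven.add {z w : GaussianInt} (hz : IsEven z) (hw : IsEven w) : IsEven (z + w) := by
  unfold IsEven at *
  rw [Zsqrtd.re_add, Zsqrtd.im_add]
  have := hz.add hw; rwa [add_add_add_comm] at this

theorem IsEven.neg {z : GaussianInt} (hz : IsEven z) : IsEven (-z) := by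
  unfold IsEven at *
  rw [Zsqrtd.re_neg, Zsqrtd.im_neg]
  have := hz.neg; rwa [neg_add] at this

theorem IsEven.sub {z w : GaussianInt} (hz : IsEven z) (hw : IsEven w) : IsEven (z - w) := by
  rw [sub_eq_add_neg]; exact hz.add hw.neg

theorem isEven_zero : IsEven 0 := by simp [IsEven]

theorem IsEven.mul_left {w : GaussianInt} (z : GaussianInt) (hw : IsEven w) :
    IsEven (z * w) := by
  unfold IsEven at *
  rw [Zsqrtd.re_mul, Zsqrtd.im_mul]
  obtain ⟨k, hk⟩ := hw
  refine ⟨z.re * k + z.im * k - z.im * w.im, ?_⟩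
  have : w.re = k + k - w.im := by linarith
  rw [this]; ring

theorem isEven_two_mul (z : GaussianInt) : IsEven (2 * z) := by
  unfold IsEven
  refine ⟨z.re + z.im, ?_⟩
  simp [two_mul]; ring

theorem not_isEven_unit (u : GaussianIntˣ) : ¬ IsEven u := by
  rcases unit_cases u with rfl | rfl | rfl | rfl <;> simp [IsEven, iPow]

theorem isEven_add_iff {z w : GaussianInt} (hw : IsEven w) : IsEven (z + w) ↔ IsEven z :=
  ⟨fun h => by simpa using h.sub hw, fun h => h.add hw⟩

theorem isEven_add_unit_iff (z : GaussianInt) (u : GaussianIntˣ) :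
    IsEven (z + u) ↔ ¬ IsEven z := by
  unfold IsEven
  rw [Zsqrtd.re_add, Zsqrtd.im_add]
  have : z.re + (u : GaussianInt).re + (z.im + (u : GaussianInt).im) =
    (z.re + z.im) + ((u : GaussianInt).re + (u : GaussianInt).im) := by ring
  rw [this, Int.even_add]
  have := not_isEven_unit u
  unfold IsEven at this
  tauto

theorem IsEven.unit_mul_iff {z : GaussianInt} (u : GaussianIntˣ) :
    IsEven (u * z) ↔ IsEven z :=
  ⟨fun h => by simpa [← mul_assoc] using h.mul_left (u⁻¹ : GaussianIntˣ), fun h => h.mul_left _⟩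

theorem isEven_one_add_iPow (a : ℤˣ) : IsEven (1 + iPow a) := by
  rcases Int.units_eq_one_or a with rfl | rfl <;> simp [IsEven, iPow]

theorem isEven_one_sub_iPow (a : ℤˣ) : IsEven (1 - iPow a) := by
  rcases Int.units_eq_one_or a with rfl | rfl <;> simp [IsEven, iPow]

theorem isEven_iff_exists {z : GaussianInt} (a : ℤˣ) :
    IsEven z ↔ ∃ w, z = (1 + iPow a) * w := by
  constructor
  · rintro ⟨k, hk⟩
    rcases Int.units_eq_one_or a with rfl | rfl
    · exact ⟨⟨k, k - z.re⟩, by ext <;> simp [iPow] <;> linarith⟩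
    · exact ⟨⟨k - z.im, k⟩, by ext <;> simp [iPow] <;> linarith⟩
  · rintro ⟨w, rfl⟩
    rw [mul_comm]; exact (isEven_one_add_iPow a).mul_left w

theorem two_mul_inj {z w : GaussianInt} (h : 2 * z = 2 * w) : z = w := by
  have h1 := congrArg Zsqrtd.re h
  have h2 := congrArg Zsqrtd.im h
  simp [two_mul] at h1 h2
  ext <;> omega

/-- An odd element is `2w + u` with `w` even and `u` a unit in exactly one way. -/
theorem two_mul_even_add_unit_inj {w w' : GaussianInt} {u u' : GaussianIntˣ} (hw : IsEven w)
    (hw' : IsEven w') (h : 2 * w + u = 2 * w' + u') : w = w' ∧ u = u' := by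
  have key : u = u' := by
    have h3 : 2 * (w - w') = (u' : GaussianInt) - u := by linear_combination h
    have he := hw.sub hw'
    generalize w - w' = v at h3 he
    have h1 := congrArg Zsqrtd.re h3
    have h2 := congrArg Zsqrtd.im h3
    simp only [two_mul, Zsqrtd.re_add, Zsqrtd.im_add, Zsqrtd.re_sub, Zsqrtd.im_sub] at h1 h2
    unfold IsEven at he
    rcases unit_cases u with rfl | rfl | rfl | rfl <;> rcases unit_cases u' with rfl | rfl | rfl | rfl <;>
      first
      | rfl
      | (exfalso; simp [iPow] at h1 h2; try omega
         try (obtain ⟨r, hr⟩ := he; omega))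
  subst key
  exact ⟨two_mul_inj (by linear_combination h), rfl⟩

/-- With the uniqueness above, (u, e) ↦ 2e + u is a bijection between the motions defined below and
the edges: each motion is named by an edge. -/
theorem exists_two_mul_even_add_unit {y : GaussianInt} (hy : ¬ IsEven y) :
    ∃ (w : GaussianInt) (u : GaussianIntˣ), IsEven w ∧ y = 2 * w + u := by
  obtain ⟨x, t⟩ := y
  have hy' : (x + t) % 2 = 1 := by
    unfold IsEven at hy; simpa [Int.even_iff] using hy
  by_cases hx : x % 2 = 1
  · by_cases h : ((x - 1) / 2 + t / 2) % 2 = 0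
    · refine ⟨⟨(x - 1) / 2, t / 2⟩, 1, ?_, ?_⟩
      · simp [IsEven, Int.even_iff, h]
      · ext <;> simp [two_mul] <;> omega
    · refine ⟨⟨(x + 1) / 2, t / 2⟩, -1, ?_, ?_⟩
      · simp [IsEven, Int.even_iff]; omega
      · ext <;> simp [two_mul] <;> omega
  · by_cases h : (x / 2 + (t - 1) / 2) % 2 = 0
    · refine ⟨⟨x / 2, (t - 1) / 2⟩, iUnit 1, ?_, ?_⟩
      · simp [IsEven, Int.even_iff, h]
      · ext <;> simp [two_mul, iPow] <;> omega
    · refine ⟨⟨x / 2, (t + 1) / 2⟩, iUnit (-1), ?_, ?_⟩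
      · simp [IsEven, Int.even_iff]; omega
      · ext <;> simp [two_mul, iPow] <;> omega

/-! ### The group of motions -/

/-- A rotation by the unit `u` followed by a translation by `e`, with `e` even. -/
@[ext]
structure Motion where
  u : GaussianIntˣ
  e : GaussianInt
  isEven_e : IsEven e

namespace Motion

instance : Mul Motion := ⟨fun g h => ⟨g.u * h.u, g.u * h.e + g.e, (h.isEven_e.mul_left _).add g.isEven_e⟩⟩
instance : One Motion := ⟨⟨1, 0, isEven_zero⟩⟩
instance : Inv Motion := ⟨fun g => ⟨g.u⁻¹, -((g.u⁻¹ : GaussianIntˣ) * g.e), (g.isEven_e.mul_left _).neg⟩⟩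

@[simp] theorem mul_u (g h : Motion) : (g * h).u = g.u * h.u := rfl
@[simp] theorem mul_e (g h : Motion) : (g * h).e = g.u * h.e + g.e := rfl
@[simp] theorem one_u : (1 : Motion).u = 1 := rfl
@[simp] theorem one_e : (1 : Motion).e = 0 := rfl
@[simp] theorem inv_u (g : Motion) : g⁻¹.u = g.u⁻¹ := rfl
@[simp] theorem inv_e (g : Motion) : g⁻¹.e = -((g.u⁻¹ : GaussianIntˣ) * g.e) := rfl

instance : Group Motion :=
  Group.ofLeftAxioms
    (fun a b c => by
      apply Motion.ext
      · simp [mul_assoc]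
      · simp only [mul_e, mul_u, Units.val_mul]; ring)
    (fun a => by apply Motion.ext <;> simp)
    (fun a => by apply Motion.ext <;> simp)

/-- The rotation by `u` around the origin. -/
def rot (u : GaussianIntˣ) : Motion := ⟨u, 0, isEven_zero⟩

/-- The motion `g` acting at scale `Q`, in doubled coordinates. -/
def act (Q : GaussianInt) (g : Motion) (y : GaussianInt) : GaussianInt := g.u * y + 2 * Q * g.e

theorem act_mul (Q : GaussianInt) (g h : Motion) (y : GaussianInt) :
    (g * h).act Q y = g.act Q (h.act Q y) := by
  simp only [act, mul_u, mul_e, Units.val_mul]; ring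

@[simp] theorem act_one (Q y : GaussianInt) : (1 : Motion).act Q y = y := by
  simp [act]

theorem act_inv_act (Q : GaussianInt) (g : Motion) (y : GaussianInt) :
    g⁻¹.act Q (g.act Q y) = y := by
  rw [← act_mul, inv_mul_cancel, act_one]

theorem act_act_inv (Q : GaussianInt) (g : Motion) (y : GaussianInt) :
    g.act Q (g⁻¹.act Q y) = y := by
  rw [← act_mul, mul_inv_cancel, act_one]

@[simp] theorem act_rot (Q y : GaussianInt) (u : GaussianIntˣ) : (rot u).act Q y = u * y := by
  simp [act, rot]

theorem act_add (Q : GaussianInt) (g : Motion) (y z : GaussianInt) :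
    g.act Q (y + z) = g.act Q y + g.u * z := by
  simp only [act]; ring

theorem act_injective (Q : GaussianInt) (g : Motion) : Function.Injective (g.act Q) := fun y z h => by
  rw [← act_inv_act Q g y, h, act_inv_act]

theorem isEven_act_iff (Q : GaussianInt) (g : Motion) (y : GaussianInt) :
    IsEven (g.act Q y) ↔ IsEven y := by
  rw [act, mul_assoc, isEven_add_iff (isEven_two_mul _), IsEven.unit_mul_iff]

/-- A motion which fixes two distinct points is trivial. -/
theorem eq_one_of_act_eq {Q : GaussianInt} (hQ : Q ≠ 0) {g : Motion} {y z : GaussianInt} (hyz : y ≠ z)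
    (hy : g.act Q y = y) (hz : g.act Q z = z) : g = 1 := by
  have hu : g.u = 1 := by
    apply Units.ext
    have : ((g.u : GaussianInt) - 1) * (y - z) = 0 := by
      simp only [act] at hy hz; linear_combination hy - hz
    rcases mul_eq_zero.1 this with h | h
    · simpa using sub_eq_zero.1 h
    · exact absurd (sub_eq_zero.1 h) hyz
  apply Motion.ext hu
  have h2 : (2 : GaussianInt) ≠ 0 := by decide
  have : 2 * Q * g.e = 0 := by
    simp only [act, hu] at hy; simpa using hy
  simpa [h2, hQ] using this

end Motion

/-- `y` and `z` are equivalent under the motions at scale `Q`. -/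
def orbitSetoid (Q : GaussianInt) : Setoid GaussianInt where
  r y z := ∃ g : Motion, g.act Q y = z
  iseqv :=
    { refl := fun y => ⟨1, by simp⟩
      symm := by rintro y z ⟨g, rfl⟩; exact ⟨g⁻¹, g.act_inv_act Q y⟩
      trans := by rintro y z w ⟨g, rfl⟩ ⟨h, rfl⟩; exact ⟨h * g, Motion.act_mul Q h g y⟩ }

/-- The centres of the nontrivial motions belong to the orbits of `0`, `2Q` and `(1 + i)Q`. -/
theorem Motion.fixed_cases {Q : GaussianInt} (hQ : Q ≠ 0) {g : Motion} (hg : g ≠ 1) {y : GaussianInt}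
    (hy : g.act Q y = y) :
    (∃ h : Motion, h.act Q 0 = y) ∨ (∃ h : Motion, h.act Q (2 * Q) = y) ∨
      ∃ h : Motion, h.act Q ((1 + iPow 1) * Q) = y := by
  have h2 : (2 : GaussianInt) ≠ 0 := by decide
  have hI : (1 + iPow 1 : GaussianInt) ≠ 0 := by decide
  -- `y` is a multiple of `(1 + i) Q`
  have key : ∃ w, y = (1 + iPow 1) * Q * w := by
    obtain ⟨w, hw⟩ := (isEven_iff_exists 1).1 g.isEven_e
    have hII : iPow 1 * iPow 1 = -1 := iPow_mul_self 1
    simp only [act, hw] at hy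
    rcases unit_cases g.u with h | h | h | h
    · exfalso
      apply hg
      apply Motion.ext h
      simp only [h, Units.val_one, one_mul, add_eq_left] at hy
      rw [hw]; simp only [mul_eq_zero] at hy; simp only [one_e, mul_eq_zero]; tauto
    · refine ⟨w, two_mul_inj ?_⟩
      simp only [h, Units.val_neg, Units.val_one] at hy
      linear_combination -hy
    · refine ⟨(1 + iPow 1) * w, mul_left_cancel₀ (a := 1 - iPow 1) (by decide) ?_⟩
      simp only [h, val_iUnit] at hy
      linear_combination -hy + Q * w * (1 + iPow 1) * hII
    · refine ⟨w * (1 - iPow 1), mul_left_cancel₀ (a := 1 + iPow 1) (by decide) ?_⟩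
      simp only [h, val_iUnit, iPow_neg] at hy
      linear_combination -hy + Q * w * (1 + iPow 1) * hII
  obtain ⟨w, rfl⟩ := key
  have hII : iPow 1 * iPow 1 = -1 := iPow_mul_self 1
  -- Up to translations by 2Qe with e even, the multiples of (1 + i)Q by an element divisible by 1 +
  -- i reduce to 0 and 2Q, and the others to the unit multiples of (1 + i)Q.
  by_cases hw : IsEven w
  · obtain ⟨v, rfl⟩ := (isEven_iff_exists 1).1 hw
    by_cases hv : IsEven v
    · refine Or.inl ⟨⟨1, iPow 1 * v, hv.mul_left _⟩, ?_⟩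
      simp only [act, Units.val_one]
      linear_combination (-Q * v) * hII
    · refine Or.inr (Or.inl ⟨⟨1, iPow 1 * v - 1, ?_⟩, ?_⟩)
      · have := (isEven_add_unit_iff (iPow 1 * v) (-1)).2
          (by rwa [← val_iUnit, IsEven.unit_mul_iff])
        simpa [sub_eq_add_neg] using this
      · simp only [act, Units.val_one]
        linear_combination (-Q * v) * hII
  · obtain ⟨w₀, u, hw₀, rfl⟩ := exists_two_mul_even_add_unit hw
    refine Or.inr (Or.inr ⟨⟨u, (1 + iPow 1) * w₀, hw₀.mul_left _⟩, ?_⟩)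
    simp only [act]
    ring

end Folding

namespace Folding

/-! ### Associativity of the folding convolution -/

theorem bar_bar (S : FoldingString) : bar (bar S) = S := by
  simp [bar]

theorem bar_append_cons (S T : FoldingString) (t : ℤˣ) :
    bar (S ++ t :: T) = bar T ++ (-t) :: bar S := by
  simp [bar]

theorem conv_append_cons (A B C : FoldingString) (t : ℤˣ) :
    conv A (B ++ t :: C) = conv A B ++ t :: conv (bar^[B.length + 1] A) C := by
  induction B generalizing A with
  | nil => simp [conv]
  | cons b B ih => simp [conv, ih]

theorem bar_conv (A B : FoldingString) :
    bar (conv A B) = conv (bar^[B.length + 1] A) (bar B) := by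
  induction B generalizing A with
  | nil => simp [conv, bar]
  | cons b B ih =>
    have h1 : bar (b :: B) = bar B ++ (-b) :: [] := bar_append_cons [] B b
    rw [conv, bar_append_cons, ih, h1, conv_append_cons, length_bar, conv]
    have h2 : bar^[B.length + 1] (bar^[(b :: B).length + 1] A) = bar A := by
      have hcomm : bar^[B.length + 1] (bar^[B.length + 1] A) = A := by
        rw [← Function.iterate_add_apply, ← two_mul, Function.iterate_mul]
        exact Function.iterate_fixed (bar_bar A) _
      rw [List.length_cons, Function.iterate_succ_apply' bar (B.length + 1),
        ← Function.iterate_succ_apply, Function.iterate_succ_apply', hcomm]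
    rw [h2]
    simp

theorem conv_assoc (A B C : FoldingString) : conv (conv A B) C = conv A (conv B C) := by
  induction C generalizing A B with
  | nil => simp [conv]
  | cons t C ih => rw [conv, bar_conv, ih, conv, conv_append_cons]

/-- Associativity lets the same string be cut in two ways: into copies of `convPow S n` separated by
the terms of S, and, as needed for self-similarity, into copies of S separated by the terms of
`convPow S n`. -/
theorem convPow_succ' (S : FoldingString) (n : ℕ) : convPow S (n + 1) = conv S (convPow S n) := by
  induction n with
  | zero => simp [convPow, conv, conv_nil_left]
  | succ n ih => rw [convPow, ih, conv_assoc]; exact congrArg _ ih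

theorem conv_getElem?_sep (S T : FoldingString) (q : ℕ) (hq : q < T.length) :
    (conv S T)[q * (S.length + 1) + S.length]? = T[q]? := by
  induction T generalizing S q with
  | nil => simp at hq
  | cons t T ih =>
    rw [conv]
    rcases q with _ | q
    · simp
    · have h := ih (bar S) q (by simpa using hq)
      rw [length_bar] at h
      rw [List.getElem?_append_right (by nlinarith),
        show (q + 1) * (S.length + 1) + S.length - S.length =
          q * (S.length + 1) + S.length + 1 by
            rw [Nat.add_sub_cancel, Nat.succ_mul, Nat.add_assoc], List.getElem?_cons_succ, h]
      simp

theorem conv_getElem?_block (S T : FoldingString) (q k : ℕ) (hq : q ≤ T.length)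
    (hk : k < S.length) :
    (conv S T)[q * (S.length + 1) + k]? = if Even q then S[k]? else (bar S)[k]? := by
  induction T generalizing S q with
  | nil =>
    have : q = 0 := by simpa using hq
    subst this; simp [conv]
  | cons t T ih =>
    rw [conv]
    rcases q with _ | q
    · simp [List.getElem?_append_left hk]
    · have h := ih (bar S) q (by simpa using hq) (by rwa [length_bar])
      rw [length_bar, bar_bar] at h
      rw [List.getElem?_append_right (by nlinarith),
        show (q + 1) * (S.length + 1) + k - S.length = q * (S.length + 1) + k + 1 by
          rw [Nat.succ_mul]; omega, List.getElem?_cons_succ, h]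
      by_cases hq : Even q <;> simp [hq, Nat.even_add_one]

/-! ### Self-similar sequences of turns -/

/-- `a` consists of blocks of `N - 1` terms, alternately equal to the initial block and to its
reverse with opposite signs, which are separated by the terms of `a` itself. -/
structure TurnRule (a : ℕ → ℤˣ) (N : ℕ) : Prop where
  pos : 0 < N
  even : ∀ q k, Even q → k + 1 < N → a (q * N + k) = a k
  odd : ∀ q k, ¬ Even q → k + 1 < N → a (q * N + k) = -a (N - 2 - k)
  sep : ∀ q, a (q * N + (N - 1)) = a q

theorem turnRule_one (a : ℕ → ℤˣ) : TurnRule a 1 :=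
  ⟨one_pos, by intros; omega, by intros; omega, by simp⟩

theorem TurnRule.mul {a : ℕ → ℤˣ} {M N : ℕ} (hM : TurnRule a M) (hN : TurnRule a N) :
    TurnRule a (M * N) := by
  have hM0 := hM.pos
  have hN0 := hN.pos
  -- the index `q M N + r` with `r = j N + k`
  have decomp : ∀ r, r < M * N → ∃ j k, j < M ∧ k < N ∧ r = j * N + k := fun r hr =>
    ⟨r / N, r % N, (Nat.div_lt_iff_lt_mul hN0).2 hr, Nat.mod_lt _ hN0, by
      rw [mul_comm]; exact (Nat.div_add_mod r N).symm⟩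
  have assoc : ∀ q j k, q * (M * N) + (j * N + k) = (q * M + j) * N + k := by intros; ring
  refine ⟨Nat.mul_pos hM0 hN0, ?_, ?_, ?_⟩
  · intro q r hq hr
    obtain ⟨j, k, hj, hk, rfl⟩ := decomp r (by omega)
    rw [assoc]
    have hpar : Even (q * M + j) ↔ Even j := by
      rw [Nat.even_add]; simp [hq]
    rcases Nat.lt_or_ge (k + 1) N with hk1 | hk1
    · by_cases hj2 : Even j
      · rw [hN.even _ _ (hpar.2 hj2) hk1, hN.even _ _ hj2 hk1]
      · rw [hN.odd _ _ (fun h => hj2 (hpar.1 h)) hk1, hN.odd _ _ hj2 hk1]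
    · obtain rfl : k = N - 1 := by omega
      have hj1 : j + 1 < M := by
        by_contra hc
        have : M = j + 1 := by omega
        subst this
        rw [add_mul] at hr; omega
      rw [hN.sep, hN.sep, hM.even _ _ hq hj1]
  · intro q r hq hr
    obtain ⟨j, k, hj, hk, rfl⟩ := decomp r (by omega)
    rw [assoc]
    obtain ⟨l, rfl⟩ : ∃ l, M = j + 1 + l := ⟨M - j - 1, by omega⟩
    -- Reversal exchanges the small blocks of indices j and l, where M = j + 1 + l. As q is odd, q *
    -- M + j has the parity opposite to that of l.
    have hpar : Even (q * (j + 1 + l) + j) ↔ ¬ Even l := by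
      simp only [Nat.even_add, Nat.even_mul, hq, Nat.not_even_one, false_or]; tauto
    rcases Nat.lt_or_ge (k + 1) N with hk1 | hk1
    · have e : (j + 1 + l) * N - 2 - (j * N + k) = l * N + (N - 2 - k) := by
        have : (j + 1 + l) * N = j * N + N + l * N := by ring
        omega
      rw [e]
      have hk2 : N - 2 - k + 1 < N := by omega
      by_cases hl : Even l
      · rw [hN.odd _ _ (fun h => hpar.1 h hl) hk1, hN.even _ _ hl hk2]
      · rw [hN.even _ _ (hpar.2 hl) hk1, hN.odd _ _ hl hk2, neg_neg]
        congr 1; omega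
    · obtain rfl : k = N - 1 := by omega
      rcases l with _ | l
      · rw [add_zero, add_mul] at hr; omega
      · have e : (j + 1 + (l + 1)) * N - 2 - (j * N + (N - 1)) = l * N + (N - 1) := by
          have : (j + 1 + (l + 1)) * N = j * N + N + l * N + N := by ring
          omega
        rw [e, hN.sep, hN.sep, hM.odd _ _ hq (by omega)]
        congr 2; omega
  · intro q
    have e : q * (M * N) + (M * N - 1) = (q * M + (M - 1)) * N + (N - 1) := by
      obtain ⟨M', rfl⟩ : ∃ M', M = M' + 1 := ⟨M - 1, by omega⟩
      have h1 : (M' + 1) * N = M' * N + N := by ring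
      have h2 : (q * (M' + 1) + M') * N = q * ((M' + 1) * N) + M' * N := by ring
      rw [Nat.add_sub_cancel, h2, h1]; omega
    rw [e, hN.sep, hM.sep]

theorem TurnRule.pow {a : ℕ → ℤˣ} {m : ℕ} (h : TurnRule a m) (n : ℕ) : TurnRule a (m ^ n) := by
  induction n with
  | zero => simpa using turnRule_one a
  | succ n ih => rw [pow_succ]; exact ih.mul h

theorem turnRule_infPow {S : FoldingString} (hS : S ≠ []) : TurnRule (infPow S) (S.length + 1) := by
  have val : ∀ {n k}, k < (convPow S n).length → ∀ {b}, (convPow S n)[k]? = some b →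
      infPow S k = b := fun hk b hb => by
    rw [convPow_getElem? hS hk] at hb; simpa using hb
  have hS1 : ∀ k (hk : k < S.length), S[k]? = some (infPow S k) := fun k hk => by
    have := convPow_getElem? hS (n := 1) (k := k) (by rwa [convPow_one])
    rwa [convPow_one] at this
  have len : ∀ q r, r ≤ S.length → q * (S.length + 1) + r < (convPow S (q + 1 + 1)).length := by
    intro q r hr
    have := le_length_convPow hS (q + 1)
    rw [convPow_succ', length_conv]
    nlinarith
  have hq : ∀ q, q < (convPow S (q + 1)).length := fun q => le_length_convPow hS (q + 1)
  refine ⟨by omega, ?_, ?_, ?_⟩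
  · intro q k he hk
    refine val (len q k (by omega)) ?_
    rw [convPow_succ', conv_getElem?_block _ _ _ _ (hq q).le (by omega), if_pos he,
      hS1 k (by omega)]
  · intro q k he hk
    refine val (len q k (by omega)) ?_
    rw [convPow_succ', conv_getElem?_block _ _ _ _ (hq q).le (by omega), if_neg he, bar,
      List.getElem?_reverse (by simp; omega), List.getElem?_map, List.length_map,
      show S.length - 1 - k = S.length + 1 - 2 - k by omega, hS1 _ (by omega)]
    rfl
  · intro q
    refine val (len q _ (by omega)) ?_
    rw [convPow_succ', Nat.add_sub_cancel, conv_getElem?_sep _ _ _ (hq q),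
      convPow_getElem? hS (hq q)]

/-! ### The curve with given turns -/

/-- The direction of the `k`-th segment of the curve with turns `a`, whose first direction is
`1`. -/
def dirSeq (a : ℕ → ℤˣ) : ℕ → GaussianIntˣ
  | 0 => 1
  | k + 1 => iUnit (a k) * dirSeq a k

/-- The `k`-th vertex of the curve with turns `a`, first direction `1` and origin `0`. -/
def ptSeq (a : ℕ → ℤˣ) : ℕ → GaussianInt
  | 0 => 0
  | k + 1 => ptSeq a k + dirSeq a k

/-- The middle of the `k`-th segment, in doubled coordinates. -/
def midSeq (a : ℕ → ℤˣ) (k : ℕ) : GaussianInt := 2 * ptSeq a k + dirSeq a k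

variable {a : ℕ → ℤˣ}

theorem dirSeq_zero : dirSeq a 0 = 1 := rfl
theorem dirSeq_succ (k : ℕ) : dirSeq a (k + 1) = iUnit (a k) * dirSeq a k := rfl
theorem ptSeq_zero : ptSeq a 0 = 0 := rfl
theorem ptSeq_succ (k : ℕ) : ptSeq a (k + 1) = ptSeq a k + dirSeq a k := rfl

theorem ptSeq_one : ptSeq a 1 = 1 := by simp [ptSeq, dirSeq]

theorem midSeq_zero : midSeq a 0 = 1 := by simp [midSeq, ptSeq, dirSeq]

theorem midSeq_eq_sub (k : ℕ) : midSeq a k = 2 * ptSeq a (k + 1) - dirSeq a k := by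
  rw [midSeq, ptSeq_succ]; ring

theorem isEven_ptSeq (k : ℕ) : IsEven (ptSeq a k) ↔ Even k := by
  induction k with
  | zero => simp [ptSeq, isEven_zero]
  | succ k ih => rw [ptSeq_succ, isEven_add_unit_iff, ih, Nat.even_add_one]

theorem not_isEven_midSeq (k : ℕ) : ¬ IsEven (midSeq a k) := by
  rw [midSeq, isEven_add_unit_iff, not_not]; exact isEven_two_mul _

/-- The motion which maps the initial part of a self-similar curve to its `q`-th block. -/
def blockMotion (a : ℕ → ℤˣ) (q : ℕ) : Motion :=
  if h : Even q then ⟨dirSeq a q, ptSeq a q, (isEven_ptSeq q).2 h⟩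
  else ⟨-dirSeq a q, ptSeq a (q + 1), (isEven_ptSeq (q + 1)).2 (Nat.even_add_one.2 h)⟩

/-- The motion of the q-th block is the one named by the q-th edge: e is the even end of this edge
and u points to its other end. This is why an odd block is described from its final end. -/
theorem midSeq_eq_blockMotion (q : ℕ) :
    midSeq a q = 2 * (blockMotion a q).e + (blockMotion a q).u := by
  unfold blockMotion
  split_ifs with h
  · rfl
  · rw [midSeq_eq_sub, Units.val_neg, sub_eq_add_neg]

namespace TurnRule

variable {N : ℕ}

theorem dirSeq_block (h : TurnRule a N) (q : ℕ) :
    (Even q → ∀ k < N, dirSeq a (q * N + k) = dirSeq a q * dirSeq a k) ∧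
      (¬ Even q → ∀ k < N, dirSeq a (q * N + k) = dirSeq a q * dirSeq a (N - 1 - k)) := by
  have hN := h.pos
  -- the start of a block determines the block
  have he : ∀ q, Even q → dirSeq a (q * N) = dirSeq a q →
      ∀ k < N, dirSeq a (q * N + k) = dirSeq a q * dirSeq a k := by
    intro q hq h0 k
    induction k with
    | zero => intro _; simp [h0, dirSeq_zero]
    | succ k ih =>
      intro hk
      rw [← add_assoc, dirSeq_succ, ih (by omega), h.even q k hq hk, dirSeq_succ, mul_left_comm]
  have ho : ∀ q, ¬ Even q → dirSeq a (q * N) = dirSeq a q * dirSeq a (N - 1) →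
      ∀ k < N, dirSeq a (q * N + k) = dirSeq a q * dirSeq a (N - 1 - k) := by
    intro q hq h0 k
    induction k with
    | zero => intro _; simpa using h0
    | succ k ih =>
      intro hk
      rw [← add_assoc, dirSeq_succ, ih (by omega), h.odd q k hq hk,
        show N - 1 - k = N - 2 - k + 1 by omega, dirSeq_succ, ← iUnit_inv,
        show N - 1 - (k + 1) = N - 2 - k by omega, mul_left_comm, ← mul_assoc (_)⁻¹]
      simp
  have start : ∀ q, (Even q → dirSeq a (q * N) = dirSeq a q) ∧
      (¬ Even q → dirSeq a (q * N) = dirSeq a q * dirSeq a (N - 1)) := by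
    intro q
    induction q with
    | zero => simp
    | succ q ih =>
      have hstep : dirSeq a ((q + 1) * N) = iUnit (a q) * dirSeq a (q * N + (N - 1)) := by
        rw [← h.sep q, ← dirSeq_succ]
        congr 1; rw [add_mul]; omega
      constructor
      · intro hq
        have hq' : ¬ Even q := by rwa [Nat.even_add_one] at hq
        rw [hstep, ho q hq' (ih.2 hq') _ (by omega), Nat.sub_self, dirSeq_zero, mul_one, dirSeq_succ]
      · intro hq
        have hq' : Even q := by rwa [Nat.even_add_one, not_not] at hq
        rw [hstep, he q hq' (ih.1 hq') _ (by omega), dirSeq_succ, mul_assoc]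
  exact ⟨fun hq => he q hq ((start q).1 hq), fun hq => ho q hq ((start q).2 hq)⟩

/-- The ends of the blocks reproduce the curve itself, multiplied by `ptSeq a N`; an odd block is a
copy of the initial one travelled backwards. -/
theorem ptSeq_block (h : TurnRule a N) (q : ℕ) :
    (Even q → ∀ k ≤ N, ptSeq a (q * N + k) = ptSeq a N * ptSeq a q + dirSeq a q * ptSeq a k) ∧
      (¬ Even q → ∀ k ≤ N, ptSeq a (q * N + k) =
        ptSeq a N * ptSeq a (q + 1) - dirSeq a q * ptSeq a (N - k)) := by
  have he : ∀ q, Even q → ptSeq a (q * N) = ptSeq a N * ptSeq a q → ∀ k ≤ N,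
      ptSeq a (q * N + k) = ptSeq a N * ptSeq a q + dirSeq a q * ptSeq a k := by
    intro q hq h0 k
    induction k with
    | zero => intro _; simp [h0, ptSeq_zero]
    | succ k ih =>
      intro hk
      rw [← add_assoc, ptSeq_succ, ih (by omega), (h.dirSeq_block q).1 hq k (by omega),
        ptSeq_succ, Units.val_mul]
      ring
  have ho : ∀ q, ¬ Even q → ptSeq a (q * N) = ptSeq a N * ptSeq a q → ∀ k ≤ N,
      ptSeq a (q * N + k) = ptSeq a N * ptSeq a (q + 1) - dirSeq a q * ptSeq a (N - k) := by
    intro q hq h0 k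
    induction k with
    | zero => intro _; rw [add_zero, h0, ptSeq_succ, Nat.sub_zero]; ring
    | succ k ih =>
      intro hk
      rw [← add_assoc, ptSeq_succ, ih (by omega), (h.dirSeq_block q).2 hq k (by omega),
        show N - k = (N - 1 - k) + 1 by omega, ptSeq_succ (N - 1 - k),
        show N - (k + 1) = N - 1 - k by omega, Units.val_mul]
      ring
  have start : ∀ q, ptSeq a (q * N) = ptSeq a N * ptSeq a q := by
    intro q
    induction q with
    | zero => simp [ptSeq_zero]
    | succ q ih =>
      by_cases hq : Even q
      · rw [add_mul, one_mul, he q hq ih N le_rfl, ptSeq_succ]; ring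
      · rw [add_mul, one_mul, ho q hq ih N le_rfl, Nat.sub_self, ptSeq_zero]; ring
  exact ⟨fun hq => he q hq (start q), fun hq => ho q hq (start q)⟩

theorem ptSeq_mul (h : TurnRule a N) (q : ℕ) : ptSeq a (q * N) = ptSeq a N * ptSeq a q := by
  by_cases hq : Even q
  · simpa [ptSeq_zero] using (h.ptSeq_block q).1 hq 0 (by omega)
  · have := (h.ptSeq_block q).2 hq 0 (by omega)
    rw [add_zero, Nat.sub_zero, ptSeq_succ] at this
    rw [this]; ring

theorem midSeq_even (h : TurnRule a N) {q k : ℕ} (hq : Even q) (hk : k < N) :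
    midSeq a (q * N + k) = (blockMotion a q).act (ptSeq a N) (midSeq a k) := by
  rw [midSeq, (h.ptSeq_block q).1 hq k hk.le, (h.dirSeq_block q).1 hq k hk, blockMotion, dif_pos hq,
    Motion.act, midSeq, Units.val_mul]
  ring

theorem midSeq_odd (h : TurnRule a N) {q k : ℕ} (hq : ¬ Even q) (hk : k < N) :
    midSeq a (q * N + k) = (blockMotion a q).act (ptSeq a N) (midSeq a (N - 1 - k)) := by
  rw [midSeq, (h.ptSeq_block q).2 hq k hk.le, (h.dirSeq_block q).2 hq k hk, blockMotion, dif_neg hq,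
    Motion.act, midSeq_eq_sub, Units.val_mul, Units.val_neg, show N - 1 - k + 1 = N - k by omega]
  ring

/-- The index, in the initial block, of the segment which corresponds to the `k`-th segment of the
`q`-th block. -/
def blockIndex (N q k : ℕ) : ℕ := if Even q then k else N - 1 - k

theorem midSeq_block (h : TurnRule a N) (q : ℕ) {k : ℕ} (hk : k < N) :
    midSeq a (q * N + blockIndex N q k) = (blockMotion a q).act (ptSeq a N) (midSeq a k) := by
  unfold blockIndex
  split_ifs with hq
  · exact h.midSeq_even hq hk
  · rw [h.midSeq_odd hq (by omega)]; congr 2; omega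

theorem blockIndex_lt {N q k : ℕ} (hk : k < N) : blockIndex N q k < N := by
  unfold blockIndex; split_ifs <;> omega

theorem blockIndex_blockIndex {N q k : ℕ} (hk : k < N) :
    blockIndex N q (blockIndex N q k) = k := by
  unfold blockIndex; split_ifs <;> omega

end TurnRule

end Folding

namespace Folding

/-! ### Middles of segments -/

/-- The middle of a segment, in doubled coordinates. -/
def Segment.mid (A : Segment) : GaussianInt := 2 * A.start + A.dir

theorem mid_eq_cases {x x' : GaussianInt} {u u' : GaussianIntˣ} (h : 2 * x + u = 2 * x' + u') :
    (x' = x ∧ u' = u) ∨ (x' = x + u ∧ u' = -u) := by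
  by_cases hp : IsEven (x' - x)
  · obtain ⟨h1, h2⟩ := two_mul_even_add_unit_inj (w := 0) (w' := x' - x) (u := u) (u' := u')
      isEven_zero hp (by linear_combination h)
    exact Or.inl ⟨by linear_combination -h1, h2.symm⟩
  · obtain ⟨h1, h2⟩ := two_mul_even_add_unit_inj (w := 0) (w' := x' - x + (-u : GaussianIntˣ))
      (u := -u) (u' := u') isEven_zero ((isEven_add_unit_iff _ _).2 hp)
      (by push_cast; linear_combination h)
    push_cast at h1
    exact Or.inr ⟨by linear_combination -h1, h2.symm⟩

theorem Segment.support_eq_iff (A B : Segment) : A.support = B.support ↔ A.mid = B.mid := by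
  obtain ⟨x, d, u, rfl⟩ := A
  obtain ⟨x', d', u', rfl⟩ := B
  simp only [Segment.support, Segment.endPt, Segment.mid, Sym2.eq_iff]
  constructor
  · rintro (⟨h1, h2⟩ | ⟨h1, h2⟩)
    · linear_combination h1 + h2
    · linear_combination h1 + h2
  · intro h
    rcases mid_eq_cases h with ⟨h1, h2⟩ | ⟨h1, h2⟩
    · exact Or.inl ⟨h1.symm, by rw [h1, h2]⟩
    · exact Or.inr ⟨by rw [h1, h2]; simp, h1.symm⟩

theorem Segment.support_mem_unitIntervals (A : Segment) : A.support ∈ unitIntervals := by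
  obtain ⟨x, d, hd⟩ := A
  simp only [Segment.support, Segment.endPt, unitIntervals, Set.mem_ofPred_eq]
  rcases isUnit_cases hd with rfl | rfl | rfl | rfl
  · exact ⟨x, Or.inl rfl⟩
  · exact ⟨x + -1, Or.inl (by rw [Sym2.eq_swap]; simp)⟩
  · exact ⟨x, Or.inr rfl⟩
  · exact ⟨x + iPow (-1), Or.inr (by rw [Sym2.eq_swap, iPow_neg]; simp)⟩

theorem exists_support_eq {e : Sym2 GaussianInt} (he : e ∈ unitIntervals) :
    ∃ A : Segment, A.support = e := by
  obtain ⟨z, rfl | rfl⟩ := he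
  · exact ⟨⟨z, 1, isUnit_one⟩, rfl⟩
  · exact ⟨⟨z, iPow 1, isUnit_iPow 1⟩, rfl⟩

theorem Segment.not_isEven_mid (A : Segment) : ¬ IsEven A.mid := by
  obtain ⟨x, d, u, rfl⟩ := A
  rw [Segment.mid, isEven_add_unit_iff, not_not]; exact isEven_two_mul _

theorem CoversSquare.exists_mid {c : ℕ → Segment} {x : GaussianInt} {r : ℕ}
    (h : CoversSquare {c} x r) {A : Segment} (h1 : A.start ∈ square x r)
    (h2 : A.endPt ∈ square x r) : ∃ k, (c k).mid = A.mid := by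
  obtain ⟨p, ⟨hp1, hp2⟩, -⟩ := h A.support ⟨A.support_mem_unitIntervals, by
    intro z hz
    rcases Sym2.mem_iff.1 hz with rfl | rfl <;> assumption⟩
  rw [Set.mem_singleton_iff] at hp1
  exact ⟨p.2, (Segment.support_eq_iff _ _).1 (by rw [← hp2, hp1])⟩

/-- The curve with turns `a`, origin `0` and first direction `1`. -/
def stdRay (a : ℕ → ℤˣ) (k : ℕ) : Segment := ⟨ptSeq a k, dirSeq a k, (dirSeq a k).isUnit⟩

theorem isRayOf_stdRay (a : ℕ → ℤˣ) : IsRayOf a (stdRay a) := fun _ => ⟨rfl, rfl⟩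

/-! ### The tiling by the images of the initial part of the curve -/

/-- The images under the motions at scale `ptSeq a N` of the first `N` segments of the curve
cover each unit interval exactly once. -/
structure IsTiling (a : ℕ → ℤˣ) (N : ℕ) : Prop where
  pos : 0 < N
  cover : ∀ y, ¬ IsEven y → ∃ (g : Motion) (k : ℕ), k < N ∧ g.act (ptSeq a N) (midSeq a k) = y
  inj : ∀ (g g' : Motion) (k k' : ℕ), k < N → k' < N →
    g.act (ptSeq a N) (midSeq a k) = g'.act (ptSeq a N) (midSeq a k') → g = g' ∧ k = k'

/-- The curve with turns `a` covers arbitrarily large squares. -/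
def FillsSquares (a : ℕ → ℤˣ) : Prop :=
  ∀ r : ℕ, 0 < r → ∃ x : GaussianInt, ∀ A : Segment, A.start ∈ square x r → A.endPt ∈ square x r →
    ∃ k, midSeq a k = A.mid

theorem FillsSquares.exists_translate {a : ℕ → ℤˣ} (h : FillsSquares a) (A B : Segment) :
    ∃ (t : GaussianInt) (k l : ℕ), IsEven t ∧ midSeq a k = A.mid + 2 * t ∧
      midSeq a l = B.mid + 2 * t := by
  obtain ⟨b, hb⟩ : ∃ b : ℕ, ∀ z ∈ [A.start, A.endPt, B.start, B.endPt],
      |z.re| ≤ b ∧ |z.im| ≤ b := by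
    refine ⟨([A.start, A.endPt, B.start, B.endPt].map fun z => z.re.natAbs + z.im.natAbs).sum, ?_⟩
    intro z hz
    have := List.single_le_sum (l := [A.start, A.endPt, B.start, B.endPt].map
      fun z => z.re.natAbs + z.im.natAbs) (by simp) _ (List.mem_map_of_mem hz)
    rw [Int.abs_eq_natAbs, Int.abs_eq_natAbs]
    omega
  obtain ⟨x, hx⟩ := h (2 * b + 1) (by omega)
  -- Only even translations are motions; the side 2b + 1, instead of 2b, leaves the unit of room
  -- needed to correct the parity of t.
  obtain ⟨t, ht, h1, h2, h3⟩ : ∃ t : GaussianInt, IsEven t ∧ x.re + b ≤ t.re ∧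
      t.re ≤ x.re + b + 1 ∧ t.im = x.im + b := by
    by_cases hp : Even (x.re + b + (x.im + b))
    · exact ⟨⟨x.re + b, x.im + b⟩, hp, le_rfl, by simp, rfl⟩
    · refine ⟨⟨x.re + b + 1, x.im + b⟩, ?_, by simp, le_rfl, rfl⟩
      unfold IsEven
      rw [Int.even_iff] at *
      simp only at *
      omega
  have key : ∀ z ∈ [A.start, A.endPt, B.start, B.endPt], z + t ∈ square x (2 * b + 1) := by
    intro z hz
    obtain ⟨h4, h5⟩ := hb z hz
    rw [abs_le] at h4 h5
    simp only [square, Set.mem_ofPred_eq, Zsqrtd.re_add, Zsqrtd.im_add]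
    push_cast
    omega
  have trans : ∀ A : Segment, A.start + t ∈ square x (2 * b + 1) →
      A.endPt + t ∈ square x (2 * b + 1) → ∃ k, midSeq a k = A.mid + 2 * t := by
    intro A h1 h2
    obtain ⟨k, hk⟩ := hx (A.translate t) h1 (by
      have : (A.translate t).endPt = A.endPt + t := by
        simp only [Segment.endPt, Segment.translate]; ring
      rwa [this])
    refine ⟨k, hk.trans ?_⟩
    simp only [Segment.mid, Segment.translate]; ring
  obtain ⟨k, hk⟩ := trans A (key _ (by simp)) (key _ (by simp))
  obtain ⟨l, hl⟩ := trans B (key _ (by simp)) (key _ (by simp))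
  exact ⟨t, k, l, ht, hk, hl⟩

theorem FillsSquares.exists_translate_mul {a : ℕ → ℤˣ} (h : FillsSquares a) {K : ℕ} (hK : 0 < K)
    (A : Segment) : ∃ (t : GaussianInt) (k : ℕ), midSeq a k = A.mid + 2 * (K * t) := by
  obtain ⟨x, hx⟩ := h (K + 2) (by omega)
  have hK' : (0 : ℤ) < K := by exact_mod_cast hK
  -- This reduces modulo K the coordinates of the start relative to x + 1 + i. The side K + 2 leaves
  -- a margin of one unit for the end of the segment.
  set t : GaussianInt := ⟨-((A.start.re - x.re - 1) / K), -((A.start.im - x.im - 1) / K)⟩ with ht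
  have e1 := Int.emod_add_mul_ediv (A.start.re - x.re - 1) K
  have e2 := Int.emod_add_mul_ediv (A.start.im - x.im - 1) K
  have m1 := Int.emod_nonneg (A.start.re - x.re - 1) hK'.ne'
  have m2 := Int.emod_nonneg (A.start.im - x.im - 1) hK'.ne'
  have m3 := Int.emod_lt_of_pos (A.start.re - x.re - 1) hK'
  have m4 := Int.emod_lt_of_pos (A.start.im - x.im - 1) hK'
  have r1 : ((K : GaussianInt) * t).re = -(K * ((A.start.re - x.re - 1) / K)) := by
    rw [ht]; simp
  have r2 : ((K : GaussianInt) * t).im = -(K * ((A.start.im - x.im - 1) / K)) := by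
    rw [ht]; simp
  have hd : |A.dir.re| ≤ 1 ∧ |A.dir.im| ≤ 1 := by
    rcases isUnit_cases A.isUnit_dir with h | h | h | h <;> rw [h] <;> simp [iPow]
  rw [abs_le, abs_le] at hd
  obtain ⟨k, hk⟩ := hx (A.translate (K * t))
    (by
      simp only [Segment.translate, square, Set.mem_ofPred_eq, Zsqrtd.re_add, Zsqrtd.im_add, r1, r2]
      push_cast
      omega)
    (by
      simp only [Segment.translate, Segment.endPt, square, Set.mem_ofPred_eq, Zsqrtd.re_add,
        Zsqrtd.im_add, r1, r2]
      push_cast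
      omega)
  refine ⟨t, k, hk.trans ?_⟩
  simp only [Segment.mid, Segment.translate]; ring

theorem exists_segment_mid {y : GaussianInt} (hy : ¬ IsEven y) : ∃ A : Segment, A.mid = y := by
  obtain ⟨w, u, -, rfl⟩ := exists_two_mul_even_add_unit hy
  exact ⟨⟨w, u, u.isUnit⟩, rfl⟩

/-- The block of index `q` is determined by the motion: it is the image of the `q`-th segment. -/
theorem blockMotion_eq {a : ℕ → ℤˣ} {q : ℕ} {g : Motion} (h : midSeq a q = 2 * g.e + g.u) :
    blockMotion a q = g := by
  rw [midSeq_eq_blockMotion] at h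
  obtain ⟨h1, h2⟩ := two_mul_even_add_unit_inj (blockMotion a q).isEven_e g.isEven_e h
  exact Motion.ext h2 h1

section

variable {a : ℕ → ℤˣ} {N : ℕ}

/-- The edges which name g and g' can be translated together into the curve, as its q-th and q'-th
segments. The same translation, at scale `ptSeq a N`, makes the two tiles the q-th and q'-th blocks
of the curve, which have no common edge unless they coincide. -/
theorem TurnRule.tiling_inj (h : TurnRule a N) (hf : FillsSquares a)
    (hi : Function.Injective (midSeq a)) (g g' : Motion) (k k' : ℕ) (hk : k < N) (hk' : k' < N)
    (he : g.act (ptSeq a N) (midSeq a k) = g'.act (ptSeq a N) (midSeq a k')) :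
    g = g' ∧ k = k' := by
  obtain ⟨t, q, q', ht, hq, hq'⟩ :=
    hf.exists_translate ⟨g.e, g.u, g.u.isUnit⟩ ⟨g'.e, g'.u, g'.u.isUnit⟩
  have e1 : blockMotion a q = ⟨1, t, ht⟩ * g :=
    blockMotion_eq (hq.trans (by simp [Segment.mid]; ring))
  have e2 : blockMotion a q' = ⟨1, t, ht⟩ * g' :=
    blockMotion_eq (hq'.trans (by simp [Segment.mid]; ring))
  have e3 : q * N + blockIndex N q k = q' * N + blockIndex N q' k' := hi (by
    rw [h.midSeq_block q hk, h.midSeq_block q' hk', e1, e2, Motion.act_mul, Motion.act_mul, he])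
  have l1 := blockIndex_lt (q := q) hk
  have l2 := blockIndex_lt (q := q') hk'
  have hqq : q = q' := by
    have h1 : (q * N + blockIndex N q k) / N = (q' * N + blockIndex N q' k') / N := by rw [e3]
    rwa [mul_comm, Nat.mul_add_div h.pos, Nat.div_eq_of_lt l1, mul_comm q', Nat.mul_add_div h.pos,
      Nat.div_eq_of_lt l2, add_zero, add_zero] at h1
  subst hqq
  refine ⟨mul_left_cancel (e1.symm.trans e2), ?_⟩
  rw [← blockIndex_blockIndex (q := q) hk, ← blockIndex_blockIndex (q := q) hk']
  congr 1; omega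

theorem TurnRule.isTiling (h : TurnRule a N) (hf : FillsSquares a)
    (hi : Function.Injective (midSeq a)) : IsTiling a N := by
  have inj := h.tiling_inj hf hi
  refine ⟨h.pos, ?_, inj⟩
  have hQ : ptSeq a N ≠ 0 := by
    intro hQ
    have := (inj 1 ⟨1, 2, by simpa using isEven_two_mul 1⟩ 0 0 h.pos h.pos (by
      simp [hQ, Motion.act])).1
    exact absurd (congrArg Motion.e this) (by simp only [Motion.one_e]; decide)
  intro y hy
  obtain ⟨A, rfl⟩ := exists_segment_mid hy
  set Q := ptSeq a N
  have hpos : 0 < Q.norm := by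
    rcases lt_or_eq_of_le (Zsqrtd.norm_nonneg (by norm_num) Q) with h | h
    · exact h
    · exact absurd ((Zsqrtd.norm_eq_zero_iff (by norm_num) _).1 h.symm) hQ
  -- The modulus is 2 * Q * star Q, so that the translation is 2Q times the even element 2 * star Q
  -- * t and is a motion. The translated edge lies in a block of the curve, and the inverse
  -- translation of this block is the required tile.
  obtain ⟨t, l, hl⟩ := hf.exists_translate_mul (K := 2 * Q.norm.natAbs) (by omega) A
  have hn : ((2 * Q.norm.natAbs : ℕ) : GaussianInt) = 2 * (Q * star Q) := by
    rw [← Zsqrtd.norm_eq_mul_conj]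
    push_cast
    congr 1
    rw [← Int.cast_natCast, Int.natAbs_of_nonneg hpos.le]
  rw [hn] at hl
  have hlt : l % N < N := Nat.mod_lt _ h.pos
  have e := h.midSeq_block (l / N) (blockIndex_lt (q := l / N) hlt)
  rw [blockIndex_blockIndex hlt, mul_comm, Nat.div_add_mod, hl] at e
  have he : IsEven (-(2 * (star Q * t))) := (isEven_two_mul _).neg
  refine ⟨⟨1, _, he⟩ * blockMotion a (l / N), _, blockIndex_lt (q := l / N) hlt, ?_⟩
  rw [Motion.act_mul, ← e]
  simp only [Motion.act, Units.val_one]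
  ring

theorem IsTiling.ptSeq_ne_zero (h : IsTiling a N) : ptSeq a N ≠ 0 := by
  intro hQ
  have := (h.inj 1 ⟨1, 2, by simpa using isEven_two_mul 1⟩ 0 0 h.pos h.pos (by
    simp [hQ, Motion.act])).1
  exact absurd (congrArg Motion.e this) (by simp only [Motion.one_e]; decide)

/-- If Q were a unit, every even translation would be available at scale Q, and some motion would
carry the first edge of the tile to the second one. -/
theorem IsTiling.one_lt_norm (h : IsTiling a N) (hN : 1 < N) : 1 < (ptSeq a N).norm := by
  have h0 := h.ptSeq_ne_zero
  by_contra hc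
  have hnn := Zsqrtd.norm_nonneg (d := -1) (by norm_num) (ptSeq a N)
  have h1 : (ptSeq a N).norm = 1 := by
    rcases eq_or_ne (ptSeq a N).norm 0 with h2 | h2
    · exact absurd ((Zsqrtd.norm_eq_zero_iff (by norm_num) _).1 h2) h0
    · omega
  obtain ⟨v, hv⟩ := (Zsqrtd.norm_eq_one_iff' (by norm_num) _).1 h1
  have he : IsEven ((v⁻¹ : GaussianIntˣ) * (1 + (dirSeq a 1 : GaussianInt))) := by
    refine IsEven.mul_left _ ((isEven_add_unit_iff _ _).2 ?_)
    simpa using not_isEven_unit 1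
  have := (h.inj ⟨-dirSeq a 1, _, he⟩ 1 0 1 h.pos hN (by
    rw [Motion.act_one, midSeq_zero, midSeq, ptSeq_one, ← hv, Motion.act]
    have : (v : GaussianInt) * (v⁻¹ : GaussianIntˣ) = 1 := v.mul_inv
    push_cast
    linear_combination (2 + 2 * (dirSeq a 1 : GaussianInt)) * this)).2
  omega

end

end Folding

namespace Folding

/-! ### Contours of trees -/

/-- If a closed walk of length `2E` follows each of its edges once in each direction and visits at
least `E + 1` vertices, then it is the contour of a tree: the walk between two passages along an
edge has no vertex in common with the rest. -/
theorem contour_disjoint {V : Type*} {lo hi : ℤ} {E : ℕ} (hE : hi - lo = 2 * E) {f : ℤ → V}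
    (hclosed : f lo = f hi) {τ : ℤ → ℤ} (hτ : ∀ j ∈ Finset.Ico lo hi, τ j ∈ Finset.Ico lo hi)
    (hττ : ∀ j ∈ Finset.Ico lo hi, τ (τ j) = j) (hne : ∀ j ∈ Finset.Ico lo hi, τ j ≠ j)
    (hf1 : ∀ j ∈ Finset.Ico lo hi, f (τ j) = f (j + 1))
    (hf2 : ∀ j ∈ Finset.Ico lo hi, f (τ j + 1) = f j)
    (hcard : E + 1 ≤ (f '' Set.Icc lo hi).ncard) {j p q : ℤ} (hj : j ∈ Finset.Ico lo hi)
    (hjp : j < p) (hp : p ≤ τ j) (hq : q ∈ Set.Icc lo hi) (hqj : q ≤ j ∨ τ j < q) :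
    f p ≠ f q := by
  classical
  intro hpq
  have hτj := hτ j hj
  rw [Finset.mem_Ico] at hj hτj
  let W := f '' Set.Icc lo hi
  have hfin : W.Finite := (Set.finite_Icc lo hi).image f
  have : Finite W := hfin
  let ν : Set.Icc lo hi → W := fun i => ⟨f i, i, i.2, rfl⟩
  let step : ℤ → Sym2 V := fun i => s(f i, f (i + 1))
  let I : Finset ℤ := {i ∈ Finset.Ico lo hi | i < τ i}
  have hI : 2 * I.card = 2 * E := by
    have h1 : ({i ∈ Finset.Ico lo hi | ¬ i < τ i} : Finset ℤ).card = I.card := by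
      refine Finset.card_bij' (fun i _ => τ i) (fun i _ => τ i) ?_ ?_ ?_ ?_
      · intro i hi'
        rw [Finset.mem_filter] at hi' ⊢
        exact ⟨hτ i hi'.1, by rw [hττ i hi'.1]; exact lt_of_le_of_ne (not_lt.1 hi'.2) (hne i hi'.1)⟩
      · intro i hi'
        rw [Finset.mem_filter] at hi' ⊢
        exact ⟨hτ i hi'.1, by rw [hττ i hi'.1]; exact not_lt.2 hi'.2.le⟩
      · intro i hi'; exact hττ i (Finset.mem_filter.1 hi').1
      · intro i hi'; exact hττ i (Finset.mem_filter.1 hi').1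
    have h2 := Finset.card_filter_add_card_filter_not (s := Finset.Ico lo hi) (fun i => i < τ i)
    rw [h1, Int.card_Ico] at h2
    change I.card + I.card = _ at h2
    omega
  have hjI : j ∈ I := Finset.mem_filter.2 ⟨Finset.mem_Ico.2 hj, by omega⟩
  -- The graph of the walk without the edge followed at j and `τ j`. If `f p = f q`, the part
  -- between the two passages stays attached to the rest, so G is connected, with at most E - 1
  -- edges on at least E + 1 vertices: a contradiction.
  let G : SimpleGraph W := SimpleGraph.fromRel fun v w =>
    ∃ i ∈ Finset.Ico lo hi, i ≠ j ∧ i ≠ τ j ∧ f i = v ∧ f (i + 1) = w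
  -- the number of edges
  have hedges : G.edgeSet.ncard ≤ (I.erase j).card := by
    have hsub : (Sym2.map Subtype.val) '' G.edgeSet ⊆ ((I.erase j).image step : Finset _) := by
      rintro _ ⟨e, he, rfl⟩
      induction e with | _ v w
      rw [SimpleGraph.mem_edgeSet, SimpleGraph.fromRel_adj] at he
      have key : ∀ v w : V, (∃ i ∈ Finset.Ico lo hi, i ≠ j ∧ i ≠ τ j ∧ f i = v ∧ f (i + 1) = w) →
          s(v, w) ∈ (I.erase j).image step := by
        rintro _ _ ⟨i, hi1, hi2, hi3, rfl, rfl⟩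
        rw [Finset.mem_image]
        by_cases hlt : i < τ i
        · exact ⟨i, Finset.mem_erase.2 ⟨hi2, Finset.mem_filter.2 ⟨hi1, hlt⟩⟩, rfl⟩
        · refine ⟨τ i, Finset.mem_erase.2 ⟨?_, Finset.mem_filter.2 ⟨hτ i hi1, ?_⟩⟩, ?_⟩
          · rintro h; apply hi3; rw [← h, hττ i hi1]
          · rw [hττ i hi1]; exact lt_of_le_of_ne (not_lt.1 hlt) (hne i hi1)
          · simp only [step, hf1 i hi1, hf2 i hi1]; exact Sym2.eq_swap
      rcases he.2 with h | h
      · exact Finset.mem_coe.2 (key _ _ h)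
      · rw [Sym2.map_mk, Sym2.eq_swap]; exact Finset.mem_coe.2 (key _ _ h)
    rw [← Set.ncard_image_of_injective _ (Sym2.map.injective Subtype.val_injective)]
    refine (Set.ncard_le_ncard hsub (Finset.finite_toSet _)).trans ?_
    rw [Set.ncard_coe_finset]
    exact Finset.card_image_le
  -- connectedness
  have hstep : ∀ i (h1 : i ∈ Set.Icc lo hi) (h2 : i + 1 ∈ Set.Icc lo hi), i ≠ j → i ≠ τ j →
      G.Reachable (ν ⟨i, h1⟩) (ν ⟨i + 1, h2⟩) := by
    intro i h1 h2 hi1 hi2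
    by_cases heq : ν ⟨i, h1⟩ = ν ⟨i + 1, h2⟩
    · rw [heq]
    · refine SimpleGraph.Adj.reachable ?_
      rw [SimpleGraph.fromRel_adj]
      refine ⟨heq, Or.inl ⟨i, Finset.mem_Ico.2 ⟨h1.1, by have := h2.2; omega⟩, hi1, hi2, rfl, rfl⟩⟩
  have hrange : ∀ s t (hs : s ∈ Set.Icc lo hi) (ht : t ∈ Set.Icc lo hi), s ≤ t →
      (∀ i, s ≤ i → i < t → i ≠ j ∧ i ≠ τ j) → G.Reachable (ν ⟨s, hs⟩) (ν ⟨t, ht⟩) := by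
    intro s t hs ht hst
    induction t, hst using Int.leInduction with
    | base => intro _; rfl
    | succ t hst ih =>
      intro h
      have ht' : t ∈ Set.Icc lo hi := ⟨hs.1.trans hst, by have := ht.2; omega⟩
      exact (ih ht' fun i h1 h2 => h i h1 (by omega)).trans
        (hstep t ht' ht (h t hst (by omega)).1 (h t hst (by omega)).2)
  have hlo : lo ∈ Set.Icc lo hi := ⟨le_rfl, by omega⟩
  have hhi : hi ∈ Set.Icc lo hi := ⟨by omega, le_rfl⟩
  have hp' : p ∈ Set.Icc lo hi := ⟨by omega, by omega⟩
  have hlohi : ν ⟨lo, hlo⟩ = ν ⟨hi, hhi⟩ := Subtype.ext hclosed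
  -- the vertices outside of the part between the two passages
  have hout : ∀ i (h : i ∈ Set.Icc lo hi), i ≤ j ∨ τ j < i →
      G.Reachable (ν ⟨lo, hlo⟩) (ν ⟨i, h⟩) := by
    intro i h hc
    rcases hc with hc | hc
    · exact hrange _ _ hlo h h.1 fun l _ _ => by omega
    · rw [hlohi]
      exact (hrange _ _ h hhi h.2 fun l _ _ => by omega).symm
  have hin : ∀ i (h : i ∈ Set.Icc lo hi), j < i → i ≤ τ j →
      G.Reachable (ν ⟨p, hp'⟩) (ν ⟨i, h⟩) := by
    intro i h h1 h2
    rcases le_total p i with hc | hc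
    · exact hrange _ _ hp' h hc fun l _ _ => by omega
    · exact (hrange _ _ h hp' hc fun l _ _ => by omega).symm
  have hpq' : ν ⟨p, hp'⟩ = ν ⟨q, hq⟩ := Subtype.ext hpq
  have hall : ∀ w : W, G.Reachable (ν ⟨lo, hlo⟩) w := by
    rintro ⟨_, i, hi', rfl⟩
    by_cases hc : i ≤ j ∨ τ j < i
    · exact hout i hi' hc
    · push Not at hc
      have := hout q hq hqj
      rw [← hpq'] at this
      exact this.trans (hin i hi' hc.1 hc.2)
  have : Nonempty W := ⟨ν ⟨lo, hlo⟩⟩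
  have hconn : G.Connected := ⟨fun v w => (hall v).symm.trans (hall w)⟩
  have h1 := hconn.card_vert_le_card_edgeSet_add_one
  rw [Nat.card_coe_set_eq, Nat.card_coe_set_eq] at h1
  rw [Finset.card_erase_of_mem hjI] at hedges
  have h2 : 0 < I.card := Finset.card_pos.2 ⟨j, hjI⟩
  change E + 1 ≤ W.ncard at hcard
  omega

end Folding

namespace Folding

/-! ### Orbits of nodes -/

theorem unit_ne_neg (u : GaussianIntˣ) : u ≠ -u := by
  intro h
  have h1 := congrArg Units.val h
  have h2 := congrArg Zsqrtd.re h1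
  have h3 := congrArg Zsqrtd.im h1
  have h4 := norm_unit u
  rw [norm_def'] at h4
  simp only [Units.val_neg, Zsqrtd.re_neg, Zsqrtd.im_neg] at h2 h3
  have h5 : (u : GaussianInt).re = 0 := by omega
  have h6 : (u : GaussianInt).im = 0 := by omega
  rw [h5, h6] at h4
  simp at h4

theorem iUnit_ne_one (s : ℤˣ) : iUnit s ≠ 1 := by
  intro h
  have := iUnit_mul_self s
  rw [h, one_mul] at this
  exact unit_ne_neg 1 this

theorem iUnit_mul_ne (s : ℤˣ) (u : GaussianIntˣ) : iUnit s * u ≠ u := by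
  intro h
  exact iUnit_ne_one s (mul_eq_right.1 h)

theorem iUnit_mul_ne_neg (s : ℤˣ) (u : GaussianIntˣ) : iUnit s * u ≠ -u := by
  intro h
  apply iUnit_mul_ne (-s) u
  rw [iUnit_neg, neg_mul, h, neg_neg]

instance : Fintype GaussianIntˣ :=
  ⟨{1, -1, iUnit 1, iUnit (-1)}, fun u => by
    rcases unit_cases u with h | h | h | h <;> simp [h]⟩

theorem card_gaussianInt_units : Fintype.card GaussianIntˣ = 4 := by decide

theorem norm_mul_unit_ne {z : GaussianInt} (hz : z.norm = 2) (w : GaussianInt) : 2 * w ≠ z := by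
  rintro rfl
  have h1 : Zsqrtd.norm (2 : GaussianInt) = 4 := by decide
  rw [Zsqrtd.norm_mul, h1] at hz
  omega

namespace IsTiling

variable {a : ℕ → ℤˣ} {N : ℕ}

/-- The nodes of the first `N` segments which belong to one orbit are separated by the positions of
the segments around the node, up to the rotations around it. -/
theorem node_inj (h : IsTiling a N) {y : GaussianInt} {k k' : ℕ} {δ δ' : GaussianIntˣ} (hk : k < N)
    (hk' : k' < N) {g g' : Motion} (hg : g.act (ptSeq a N) (midSeq a k + δ) = y)
    (hg' : g'.act (ptSeq a N) (midSeq a k' + δ') = y) {r : Motion} (hr : r.act (ptSeq a N) y = y)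
    (hru : r.u * (g.u * δ) = g'.u * δ') : k = k' ∧ δ = δ' := by
  rw [Motion.act_add] at hg hg'
  have e : (r * g).act (ptSeq a N) (midSeq a k) = g'.act (ptSeq a N) (midSeq a k') := by
    rw [Motion.act_mul, eq_sub_of_add_eq hg, eq_sub_of_add_eq hg', sub_eq_add_neg, Motion.act_add, hr]
    have := congrArg Units.val hru
    push_cast at this
    linear_combination -this
  obtain ⟨h1, h2⟩ := h.inj _ _ _ _ hk hk' e
  refine ⟨h2, ?_⟩
  rw [← h1, Motion.mul_u, mul_assoc] at hru
  exact mul_left_cancel (mul_left_cancel hru)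

/-- The rotation by `u` around `0`, or around `2Q`. -/
theorem exists_rotation (Q : GaussianInt) (v : GaussianIntˣ) :
    (∃ r : Motion, r.act Q 0 = 0 ∧ r.u = v) ∧ ∃ r : Motion, r.act Q (2 * Q) = 2 * Q ∧ r.u = v := by
  refine ⟨⟨Motion.rot v, by simp, rfl⟩, ⟨⟨v, 1 - v, ?_⟩, ?_, rfl⟩⟩
  · rw [sub_eq_add_neg, ← Units.val_neg, isEven_add_unit_iff]
    simpa using not_isEven_unit 1
  · simp only [Motion.act]; ring

theorem node_zero (h : IsTiling a N) {k : ℕ} {δ : GaussianIntˣ} (hk : k < N) {g : Motion}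
    (hg : g.act (ptSeq a N) (midSeq a k + δ) = 0) : k = 0 ∧ δ = -dirSeq a 0 := by
  obtain ⟨r, hr, hru⟩ := (exists_rotation (ptSeq a N) (-(dirSeq a 0) * (g.u * δ)⁻¹)).1
  refine h.node_inj hk h.pos hg (g' := 1) ?_ hr ?_
  · rw [midSeq_zero, dirSeq_zero, Motion.act_one]; simp
  · rw [hru, inv_mul_cancel_right, Motion.one_u, one_mul]

theorem node_two_mul (h : IsTiling a N) {k : ℕ} {δ : GaussianIntˣ} (hk : k < N) {g : Motion}
    (hg : g.act (ptSeq a N) (midSeq a k + δ) = 2 * ptSeq a N) :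
    k = N - 1 ∧ δ = dirSeq a (N - 1) := by
  have hN := h.pos
  obtain ⟨r, hr, hru⟩ := (exists_rotation (ptSeq a N) (dirSeq a (N - 1) * (g.u * δ)⁻¹)).2
  refine h.node_inj hk (by omega) hg (g' := 1) ?_ hr ?_
  · rw [midSeq_eq_sub, Motion.act_one, Nat.sub_add_cancel h.pos]; simp
  · rw [hru, inv_mul_cancel_right, Motion.one_u, one_mul]

theorem orbit_zero_ne_two_mul (h : IsTiling a N) (g : Motion) :
    g.act (ptSeq a N) 0 ≠ 2 * ptSeq a N := by
  intro hg
  simp only [Motion.act, mul_zero, zero_add] at hg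
  have : g.e = 1 := by
    refine mul_left_cancel₀ (a := 2 * ptSeq a N) (mul_ne_zero (by decide) h.ptSeq_ne_zero) ?_
    rw [hg, mul_one]
  have h2 := g.isEven_e
  rw [this] at h2
  exact not_isEven_unit 1 (by simpa using h2)

theorem orbit_zero_ne (h : IsTiling a N) (g : Motion) :
    g.act (ptSeq a N) 0 ≠ (1 + iPow 1) * ptSeq a N := by
  intro hg
  simp only [Motion.act, mul_zero, zero_add] at hg
  refine norm_mul_unit_ne (z := 1 + iPow 1) (by decide) g.e ?_
  exact mul_left_cancel₀ h.ptSeq_ne_zero (by linear_combination hg)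

theorem orbit_two_mul_ne (h : IsTiling a N) (g : Motion) :
    g.act (ptSeq a N) (2 * ptSeq a N) ≠ (1 + iPow 1) * ptSeq a N := by
  intro hg
  simp only [Motion.act] at hg
  refine norm_mul_unit_ne (z := 1 + iPow 1) (by decide) (g.u + g.e) ?_
  exact mul_left_cancel₀ h.ptSeq_ne_zero (by linear_combination hg)

/-- The orbits of the nodes of the first `N` segments. -/
def nodeOrbits (a : ℕ → ℤˣ) (N : ℕ) : Set (Quotient (orbitSetoid (ptSeq a N))) :=
  {v | ∃ k < N, ∃ δ : GaussianIntˣ, Quotient.mk _ (midSeq a k + (δ : GaussianInt)) = v}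

theorem mk_mem_nodeOrbits (h : IsTiling a N) {y : GaussianInt} (hy : IsEven y) :
    Quotient.mk _ y ∈ nodeOrbits a N := by
  obtain ⟨g, k, hk, hg⟩ := h.cover (y + (1 : GaussianIntˣ)) (by
    rw [isEven_add_unit_iff]; exact not_not.2 hy)
  refine ⟨k, hk, -g.u⁻¹, Quotient.sound ⟨g, ?_⟩⟩
  rw [Motion.act_add, hg]
  simp

/-- This is the Euler count for the quotient sphere: it has N square faces and 2N sides, hence N + 2
nodes. Only the lower bound is needed, and it follows from counting the 4N corners of the squares.
-/
theorem le_ncard_nodeOrbits (h : IsTiling a N) :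
    (nodeOrbits a N).Finite ∧ N + 2 ≤ (nodeOrbits a N).ncard := by
  classical
  set Q := ptSeq a N
  let cls : GaussianInt → Quotient (orbitSetoid Q) := Quotient.mk _
  let F : Finset (ℕ × GaussianIntˣ) := Finset.range N ×ˢ Finset.univ
  let ψ : ℕ × GaussianIntˣ → Quotient (orbitSetoid Q) := fun d => cls (midSeq a d.1 + d.2)
  have hV : nodeOrbits a N = (F.image ψ : Finset _) := by
    ext v
    simp only [nodeOrbits, Set.mem_ofPred_eq, Finset.coe_image, Set.mem_image, Finset.mem_coe, F,
      Finset.mem_product, Finset.mem_range, Finset.mem_univ, and_true, Prod.exists, ψ, cls]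
    constructor
    · rintro ⟨k, hk, δ, hv⟩; exact ⟨k, δ, hk, hv⟩
    · rintro ⟨k, δ, hk, hv⟩; exact ⟨k, hk, δ, hv⟩
  have hmem : ∀ y, IsEven y → cls y ∈ F.image ψ := fun y hy => by
    have := h.mk_mem_nodeOrbits hy
    rw [hV] at this
    exact_mod_cast this
  refine ⟨by rw [hV]; exact Finset.finite_toSet _, ?_⟩
  rw [hV, Set.ncard_coe_finset]
  -- a bound for the fibres
  have fiber : ∀ {T : Type} [Fintype T] [DecidableEq T] (y : GaussianInt) (f : GaussianIntˣ → T),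
      (∀ e e', f e = f e' → ∃ r : Motion, r.act Q y = y ∧ r.u = e' * e⁻¹) →
      (F.filter fun d => ψ d = cls y).card ≤ Fintype.card T := by
    intro T _ _ y f hf
    have hex : ∀ d ∈ F.filter fun d => ψ d = cls y,
        ∃ g : Motion, g.act Q (midSeq a d.1 + d.2) = y := fun d hd =>
      Quotient.exact (Finset.mem_filter.1 hd).2
    choose! g hg using hex
    refine Finset.card_le_card_of_injOn (fun d => f ((g d).u * d.2)) (fun _ _ => Finset.mem_univ _) ?_
    intro d hd d' hd' hdd
    obtain ⟨r, hr, hru⟩ := hf _ _ hdd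
    have m1 := Finset.mem_filter.1 hd
    have m2 := Finset.mem_filter.1 hd'
    simp only [F, Finset.mem_product, Finset.mem_range, Finset.mem_univ, and_true] at m1 m2
    obtain ⟨h1, h2⟩ := h.node_inj m1.1 m2.1 (hg d hd) (hg d' hd') hr
      (by rw [hru, inv_mul_cancel_right])
    exact Prod.ext h1 h2
  have hab : cls 0 ≠ cls (2 * Q) := fun hc => by
    obtain ⟨g, hg⟩ := Quotient.exact hc; exact h.orbit_zero_ne_two_mul g hg
  have hac : cls 0 ≠ cls ((1 + iPow 1) * Q) := fun hc => by
    obtain ⟨g, hg⟩ := Quotient.exact hc; exact h.orbit_zero_ne g hg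
  have hbc : cls (2 * Q) ≠ cls ((1 + iPow 1) * Q) := fun hc => by
    obtain ⟨g, hg⟩ := Quotient.exact hc; exact h.orbit_two_mul_ne g hg
  have fa : (F.filter fun d => ψ d = cls 0).card ≤ 1 :=
    fiber (T := Unit) 0 (fun _ => ()) fun e e' _ => (exists_rotation Q _).1
  have fb : (F.filter fun d => ψ d = cls (2 * Q)).card ≤ 1 :=
    fiber (T := Unit) (2 * Q) (fun _ => ()) fun e e' _ => (exists_rotation Q _).2
  have fc : (F.filter fun d => ψ d = cls ((1 + iPow 1) * Q)).card ≤ 2 := by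
    -- The square of e is 1 or -1 and determines e up to sign; opposite directions at (1 + i)Q are
    -- exchanged by the half-turn around this point.
    refine fiber (T := Bool) _ (fun e => decide (e * e = 1)) fun e e' hee => ?_
    have hcases : e' = e ∨ e' = -e := by
      rcases unit_cases_mul e' e 1 with h | h | h | h
      · exact Or.inl h
      · exact Or.inr h
      all_goals
        exfalso
        have h1 : e' * e' = -(e * e) := by
          have h0 : iUnit 1 * e * (iUnit 1 * e) = -(e * e) := by
            rw [mul_mul_mul_comm, iUnit_mul_self, neg_one_mul]
          first
          | rw [h, h0]
          | rw [h, neg_mul_neg, h0]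
        have h2 : e * e = 1 ∨ e * e = -1 := by
          rcases unit_cases e with rfl | rfl | rfl | rfl <;> simp [iUnit_mul_self]
        have h3 : (e * e = 1 ↔ e' * e' = 1) := by simpa using hee
        rcases h2 with h2 | h2
        · have := h3.1 h2
          rw [h1, h2] at this
          exact unit_ne_neg 1 this.symm
        · have := h3.2 (by rw [h1, h2, neg_neg])
          rw [h2] at this
          exact unit_ne_neg 1 this.symm
    rcases hcases with rfl | rfl
    · exact ⟨1, by simp, by simp⟩
    · refine ⟨⟨-1, 1 + iPow 1, isEven_one_add_iPow 1⟩, ?_, by simp⟩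
      simp only [Motion.act, Units.val_neg, Units.val_one]; ring
  -- An orbit of nodes receives at most 4 corners, but only 1 at each centre of order 4 and 2 at the
  -- centre of order 2. The deficits 3 + 3 + 2 = 8, added to the 4N corners, give at least N + 2
  -- orbits.
  have f4 : ∀ v ∈ F.image ψ, (F.filter fun d => ψ d = v).card +
      ((if v = cls 0 then 3 else 0) + (if v = cls (2 * Q) then 3 else 0) +
        (if v = cls ((1 + iPow 1) * Q) then 2 else 0)) ≤ 4 := by
    intro v hv
    have f0 : (F.filter fun d => ψ d = v).card ≤ 4 := by
      obtain ⟨y, rfl⟩ := Quotient.exists_rep v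
      have := fiber (T := GaussianIntˣ) y id fun e e' hee => ⟨1, by simp, by simp_all⟩
      rwa [card_gaussianInt_units] at this
    by_cases h1 : v = cls 0
    · subst h1; simp [hab, hac]; exact fa
    by_cases h2 : v = cls (2 * Q)
    · subst h2; simp [hab.symm, hbc]; exact fb
    by_cases h3 : v = cls ((1 + iPow 1) * Q)
    · subst h3; simp [hac.symm, hbc.symm]; exact fc
    simpa [h1, h2, h3] using f0
  have hsum := Finset.sum_le_sum f4
  rw [Finset.sum_add_distrib, Finset.sum_add_distrib, Finset.sum_add_distrib, Finset.sum_ite_eq',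
    Finset.sum_ite_eq', Finset.sum_ite_eq', if_pos (hmem _ isEven_zero),
    if_pos (hmem _ (isEven_two_mul _)),
    if_pos (hmem _ (by rw [mul_comm]; exact (isEven_one_add_iPow 1).mul_left _)),
    ← Finset.card_eq_sum_card_image, Finset.sum_const, Finset.card_product, Finset.card_range,
    Finset.card_univ, card_gaussianInt_units, smul_eq_mul] at hsum
  omega

end IsTiling

end Folding

namespace Folding

/-! ### Contacts between tiles -/

/-- The side of the `k`-th segment which goes from `midSeq a k + δ` to `midSeq a k + i^s δ` is also
a side of the image by `g` of the `k'`-th segment. -/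
structure Contact (a : ℕ → ℤˣ) (Q : GaussianInt) (s : ℤˣ) (k : ℕ) (δ : GaussianIntˣ) (k' : ℕ)
    (δ' : GaussianIntˣ) (g : Motion) : Prop where
  mid : g.act Q (midSeq a k') = midSeq a k + (1 + iPow s) * δ
  dir : g.u * δ' = -δ

namespace Contact

variable {a : ℕ → ℤˣ} {Q : GaussianInt} {s : ℤˣ} {k k' : ℕ} {δ δ' : GaussianIntˣ} {g : Motion}

theorem symm (h : Contact a Q s k δ k' δ' g) : Contact a Q s k' δ' k δ g⁻¹ := by
  have hd : δ' = g.u⁻¹ * -δ := by rw [← h.dir, inv_mul_cancel_left]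
  refine ⟨?_, by rw [hd]; simp⟩
  apply g.act_injective Q
  have := congrArg Units.val h.dir
  push_cast at this
  rw [Motion.act_act_inv, Motion.act_add, h.mid]
  linear_combination (-1 - iPow s) * this

theorem act_tail (h : Contact a Q s k δ k' δ' g) :
    g.act Q (midSeq a k' + δ') = midSeq a k + iPow s * δ := by
  have := congrArg Units.val h.dir
  push_cast at this
  rw [Motion.act_add, h.mid]
  linear_combination this

theorem act_head (h : Contact a Q s k δ k' δ' g) :
    g.act Q (midSeq a k' + iPow s * δ') = midSeq a k + δ := by
  have := congrArg Units.val h.dir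
  push_cast at this
  rw [Motion.act_add, h.mid]
  linear_combination iPow s * this

end Contact

variable {a : ℕ → ℤˣ} {N : ℕ} {s : ℤˣ}

theorem not_isEven_side (k : ℕ) (δ : GaussianIntˣ) : ¬ IsEven (midSeq a k + (1 + iPow s) * δ) := by
  rw [isEven_add_iff (by rw [mul_comm]; exact (isEven_one_add_iPow s).mul_left _)]
  exact not_isEven_midSeq k

theorem IsTiling.exists_contact (h : IsTiling a N) (s : ℤˣ) (k : ℕ) (δ : GaussianIntˣ) :
    ∃ k' < N, ∃ δ' g, Contact a (ptSeq a N) s k δ k' δ' g := by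
  obtain ⟨g, k', hk', hg⟩ := h.cover _ (not_isEven_side (s := s) k δ)
  exact ⟨k', hk', g.u⁻¹ * -δ, g, hg, by simp⟩

theorem IsTiling.contact_unique (h : IsTiling a N) {k k₁ k₂ : ℕ} {δ δ₁ δ₂ : GaussianIntˣ}
    {g₁ g₂ : Motion} (hk₁ : k₁ < N) (hk₂ : k₂ < N)
    (h₁ : Contact a (ptSeq a N) s k δ k₁ δ₁ g₁) (h₂ : Contact a (ptSeq a N) s k δ k₂ δ₂ g₂) :
    k₁ = k₂ ∧ δ₁ = δ₂ ∧ g₁ = g₂ := by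
  obtain ⟨e1, e2⟩ := h.inj _ _ _ _ hk₁ hk₂ (h₁.mid.trans h₂.mid.symm)
  subst e1
  exact ⟨e2, mul_left_cancel (h₁.dir.trans h₂.dir.symm), rfl⟩

/-- No side is in contact with itself. -/
theorem Contact.irrefl {k : ℕ} {δ : GaussianIntˣ} {g : Motion}
    (hc : Contact a (ptSeq a N) s k δ k δ g) : False := by
  have hu : g.u = -1 := mul_right_cancel (b := δ) (by rw [hc.dir, neg_one_mul])
  have hm := hc.mid
  rw [Motion.act, hu] at hm
  -- The motion reverses directions, so (1 + i^s)δ, the difference between the middle and its image,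
  -- would be divisible by 2; its norm is 2.
  refine norm_mul_unit_ne (z := (1 + iPow s) * δ) ?_ (ptSeq a N * g.e - midSeq a k) ?_
  · rw [Zsqrtd.norm_mul, norm_unit]
    rcases Int.units_eq_one_or s with rfl | rfl <;> decide
  · push_cast at hm
    linear_combination hm

/-- At a turn, the squares of the two consecutive edges share the side which joins their common
vertex to the centre of the face inside the turn. So the tile touches itself there, with the trivial
motion; the two signs of the turn give the two sides of the curve. -/
theorem contact_turn_neg {Q : GaussianInt} {k : ℕ} (hk : a k = -s) :
    Contact a Q s k (-(iUnit s * dirSeq a k)) (k + 1) (-dirSeq a (k + 1)) 1 := by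
  have hs := iPow_mul_self s
  refine ⟨?_, ?_⟩
  · rw [Motion.act_one, midSeq, ptSeq_succ, dirSeq_succ, hk, midSeq]
    push_cast
    rw [val_iUnit, val_iUnit, iPow_neg]
    linear_combination (dirSeq a k : GaussianInt) * hs
  · rw [Motion.one_u, one_mul, dirSeq_succ, hk, iUnit_neg, neg_mul]

theorem contact_turn_pos {Q : GaussianInt} {k : ℕ} (hk : a k = s) :
    Contact a Q s k (dirSeq a k) (k + 1) (iUnit s * dirSeq a (k + 1)) 1 := by
  refine ⟨?_, ?_⟩
  · rw [Motion.act_one, midSeq, ptSeq_succ, dirSeq_succ, hk, midSeq]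
    push_cast
    rw [val_iUnit]
    ring
  · rw [Motion.one_u, one_mul, dirSeq_succ, hk, ← mul_assoc, iUnit_mul_self, neg_one_mul]

/-! ### The contour of a tile -/

/-- The nodes along the side `σ` of the curve: the vertices alternate with the faces. -/
def sideNode (a : ℕ → ℤˣ) (σ : ℤˣ) (n : ℕ) : GaussianInt :=
  if Even n then 2 * ptSeq a (n / 2) else midSeq a (n / 2) + iPow σ * dirSeq a (n / 2)

/-- The orbit of a node along the side `σ`, except for the vertices where the curve turns to this
side, which are replaced by distinct labels. -/
def sideLabel (a : ℕ → ℤˣ) (N : ℕ) (σ : ℤˣ) (n : ℕ) : Quotient (orbitSetoid (ptSeq a N)) ⊕ ℕ :=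
  if Even n ∧ 0 < n ∧ n < 2 * N ∧ a (n / 2 - 1) = σ then Sum.inr (n / 2)
  else Sum.inl (Quotient.mk _ (sideNode a σ n))

/-- The values of `Φ` along the contour of the first `N` segments: on the side `s` backwards to the
origin, then on the other side forwards, and again on the side `s` backwards. -/
def along {α : Type*} (N : ℕ) (s : ℤˣ) (Φ : ℤˣ → ℕ → α) (t : ℤ) : α :=
  if t < 0 then Φ s (-t).toNat else if t ≤ 2 * N then Φ (-s) t.toNat else Φ s (4 * N - t).toNat

/-- The position in the contour of the node of index `n` on the side `s`, when the contour starts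
from the node of index `h`. -/
def backPos (N h n : ℕ) : ℤ := if n ≤ h then -(n : ℤ) else 4 * N - n

/-- The position in the contour of the side of the `k`-th segment which starts at
`midSeq a k + δ`. -/
def dartPos (a : ℕ → ℤˣ) (N : ℕ) (s : ℤˣ) (h k : ℕ) (δ : GaussianIntˣ) : ℤ :=
  if δ = -dirSeq a k then 2 * k
  else if δ = -(iUnit s * dirSeq a k) then 2 * k + 1
  else if δ = dirSeq a k then backPos N h (2 * k + 2)
  else backPos N h (2 * k + 1)

theorem sideNode_even (σ : ℤˣ) (k : ℕ) : sideNode a σ (2 * k) = 2 * ptSeq a k := by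
  simp [sideNode]

theorem sideNode_odd (σ : ℤˣ) (k : ℕ) :
    sideNode a σ (2 * k + 1) = midSeq a k + iPow σ * dirSeq a k := by
  have h1 : ¬ Even (2 * k + 1) := by simp
  have h2 : (2 * k + 1) / 2 = k := by omega
  rw [sideNode, if_neg h1, h2]

theorem sideLabel_odd (σ : ℤˣ) (k : ℕ) :
    sideLabel a N σ (2 * k + 1) = Sum.inl (Quotient.mk _ (midSeq a k + iPow σ * dirSeq a k)) := by
  have h1 : ¬ Even (2 * k + 1) := by simp
  rw [sideLabel, if_neg (fun h => h1 h.1), sideNode_odd]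

theorem sideLabel_inr {σ : ℤˣ} {k : ℕ} (hk : k + 1 < N) (ha : a k = σ) :
    sideLabel a N σ (2 * k + 2) = Sum.inr (k + 1) := by
  have h2 : (2 * k + 2) / 2 = k + 1 := by omega
  rw [sideLabel, if_pos, h2]
  refine ⟨by simp [Nat.even_add], by omega, by omega, ?_⟩
  rw [h2]; exact ha

theorem sideLabel_inl {σ : ℤˣ} {k : ℕ} (ha : k + 1 < N → a k ≠ σ) :
    sideLabel a N σ (2 * k + 2) = Sum.inl (Quotient.mk _ (2 * ptSeq a (k + 1))) := by
  have h2 : (2 * k + 2) / 2 = k + 1 := by omega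
  rw [sideLabel, if_neg, show 2 * k + 2 = 2 * (k + 1) by ring, sideNode_even]
  rintro ⟨-, -, h3, h4⟩
  rw [h2] at h4
  exact ha (by omega) h4

theorem sideLabel_zero (σ : ℤˣ) : sideLabel a N σ 0 = Sum.inl (Quotient.mk _ 0) := by
  simp [sideLabel, sideNode, ptSeq_zero]

theorem sideLabel_last (σ : ℤˣ) :
    sideLabel a N σ (2 * N) = Sum.inl (Quotient.mk _ (2 * ptSeq a N)) := by
  rw [sideLabel, if_neg (by simp), sideNode_even]

section along

variable {α : Type*} {Φ : ℤˣ → ℕ → α} {h n : ℕ}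

theorem along_forward (hn : n ≤ 2 * N) : along N s Φ n = Φ (-s) n := by
  rw [along, if_neg (by omega), if_pos (by exact_mod_cast hn), Int.toNat_natCast]

theorem along_backPos (h0 : Φ s (2 * N) = Φ (-s) (2 * N)) (h0' : Φ s 0 = Φ (-s) 0)
    (hn : n ≤ 2 * N) : along N s Φ (backPos N h n) = Φ s n := by
  unfold backPos
  split_ifs with hh
  · rcases Nat.eq_zero_or_pos n with rfl | hn0
    · simp [along, h0']
    · rw [along, if_pos (by omega)]; simp
  · rcases eq_or_ne n (2 * N) with rfl | hne
    · have : (4 * N - (2 * N : ℕ) : ℤ) = (2 * N : ℕ) := by push_cast; ring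
      rw [this, along_forward le_rfl, h0]
    · rw [along, if_neg (by omega), if_neg (by omega)]
      congr 1; omega

theorem along_backPos_add_one (h0 : Φ s 0 = Φ (-s) 0) (hn : n + 1 ≤ 2 * N) :
    along N s Φ (backPos N h (n + 1) + 1) = Φ s n := by
  unfold backPos
  split_ifs with hh
  · rcases Nat.eq_zero_or_pos n with rfl | hn0
    · have : (-((0 + 1 : ℕ) : ℤ) + 1) = (0 : ℕ) := by simp
      rw [this, along_forward (by omega), h0]
    · rw [along, if_pos (by push_cast; omega)]
      congr 1; push_cast; omega
  · rw [along, if_neg (by push_cast; omega), if_neg (by push_cast; omega)]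
    congr 1; push_cast; omega

end along

section dartPos

variable {h k : ℕ}

theorem dartPos_neg : dartPos a N s h k (-dirSeq a k) = 2 * k := by
  rw [dartPos, if_pos rfl]

theorem dartPos_neg_mul : dartPos a N s h k (-(iUnit s * dirSeq a k)) = 2 * k + 1 := by
  rw [dartPos, if_neg, if_pos rfl]
  intro hc
  exact iUnit_mul_ne s _ (neg_injective hc)

theorem dartPos_self : dartPos a N s h k (dirSeq a k) = backPos N h (2 * k + 2) := by
  rw [dartPos, if_neg (unit_ne_neg _), if_neg, if_pos rfl]
  intro hc
  have := congrArg Neg.neg hc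
  rw [neg_neg] at this
  exact iUnit_mul_ne_neg s _ this.symm

theorem dartPos_mul : dartPos a N s h k (iUnit s * dirSeq a k) = backPos N h (2 * k + 1) := by
  rw [dartPos, if_neg (iUnit_mul_ne_neg s _), if_neg (unit_ne_neg _), if_neg (iUnit_mul_ne s _)]

end dartPos

end Folding

namespace Folding

/-! ### Positions of the sides of the squares in the contour -/

variable {a : ℕ → ℤˣ} {N : ℕ} {s : ℤˣ} {n₀ : ℕ}

theorem dart_cases (a : ℕ → ℤˣ) (s : ℤˣ) (k : ℕ) (δ : GaussianIntˣ) :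
    δ = -dirSeq a k ∨ δ = -(iUnit s * dirSeq a k) ∨ δ = dirSeq a k ∨ δ = iUnit s * dirSeq a k := by
  rcases unit_cases_mul δ (dirSeq a k) s with h | h | h | h <;> simp [h]

theorem backPos_mem {n : ℕ} (hn₀ : n₀ < 2 * N) (hn : 0 < n) (hn' : n ≤ 2 * N) :
    backPos N n₀ n ∈ Finset.Ico (-(n₀ : ℤ)) (4 * N - n₀) := by
  rw [Finset.mem_Ico]
  unfold backPos
  split_ifs <;> omega

theorem dartPos_mem (hn₀ : n₀ < 2 * N) {k : ℕ} (hk : k < N) (δ : GaussianIntˣ) :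
    dartPos a N s n₀ k δ ∈ Finset.Ico (-(n₀ : ℤ)) (4 * N - n₀) := by
  rcases dart_cases a s k δ with rfl | rfl | rfl | rfl
  · rw [dartPos_neg, Finset.mem_Ico]; omega
  · rw [dartPos_neg_mul, Finset.mem_Ico]; omega
  · rw [dartPos_self]; exact backPos_mem hn₀ (by omega) (by omega)
  · rw [dartPos_mul]; exact backPos_mem hn₀ (by omega) (by omega)

theorem exists_backPos_eq {n : ℕ} (hn : 0 < n) (hn' : n ≤ 2 * N) :
    ∃ k < N, ∃ δ : GaussianIntˣ, dartPos a N s n₀ k δ = backPos N n₀ n := by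
  rcases Nat.even_or_odd' n with ⟨k, rfl | rfl⟩
  · refine ⟨k - 1, by omega, _, dartPos_self.trans ?_⟩
    congr 1; omega
  · exact ⟨k, by omega, _, dartPos_mul⟩

theorem exists_dartPos_eq (hn₀ : n₀ < 2 * N) {t : ℤ}
    (ht : t ∈ Finset.Ico (-(n₀ : ℤ)) (4 * N - n₀)) :
    ∃ k < N, ∃ δ : GaussianIntˣ, dartPos a N s n₀ k δ = t := by
  rw [Finset.mem_Ico] at ht
  rcases lt_or_ge t 0 with h | h
  · obtain ⟨n, rfl⟩ : ∃ n : ℕ, t = -n := ⟨(-t).toNat, by omega⟩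
    obtain ⟨k, hk, δ, h⟩ := exists_backPos_eq (a := a) (s := s) (n₀ := n₀) (n := n) (N := N)
      (by omega) (by omega)
    exact ⟨k, hk, δ, h.trans (by rw [backPos, if_pos (by omega)])⟩
  rcases lt_or_ge t (2 * N) with h' | h'
  · obtain ⟨n, rfl⟩ : ∃ n : ℕ, t = n := ⟨t.toNat, by omega⟩
    rcases Nat.even_or_odd' n with ⟨k, rfl | rfl⟩
    · exact ⟨k, by omega, _, dartPos_neg.trans (by push_cast; ring)⟩
    · exact ⟨k, by omega, _, dartPos_neg_mul.trans (by push_cast; ring)⟩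
  · obtain ⟨n, hn⟩ : ∃ n : ℕ, t = 4 * N - n := ⟨(4 * N - t).toNat, by omega⟩
    obtain ⟨k, hk, δ, h⟩ := exists_backPos_eq (a := a) (s := s) (n₀ := n₀) (n := n) (N := N)
      (by omega) (by omega)
    exact ⟨k, hk, δ, h.trans (by rw [backPos, if_neg (by omega), hn])⟩

theorem dartPos_inj {k k' : ℕ} (hk : k < N) (hk' : k' < N)
    {δ δ' : GaussianIntˣ} (h : dartPos a N s n₀ k δ = dartPos a N s n₀ k' δ') : k = k' ∧ δ = δ' := by
  rcases dart_cases a s k δ with rfl | rfl | rfl | rfl <;>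
    rcases dart_cases a s k' δ' with rfl | rfl | rfl | rfl <;>
    simp only [dartPos_neg, dartPos_neg_mul, dartPos_self, dartPos_mul, backPos] at h <;>
    (have hkk : k = k' := by omega) <;> subst hkk <;>
    first
    | exact ⟨rfl, rfl⟩
    | (exfalso; omega)

/-! ### Nodes and labels along the contour -/

theorem along_sideNode_tail {k : ℕ} (hk : k < N) (δ : GaussianIntˣ) :
    along N s (sideNode a) (dartPos a N s n₀ k δ) = midSeq a k + δ := by
  have h1 : sideNode a s (2 * N) = sideNode a (-s) (2 * N) := by simp [sideNode_even]
  have h2 : sideNode a s 0 = sideNode a (-s) 0 := by simp [sideNode]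
  rcases dart_cases a s k δ with rfl | rfl | rfl | rfl
  · rw [dartPos_neg, show (2 * k : ℤ) = (2 * k : ℕ) by push_cast; ring, along_forward (by omega),
      sideNode_even, midSeq]
    push_cast; ring
  · rw [dartPos_neg_mul, show (2 * k + 1 : ℤ) = (2 * k + 1 : ℕ) by push_cast; ring,
      along_forward (by omega), sideNode_odd, iPow_neg]
    push_cast; simp
  · rw [dartPos_self, along_backPos h1 h2 (by omega), show 2 * k + 2 = 2 * (k + 1) by ring,
      sideNode_even, midSeq_eq_sub]
    ring
  · rw [dartPos_mul, along_backPos h1 h2 (by omega), sideNode_odd]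
    simp

theorem along_sideNode_head {k : ℕ} (hk : k < N) (δ : GaussianIntˣ) :
    along N s (sideNode a) (dartPos a N s n₀ k δ + 1) = midSeq a k + iPow s * δ := by
  have h2 : sideNode a s 0 = sideNode a (-s) 0 := by simp [sideNode]
  have hs := iPow_mul_self s
  rcases dart_cases a s k δ with rfl | rfl | rfl | rfl
  · rw [dartPos_neg, show (2 * k + 1 : ℤ) = (2 * k + 1 : ℕ) by push_cast; ring,
      along_forward (by omega), sideNode_odd, iPow_neg]
    push_cast; ring
  · rw [dartPos_neg_mul, show (2 * k + 1 + 1 : ℤ) = (2 * (k + 1) : ℕ) by push_cast; ring,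
      along_forward (by omega), sideNode_even, midSeq_eq_sub]
    push_cast
    rw [val_iUnit]
    linear_combination (dirSeq a k : GaussianInt) * hs
  · rw [dartPos_self, along_backPos_add_one h2 (by omega), sideNode_odd]
  · rw [dartPos_mul, along_backPos_add_one h2 (by omega), sideNode_even, midSeq]
    push_cast
    rw [val_iUnit]
    linear_combination -(dirSeq a k : GaussianInt) * hs

section labels

variable {k : ℕ}

theorem label_tail_neg (hk : k < N) : along N s (sideLabel a N) (dartPos a N s n₀ k (-dirSeq a k)) =
    sideLabel a N (-s) (2 * k) := by
  rw [dartPos_neg, show (2 * k : ℤ) = (2 * k : ℕ) by push_cast; ring, along_forward (by omega)]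

theorem label_head_neg_mul (hk : k < N) :
    along N s (sideLabel a N) (dartPos a N s n₀ k (-(iUnit s * dirSeq a k)) + 1) =
      sideLabel a N (-s) (2 * k + 2) := by
  rw [dartPos_neg_mul, show (2 * k + 1 + 1 : ℤ) = (2 * k + 2 : ℕ) by push_cast; ring,
    along_forward (by omega)]

theorem label_tail_self (hk : k < N) : along N s (sideLabel a N) (dartPos a N s n₀ k (dirSeq a k)) =
    sideLabel a N s (2 * k + 2) := by
  rw [dartPos_self, along_backPos (by rw [sideLabel_last, sideLabel_last])
    (by rw [sideLabel_zero, sideLabel_zero]) (by omega)]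

theorem label_head_mul (hk : k < N) :
    along N s (sideLabel a N) (dartPos a N s n₀ k (iUnit s * dirSeq a k) + 1) =
      sideLabel a N s (2 * k) := by
  rw [dartPos_mul, along_backPos_add_one (by rw [sideLabel_zero, sideLabel_zero]) (by omega)]

theorem label_tail_cases (hk : k < N) (δ : GaussianIntˣ) :
    along N s (sideLabel a N) (dartPos a N s n₀ k δ) =
        Sum.inl (Quotient.mk _ (midSeq a k + (δ : GaussianInt))) ∨
      (∃ j, k = j + 1 ∧ δ = -dirSeq a k ∧ a j = -s) ∨
      (k + 1 < N ∧ δ = dirSeq a k ∧ a k = s) := by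
  rcases dart_cases a s k δ with rfl | rfl | rfl | rfl
  · rw [label_tail_neg hk]
    have e : midSeq a k + ((-dirSeq a k : GaussianIntˣ) : GaussianInt) = 2 * ptSeq a k := by
      rw [midSeq]; push_cast; ring
    rcases k with _ | j
    · left; rw [e, mul_zero, sideLabel_zero, ptSeq_zero, mul_zero]
    · by_cases h : a j = -s
      · exact Or.inr (Or.inl ⟨j, rfl, rfl, h⟩)
      · left; rw [e, show 2 * (j + 1) = 2 * j + 2 by ring, sideLabel_inl fun _ => h]
  · left
    rw [dartPos_neg_mul, show (2 * k + 1 : ℤ) = (2 * k + 1 : ℕ) by push_cast; ring,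
      along_forward (by omega), sideLabel_odd, iPow_neg]
    push_cast; rw [neg_mul, val_iUnit]
  · rw [label_tail_self hk]
    by_cases h : k + 1 < N ∧ a k = s
    · exact Or.inr (Or.inr ⟨h.1, rfl, h.2⟩)
    · left
      rw [sideLabel_inl fun h1 h2 => h ⟨h1, h2⟩, midSeq_eq_sub]
      congr 2; ring
  · left
    rw [dartPos_mul, along_backPos (by rw [sideLabel_last, sideLabel_last])
      (by rw [sideLabel_zero, sideLabel_zero]) (by omega), sideLabel_odd]
    rfl

theorem label_head_cases (hk : k < N) (δ : GaussianIntˣ) :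
    along N s (sideLabel a N) (dartPos a N s n₀ k δ + 1) =
        Sum.inl (Quotient.mk _ (midSeq a k + iPow s * (δ : GaussianInt))) ∨
      (k + 1 < N ∧ δ = -(iUnit s * dirSeq a k) ∧ a k = -s) ∨
      (∃ j, k = j + 1 ∧ δ = iUnit s * dirSeq a k ∧ a j = s) := by
  have hs := iPow_mul_self s
  rcases dart_cases a s k δ with rfl | rfl | rfl | rfl
  · left
    rw [dartPos_neg, show (2 * k + 1 : ℤ) = (2 * k + 1 : ℕ) by push_cast; ring,
      along_forward (by omega), sideLabel_odd, iPow_neg]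
    push_cast; rw [neg_mul, mul_neg]
  · rw [label_head_neg_mul hk]
    by_cases h : k + 1 < N ∧ a k = -s
    · exact Or.inr (Or.inl ⟨h.1, rfl, h.2⟩)
    · left
      rw [sideLabel_inl fun h1 h2 => h ⟨h1, h2⟩, midSeq_eq_sub]
      congr 2
      push_cast
      rw [val_iUnit]
      linear_combination (dirSeq a k : GaussianInt) * hs
  · left
    rw [dartPos_self, along_backPos_add_one (by rw [sideLabel_zero, sideLabel_zero]) (by omega),
      sideLabel_odd]
  · rw [label_head_mul hk]
    have e : midSeq a k + iPow s * ((iUnit s * dirSeq a k : GaussianIntˣ) : GaussianInt) =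
        2 * ptSeq a k := by
      rw [midSeq]; push_cast; rw [val_iUnit]; linear_combination (dirSeq a k : GaussianInt) * hs
    rcases k with _ | j
    · left; rw [e, mul_zero, sideLabel_zero, ptSeq_zero, mul_zero]
    · by_cases h : a j = s
      · exact Or.inr (Or.inr ⟨j, rfl, rfl, h⟩)
      · left; rw [e, show 2 * (j + 1) = 2 * j + 2 by ring, sideLabel_inl fun _ => h]

end labels

/-- If the initial node of a side is a vertex where the curve turns to this side, then the side
is in contact with the side which precedes it in the contour. -/
theorem IsTiling.contact_of_turn (h : IsTiling a N) {k k' : ℕ} {δ δ' : GaussianIntˣ} {g : Motion}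
    (hk : k < N) (hk' : k' < N) (hc : Contact a (ptSeq a N) s k δ k' δ' g)
    (ht : (∃ j, k' = j + 1 ∧ δ' = -dirSeq a k' ∧ a j = -s) ∨
      (k' + 1 < N ∧ δ' = dirSeq a k' ∧ a k' = s)) :
    g = 1 ∧ ((k' = k + 1 ∧ δ' = -dirSeq a k' ∧ δ = -(iUnit s * dirSeq a k)) ∨
      (k = k' + 1 ∧ δ' = dirSeq a k' ∧ δ = iUnit s * dirSeq a k)) := by
  rcases ht with ⟨j, rfl, rfl, hj⟩ | ⟨h1, rfl, h2⟩
  · obtain ⟨rfl, rfl, e⟩ := h.contact_unique hk (by omega) hc.symm (contact_turn_neg hj).symm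
    exact ⟨inv_injective e, Or.inl ⟨rfl, rfl, rfl⟩⟩
  · obtain ⟨rfl, rfl, e⟩ := h.contact_unique hk h1 hc.symm (contact_turn_pos h2)
    exact ⟨inv_eq_one.1 e, Or.inr ⟨rfl, rfl, rfl⟩⟩

/-- The gluing still respects the labels although some vertices were split: the two sides at a
vertex inside a turn are glued to each other, so that a new label only occurs at the tip of such a
fold. -/
theorem IsTiling.label_contact (h : IsTiling a N) {k k' : ℕ} {δ δ' : GaussianIntˣ} {g : Motion}
    (hk : k < N) (hk' : k' < N) (hc : Contact a (ptSeq a N) s k δ k' δ' g) :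
    along N s (sideLabel a N) (dartPos a N s n₀ k' δ') =
      along N s (sideLabel a N) (dartPos a N s n₀ k δ + 1) := by
  rcases label_tail_cases (a := a) (s := s) (n₀ := n₀) hk' δ' with ht | ht
  · rcases label_head_cases (a := a) (s := s) (n₀ := n₀) hk δ with hh | ⟨h1, rfl, h2⟩ | ⟨j, rfl, rfl, h2⟩
    · rw [ht, hh]
      exact congrArg Sum.inl (Quotient.sound ⟨g, hc.act_tail⟩)
    · obtain ⟨rfl, rfl, -⟩ := h.contact_unique hk' h1 hc (contact_turn_neg h2)
      rw [label_tail_neg hk', label_head_neg_mul hk]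
      rfl
    · obtain ⟨rfl, rfl, -⟩ := h.contact_unique hk' (by omega) hc (contact_turn_pos h2).symm
      rw [label_tail_self hk', label_head_mul hk]
      rfl
  · obtain ⟨-, ⟨rfl, rfl, rfl⟩ | ⟨rfl, rfl, rfl⟩⟩ := h.contact_of_turn hk hk' hc ht
    · rw [label_tail_neg hk', label_head_neg_mul hk]
      rfl
    · rw [label_tail_self hk', label_head_mul hk]
      rfl

/-- The N - 1 interior vertices give new labels on the sides to which the curve turns, and no orbit
is lost since each of these vertices keeps its orbit on the opposite side. With the N + 2 orbits
this makes 2N + 1 labels for 2N pairs of sides, as required by `contour_disjoint`. -/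
theorem IsTiling.le_ncard_labels (h : IsTiling a N) (hn₀ : n₀ < 2 * N) (hn₁ : 0 < n₀) :
    2 * N + 1 ≤ (along N s (sideLabel a N) '' Set.Icc (-(n₀ : ℤ)) (4 * N - n₀)).ncard := by
  set L := along N s (sideLabel a N)
  have hN := h.pos
  have hside : ∀ (σ : ℤˣ) (n : ℕ), n ≤ 2 * N →
      sideLabel a N σ n ∈ L '' Set.Icc (-(n₀ : ℤ)) (4 * N - n₀) := by
    intro σ n hn
    have hσ : σ = s ∨ σ = -s := by
      rcases Int.units_eq_one_or σ with rfl | rfl <;> rcases Int.units_eq_one_or s with rfl | rfl <;>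
        simp
    rcases hσ with rfl | rfl
    · refine ⟨backPos N n₀ n, ?_, along_backPos (by rw [sideLabel_last, sideLabel_last])
        (by rw [sideLabel_zero, sideLabel_zero]) hn⟩
      rw [Set.mem_Icc]
      unfold backPos
      split_ifs <;> omega
    · exact ⟨n, ⟨by omega, by omega⟩, along_forward hn⟩
  have hvert : ∀ k, k ≤ N → Sum.inl (Quotient.mk _ (2 * ptSeq a k)) ∈
      L '' Set.Icc (-(n₀ : ℤ)) (4 * N - n₀) := by
    rintro (_ | k) hk
    · have := hside s 0 (by omega)
      rwa [sideLabel_zero, ← mul_zero 2, ← ptSeq_zero (a := a)] at this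
    · have := hside (-a k) (2 * k + 2) (by omega)
      rwa [sideLabel_inl] at this
      intro _
      rcases Int.units_eq_one_or (a k) with h | h <;> rw [h] <;> decide
  obtain ⟨hfin, hcard⟩ := h.le_ncard_nodeOrbits
  have hsub : Sum.inl '' IsTiling.nodeOrbits a N ∪ Sum.inr '' (Set.Ico 1 N) ⊆
      L '' Set.Icc (-(n₀ : ℤ)) (4 * N - n₀) := by
    rintro _ (⟨_, ⟨k, hk, δ, rfl⟩, rfl⟩ | ⟨p, hp, rfl⟩)
    · rcases dart_cases a 1 k δ with rfl | rfl | rfl | rfl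
      · have := hvert k hk.le
        rwa [show 2 * ptSeq a k = midSeq a k + ((-dirSeq a k : GaussianIntˣ) : GaussianInt) by
          rw [midSeq]; push_cast; ring] at this
      · have := hside (-1) (2 * k + 1) (by omega)
        rwa [sideLabel_odd, iPow_neg, neg_mul, ← val_iUnit, ← Units.val_mul, ← Units.val_neg] at this
      · have := hvert (k + 1) hk
        rwa [show 2 * ptSeq a (k + 1) = midSeq a k + (dirSeq a k : GaussianInt) by
          rw [midSeq_eq_sub]; ring] at this
      · have := hside 1 (2 * k + 1) (by omega)
        rwa [sideLabel_odd, ← val_iUnit, ← Units.val_mul] at this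
    · obtain ⟨hp1, hp2⟩ := hp
      have := hside (a (p - 1)) (2 * (p - 1) + 2) (by omega)
      rwa [sideLabel_inr (by omega) rfl, Nat.sub_add_cancel hp1] at this
  refine le_trans ?_ (Set.ncard_le_ncard hsub ((Set.finite_Icc _ _).image _))
  rw [Set.ncard_union_eq ?_ (hfin.image _) ((Set.finite_Ico _ _).image _),
    Set.ncard_image_of_injective _ Sum.inl_injective, Set.ncard_image_of_injective _ Sum.inr_injective,
    ← Finset.coe_Ico, Set.ncard_coe_finset, Nat.card_Ico]
  · omega
  · rw [Set.disjoint_left]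
    rintro _ ⟨_, _, rfl⟩ ⟨_, _, h⟩
    exact absurd h (by simp)

end Folding

namespace Folding

/-! ### Unfolding of the contour -/

/-- The rotation by `i^s` around the end `2Q` of the first tile. -/
def endRot (s : ℤˣ) : Motion := ⟨iUnit s, 1 - iPow s, isEven_one_sub_iPow s⟩

/-- The motions which unfold the three parts of the contour. -/
def zoneMotion (N : ℕ) (s : ℤˣ) (t : ℤ) : Motion :=
  if t < 0 then Motion.rot (iUnit s)⁻¹ else if t < 2 * N then 1 else endRot s

variable {a : ℕ → ℤˣ} {N : ℕ} {s : ℤˣ} {n₀ : ℕ}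

theorem endRot_act (Q : GaussianInt) (s : ℤˣ) : (endRot s).act Q (2 * Q) = 2 * Q := by
  simp only [endRot, Motion.act, val_iUnit]; ring

theorem along_sideNode_zero : along N s (sideNode a) 0 = 0 := by
  have := along_forward (N := N) (s := s) (Φ := sideNode a) (n := 0) (by omega)
  simpa [sideNode, ptSeq_zero] using this

theorem along_sideNode_last : along N s (sideNode a) (2 * N) = 2 * ptSeq a N := by
  have := along_forward (N := N) (s := s) (Φ := sideNode a) (n := 2 * N) le_rfl
  rw [sideNode_even] at this
  exact_mod_cast this

/-- The nodes of the contour, unfolded. -/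
def unfolded (a : ℕ → ℤˣ) (N : ℕ) (s : ℤˣ) (t : ℤ) : GaussianInt :=
  (zoneMotion N s t).act (ptSeq a N) (along N s (sideNode a) t)

/-- The motion changes only at the positions 0 and 2N, where the node is fixed by the rotations that
are introduced. So the unfolded contour has no jump there. -/
theorem zoneMotion_act_succ (hN : 0 < N) (t : ℤ) :
    (zoneMotion N s t).act (ptSeq a N) (along N s (sideNode a) (t + 1)) = unfolded a N s (t + 1) := by
  unfold unfolded
  rcases eq_or_ne t (-1) with rfl | h1
  · rw [neg_add_cancel, along_sideNode_zero, zoneMotion, if_pos (by norm_num), zoneMotion,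
      if_neg (by norm_num), if_pos (by omega), Motion.act_rot, Motion.act_one, mul_zero]
  rcases eq_or_ne t (2 * N - 1) with rfl | h2
  · rw [sub_add_cancel, along_sideNode_last, zoneMotion, if_neg (by omega), if_pos (by omega),
      zoneMotion, if_neg (by omega), if_neg (by omega), Motion.act_one, endRot_act]
  · have : zoneMotion N s t = zoneMotion N s (t + 1) := by
      unfold zoneMotion
      split_ifs <;> first | rfl | omega
    rw [this]

theorem zoneMotion_backPos {h n : ℕ} (h1 : 1 ≤ n) (h2 : n + 1 ≤ 2 * N)
    (hlt : backPos N h (n + 1) < backPos N h n) :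
    zoneMotion N s (backPos N h (n + 1)) = zoneMotion N s (backPos N h n) := by
  unfold backPos at hlt ⊢
  unfold zoneMotion
  split_ifs at hlt ⊢ <;> first | rfl | (push_cast at *; omega)

/-- The two neighbours of the position 0 unfold to the same node, and so do those of the position
2N. In `IsTiling.contact_motion`, this gives a second fixed point for the contacts folded around
these centres. -/
theorem unfolded_one (hN : 0 < N) : unfolded a N s 1 = 1 - iPow s := by
  have := along_forward (N := N) (s := s) (Φ := sideNode a) (n := 1) (by omega)
  rw [unfolded, zoneMotion, if_neg (by norm_num), if_pos (by omega), Motion.act_one]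
  rw [Nat.cast_one] at this
  rw [this, show 1 = 2 * 0 + 1 by ring, sideNode_odd, midSeq_zero, dirSeq_zero, iPow_neg]
  simp [sub_eq_add_neg]

theorem unfolded_neg_one : unfolded a N s (-1) = 1 - iPow s := by
  have h1 : along N s (sideNode a) (-1) = 1 + iPow s := by
    rw [along, if_pos (by norm_num), show (- -1 : ℤ).toNat = 2 * 0 + 1 by norm_num, sideNode_odd,
      midSeq_zero, dirSeq_zero]
    simp
  rw [unfolded, zoneMotion, if_pos (by norm_num), h1, Motion.act_rot, iUnit_inv, val_iUnit, iPow_neg]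
  linear_combination -(iPow_mul_self s)

theorem unfolded_before_last (hN : 0 < N) :
    unfolded a N s (2 * N - 1) = 2 * ptSeq a N - (1 + iPow s) * dirSeq a (N - 1) := by
  have := along_forward (N := N) (s := s) (Φ := sideNode a) (n := 2 * (N - 1) + 1) (by omega)
  rw [unfolded, zoneMotion, if_neg (by omega), if_pos (by omega), Motion.act_one]
  rw [show ((2 * (N - 1) + 1 : ℕ) : ℤ) = 2 * N - 1 by omega] at this
  rw [this, sideNode_odd, midSeq_eq_sub, Nat.sub_add_cancel hN, iPow_neg]
  ring

theorem unfolded_after_last (hN : 0 < N) :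
    unfolded a N s (2 * N + 1) = 2 * ptSeq a N - (1 + iPow s) * dirSeq a (N - 1) := by
  have h1 : along N s (sideNode a) (2 * N + 1) =
      2 * ptSeq a N - dirSeq a (N - 1) + iPow s * dirSeq a (N - 1) := by
    rw [along, if_neg (by omega), if_neg (by omega),
      show (4 * N - (2 * N + 1) : ℤ).toNat = 2 * (N - 1) + 1 by omega, sideNode_odd, midSeq_eq_sub,
      Nat.sub_add_cancel hN]
  rw [unfolded, zoneMotion, if_neg (by omega), if_neg (by omega), h1, endRot, Motion.act, val_iUnit]
  linear_combination (dirSeq a (N - 1) : GaussianInt) * iPow_mul_self s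

/-! ### Special labels -/

/-- Only one corner of the tile belongs to the orbit of 0, because the whole group of rotations
fixes this centre. Hence its label occurs once in the contour; the same holds for 2Q. -/
theorem IsTiling.sideLabel_eq_zero (h : IsTiling a N) {σ : ℤˣ} {n : ℕ} (hn : n ≤ 2 * N)
    (he : sideLabel a N σ n = Sum.inl (Quotient.mk _ 0)) : n = 0 := by
  unfold sideLabel at he
  split_ifs at he
  obtain ⟨g, hg⟩ := Quotient.exact (Sum.inl_injective he)
  rcases Nat.even_or_odd' n with ⟨k, rfl | rfl⟩
  · rcases k with _ | k
    · rfl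
    · exfalso
      rw [sideNode_even, show 2 * ptSeq a (k + 1) = midSeq a k + (dirSeq a k : GaussianInt) by
        rw [midSeq_eq_sub]; ring] at hg
      obtain ⟨rfl, h2⟩ := h.node_zero (by omega) hg
      exact unit_ne_neg _ h2
  · exfalso
    rw [sideNode_odd, ← val_iUnit, ← Units.val_mul] at hg
    obtain ⟨rfl, h2⟩ := h.node_zero (by omega) hg
    exact iUnit_mul_ne_neg _ _ h2

theorem IsTiling.sideLabel_eq_last (h : IsTiling a N) {σ : ℤˣ} {n : ℕ} (hn : n ≤ 2 * N)
    (he : sideLabel a N σ n = Sum.inl (Quotient.mk _ (2 * ptSeq a N))) : n = 2 * N := by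
  by_contra hne
  unfold sideLabel at he
  split_ifs at he
  obtain ⟨g, hg⟩ := Quotient.exact (Sum.inl_injective he)
  rcases Nat.even_or_odd' n with ⟨k, rfl | rfl⟩
  · rw [sideNode_even, show 2 * ptSeq a k = midSeq a k + ((-dirSeq a k : GaussianIntˣ) : GaussianInt) by
        rw [midSeq]; push_cast; ring] at hg
    obtain ⟨rfl, h2⟩ := h.node_two_mul (by omega) hg
    exact unit_ne_neg _ h2.symm
  · rw [sideNode_odd, ← val_iUnit, ← Units.val_mul] at hg
    obtain ⟨rfl, h2⟩ := h.node_two_mul (by omega) hg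
    exact iUnit_mul_ne _ _ h2

theorem IsTiling.label_eq_zero (h : IsTiling a N) (hn₀ : n₀ < 2 * N) (hn₁ : 0 < n₀) {t : ℤ}
    (ht : t ∈ Set.Icc (-(n₀ : ℤ)) (4 * N - n₀))
    (he : along N s (sideLabel a N) t = Sum.inl (Quotient.mk _ 0)) : t = 0 := by
  obtain ⟨h1, h2⟩ := ht
  unfold along at he
  split_ifs at he
  · have := h.sideLabel_eq_zero (by omega) he; omega
  · have := h.sideLabel_eq_zero (by omega) he; omega
  · have := h.sideLabel_eq_zero (by omega) he; omega

theorem IsTiling.label_eq_last (h : IsTiling a N) (hn₀ : n₀ < 2 * N) {t : ℤ}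
    (ht : t ∈ Set.Icc (-(n₀ : ℤ)) (4 * N - n₀))
    (he : along N s (sideLabel a N) t = Sum.inl (Quotient.mk _ (2 * ptSeq a N))) : t = 2 * N := by
  obtain ⟨h1, h2⟩ := ht
  unfold along at he
  split_ifs at he
  · have := h.sideLabel_eq_last (by omega) he; omega
  · have := h.sideLabel_eq_last (by omega) he; omega
  · have := h.sideLabel_eq_last (by omega) he; omega

/-! ### The pairing of the sides of a tile -/

/-- A position determines its side, and a side determines its contact. The contacts thus become
functions on positions, in the form required by `contour_disjoint`. -/
theorem IsTiling.exists_pairing (h : IsTiling a N) (s : ℤˣ) (n₀ : ℕ) :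
    ∃ (τ : ℤ → ℤ) (γ : ℤ → Motion), ∀ k < N, ∀ δ, ∀ k' < N, ∀ δ' g,
      Contact a (ptSeq a N) s k δ k' δ' g →
        τ (dartPos a N s n₀ k δ) = dartPos a N s n₀ k' δ' ∧ γ (dartPos a N s n₀ k δ) = g := by
  have key : ∀ t : ℤ, ∃ (t' : ℤ) (g₀ : Motion), ∀ k < N, ∀ δ, ∀ k' < N, ∀ δ' g,
      dartPos a N s n₀ k δ = t → Contact a (ptSeq a N) s k δ k' δ' g →
        t' = dartPos a N s n₀ k' δ' ∧ g₀ = g := by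
    intro t
    by_cases ht : ∃ k < N, ∃ δ, dartPos a N s n₀ k δ = t
    · obtain ⟨k, hk, δ, rfl⟩ := ht
      obtain ⟨k', hk', δ', g, hc⟩ := h.exists_contact s k δ
      refine ⟨dartPos a N s n₀ k' δ', g, fun k₁ hk₁ δ₁ k₁' hk₁' δ₁' g₁ he hc₁ => ?_⟩
      obtain ⟨rfl, rfl⟩ := dartPos_inj hk₁ hk he
      obtain ⟨rfl, rfl, rfl⟩ := h.contact_unique hk' hk₁' hc hc₁
      exact ⟨rfl, rfl⟩
    · exact ⟨0, 1, fun k hk δ _ _ _ _ he => absurd ⟨k, hk, δ, he⟩ ht⟩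
  choose τ γ hτ using key
  exact ⟨τ, γ, fun k hk δ k' hk' δ' g hc => hτ _ k hk δ k' hk' δ' g rfl hc⟩

set_option maxHeartbeats 1000000 in
/-- The contacts of a tile are determined by the positions of the sides in the contour, and two
contacts do not cross. -/
theorem IsTiling.contact_motion (h : IsTiling a N) (hn₀ : n₀ < 2 * N) (hn₁ : 0 < n₀)
    (hlab : sideLabel a N s n₀ = Sum.inl (Quotient.mk _ ((1 + iPow 1) * ptSeq a N)))
    {k k' : ℕ} {δ δ' : GaussianIntˣ} {g : Motion} (hk : k < N) (hk' : k' < N)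
    (hc : Contact a (ptSeq a N) s k δ k' δ' g)
    (hlt : dartPos a N s n₀ k δ < dartPos a N s n₀ k' δ') :
    g = (zoneMotion N s (dartPos a N s n₀ k δ))⁻¹ * zoneMotion N s (dartPos a N s n₀ k' δ') ∧
      ∀ {k₁ k₁' : ℕ} {δ₁ δ₁' : GaussianIntˣ} {g₁ : Motion}, k₁ < N → k₁' < N →
        Contact a (ptSeq a N) s k₁ δ₁ k₁' δ₁' g₁ →
        dartPos a N s n₀ k δ < dartPos a N s n₀ k₁ δ₁ →
        dartPos a N s n₀ k₁ δ₁ < dartPos a N s n₀ k' δ' →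
        dartPos a N s n₀ k₁' δ₁' < dartPos a N s n₀ k' δ' := by
  have hN := h.pos
  have hQ := h.ptSeq_ne_zero
  set Q := ptSeq a N
  obtain ⟨τ, γ, hτγ⟩ := h.exists_pairing s n₀
  set lo : ℤ := -(n₀ : ℤ) with hlo
  set hi : ℤ := 4 * N - n₀ with hhi
  set L := along N s (sideLabel a N) with hL
  set ω := along N s (sideNode a) with hω
  -- each position is that of a side and of a contact
  have full : ∀ t ∈ Finset.Ico lo hi, ∃ k < N, ∃ δ, ∃ k' < N, ∃ δ' g,
      dartPos a N s n₀ k δ = t ∧ Contact a Q s k δ k' δ' g ∧ τ t = dartPos a N s n₀ k' δ' ∧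
        γ t = g := by
    intro t ht
    obtain ⟨k, hk, δ, rfl⟩ := exists_dartPos_eq (a := a) (s := s) hn₀ ht
    obtain ⟨k', hk', δ', g, hc⟩ := h.exists_contact s k δ
    obtain ⟨h1, h2⟩ := hτγ k hk δ k' hk' δ' g hc
    exact ⟨k, hk, δ, k', hk', δ', g, rfl, hc, h1, h2⟩
  have hτ : ∀ t ∈ Finset.Ico lo hi, τ t ∈ Finset.Ico lo hi := by
    intro t ht
    obtain ⟨k, hk, δ, k', hk', δ', g, -, -, h1, -⟩ := full t ht
    rw [h1]; exact dartPos_mem hn₀ hk' δ'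
  have hττ : ∀ t ∈ Finset.Ico lo hi, τ (τ t) = t := by
    intro t ht
    obtain ⟨k, hk, δ, k', hk', δ', g, rfl, hc, h1, -⟩ := full t ht
    rw [h1, (hτγ k' hk' δ' k hk δ _ hc.symm).1]
  have hne : ∀ t ∈ Finset.Ico lo hi, τ t ≠ t := by
    intro t ht
    obtain ⟨k, hk, δ, k', hk', δ', g, rfl, hc, h1, -⟩ := full t ht
    rw [h1]
    intro he
    obtain ⟨rfl, rfl⟩ := dartPos_inj hk' hk he
    exact hc.irrefl
  have hf1 : ∀ t ∈ Finset.Ico lo hi, L (τ t) = L (t + 1) := by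
    intro t ht
    obtain ⟨k, hk, δ, k', hk', δ', g, rfl, hc, h1, -⟩ := full t ht
    rw [h1]; exact h.label_contact hk hk' hc
  have hf2 : ∀ t ∈ Finset.Ico lo hi, L (τ t + 1) = L t := by
    intro t ht
    rw [← hf1 (τ t) (hτ t ht), hττ t ht]
  have hLlo : L lo = Sum.inl (Quotient.mk _ ((1 + iPow 1) * Q)) := by
    rw [← hlab, hL, along, if_pos (by omega)]
    congr 1; omega
  have hLhi : L hi = Sum.inl (Quotient.mk _ ((1 + iPow 1) * Q)) := by
    rw [← hlab, hL, along, if_neg (by omega), if_neg (by omega)]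
    congr 1; omega
  have disj : ∀ {t p q : ℤ}, t ∈ Finset.Ico lo hi → t < p → p ≤ τ t → q ∈ Set.Icc lo hi →
      (q ≤ t ∨ τ t < q) → L p ≠ L q := by
    intro t p q ht h1 h2 h3 h4
    exact contour_disjoint (E := 2 * N) (by push_cast; omega) (hLlo.trans hLhi.symm) hτ hττ hne hf1 hf2
      (h.le_ncard_labels hn₀ hn₁) ht h1 h2 h3 h4
  -- contacts do not cross
  have nocross : ∀ {t i : ℤ}, t ∈ Finset.Ico lo hi → t < i → i < τ t → t < τ i ∧ τ i < τ t := by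
    intro t i ht h1 h2
    have ht' := hτ t ht
    have hi' : i ∈ Finset.Ico lo hi := by rw [Finset.mem_Ico] at *; omega
    have hτi := hτ i hi'
    rw [Finset.mem_Ico] at hτi
    by_contra hcon
    rcases eq_or_ne (τ i) (τ t) with he | hne'
    · have := congrArg τ he
      rw [hττ i hi', hττ t ht] at this
      omega
    -- The positions i + 1 and `τ i` carry the same label, the first one between the two passages
    -- and the second one outside.
    · exact disj ht (p := i + 1) (q := τ i) (by omega) (by omega) ⟨by omega, by omega⟩ (by omega)
        (hf1 i hi').symm
  have hγ1 : ∀ t ∈ Finset.Ico lo hi, (γ t).act Q (ω (τ t)) = ω (t + 1) := by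
    intro t ht
    obtain ⟨k, hk, δ, k', hk', δ', g, rfl, hc, h1, h2⟩ := full t ht
    rw [h1, h2, hω, along_sideNode_tail hk', along_sideNode_head hk]
    exact hc.act_tail
  have hγ2 : ∀ t ∈ Finset.Ico lo hi, (γ t).act Q (ω (τ t + 1)) = ω t := by
    intro t ht
    obtain ⟨k, hk, δ, k', hk', δ', g, rfl, hc, h1, h2⟩ := full t ht
    rw [h1, h2, hω, along_sideNode_head hk', along_sideNode_tail hk]
    exact hc.act_head
  -- the motion of a contact, given that the contour between the two sides is closed when unfolded
  have motion : ∀ t ∈ Finset.Ico lo hi, t < τ t → unfolded a N s (t + 1) = unfolded a N s (τ t) →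
      γ t = (zoneMotion N s t)⁻¹ * zoneMotion N s (τ t) := by
    intro t ht hlt hun
    have ht' := hτ t ht
    rw [Finset.mem_Ico] at ht'
    have ht0 := Finset.mem_Ico.1 ht
    have hfix : (zoneMotion N s t * γ t * (zoneMotion N s (τ t))⁻¹).act Q (unfolded a N s (τ t)) =
        unfolded a N s (τ t) := by
      rw [Motion.act_mul, Motion.act_mul, unfolded, Motion.act_inv_act, hγ1 t ht,
        zoneMotion_act_succ hN, hun, unfolded]
    have hfix' : (zoneMotion N s t * γ t * (zoneMotion N s (τ t))⁻¹).act Q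
        (unfolded a N s (τ t + 1)) = unfolded a N s t := by
      rw [← zoneMotion_act_succ hN, Motion.act_mul, Motion.act_mul, Motion.act_inv_act, hγ2 t ht]
      rfl
    -- The motion fixes the unfolded node at `τ t`. If it is not trivial, this node is in the orbit
    -- of a centre. For 0 and 2Q, which occur once in the contour, the two sides are adjacent to
    -- that occurrence and a second fixed node appears. The label of (1 + i)Q is carried by `lo`,
    -- outside the part between the two sides.
    suffices hone : zoneMotion N s t * γ t * (zoneMotion N s (τ t))⁻¹ = 1 by
      rw [mul_inv_eq_one] at hone
      rw [← hone, inv_mul_cancel_left]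
    obtain ⟨k, hk, δ, k', hk', δ', g, hpos, hc, h1, h2⟩ := full t ht
    rcases label_tail_cases (a := a) (s := s) (n₀ := n₀) hk' δ' with hl | hl
    · by_contra hne1
      rw [← h1] at hl
      have hcls : ∀ y, (∃ m : Motion, m.act Q y = unfolded a N s (τ t)) →
          L (τ t) = Sum.inl (Quotient.mk _ y) := by
        rintro y ⟨m, hm⟩
        rw [hL, hl]
        refine congrArg Sum.inl (Quotient.sound ⟨m⁻¹ * zoneMotion N s (τ t), ?_⟩)
        have e : midSeq a k' + (δ' : GaussianInt) = ω (τ t) := by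
          rw [h1, hω, along_sideNode_tail hk']
        rw [Motion.act_mul, e]
        change m⁻¹.act Q (unfolded a N s (τ t)) = y
        rw [← hm, Motion.act_inv_act]
      rcases Motion.fixed_cases hQ hne1 hfix with hm | hm | hm
      · have e1 := hcls _ hm
        have e2 := e1
        rw [hf1 t ht] at e2
        have p1 := h.label_eq_zero hn₀ hn₁ ⟨by omega, by omega⟩ e1
        have p2 := h.label_eq_zero hn₀ hn₁ ⟨by omega, by omega⟩ e2
        obtain rfl : t = -1 := by omega
        rw [p1, zero_add, unfolded_one hN, unfolded_neg_one] at hfix'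
        rw [p1] at hfix
        have e0 : unfolded a N s 0 = 0 := by
          rw [unfolded, along_sideNode_zero, zoneMotion, if_neg (by omega), if_pos (by omega),
            Motion.act_one]
        rw [e0] at hfix
        refine hne1 (Motion.eq_one_of_act_eq hQ (y := 0) (z := 1 - iPow s) ?_ ?_ ?_)
        · rcases Int.units_eq_one_or s with rfl | rfl <;> decide
        · rw [p1]; exact hfix
        · rw [p1]; exact hfix'
      · have e1 := hcls _ hm
        have e2 := e1
        rw [hf1 t ht] at e2
        have p1 := h.label_eq_last hn₀ ⟨by omega, by omega⟩ e1
        have p2 := h.label_eq_last hn₀ ⟨by omega, by omega⟩ e2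
        obtain rfl : t = 2 * N - 1 := by omega
        rw [p1, unfolded_before_last hN, unfolded_after_last hN] at hfix'
        rw [p1] at hfix
        have e0 : unfolded a N s (2 * N) = 2 * Q := by
          rw [unfolded, along_sideNode_last, zoneMotion, if_neg (by omega), if_neg (by omega),
            endRot_act]
        rw [e0] at hfix
        refine hne1 (Motion.eq_one_of_act_eq hQ (y := 2 * Q)
          (z := 2 * Q - (1 + iPow s) * dirSeq a (N - 1)) ?_ ?_ ?_)
        · intro he
          have h0 : (1 + iPow s) * (dirSeq a (N - 1) : GaussianInt) = 0 := by linear_combination he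
          rcases mul_eq_zero.1 h0 with h3 | h3
          · revert h3
            rcases Int.units_eq_one_or s with rfl | rfl <;> decide
          · exact (dirSeq a (N - 1)).ne_zero h3
        · rw [p1]; exact hfix
        · rw [p1]; exact hfix'
      · have e1 := hcls _ hm
        exact disj ht hlt le_rfl ⟨le_rfl, by omega⟩ (Or.inl ht0.1) (e1.trans hLlo.symm)
    · obtain ⟨rfl, hcase⟩ := h.contact_of_turn hk hk' hc hl
      have hz : zoneMotion N s t = zoneMotion N s (τ t) := by
        rcases hcase with ⟨rfl, rfl, rfl⟩ | ⟨rfl, rfl, rfl⟩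
        · rw [h1, ← hpos, dartPos_neg_mul, dartPos_neg, zoneMotion, zoneMotion, if_neg (by omega),
            if_pos (by omega), if_neg (by omega), if_pos (by push_cast; omega)]
        · rw [h1, ← hpos, dartPos_mul, dartPos_self] at hlt
          rw [h1, ← hpos, dartPos_mul, dartPos_self]
          exact zoneMotion_backPos (by omega) (by omega) hlt
      rw [h2, mul_one, hz, mul_inv_cancel]
  -- induction on the length of the contour between the two sides
  have main : ∀ (n : ℕ) (t : ℤ), t ∈ Finset.Ico lo hi → t < τ t → τ t - t ≤ n →
      γ t = (zoneMotion N s t)⁻¹ * zoneMotion N s (τ t) := by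
    intro n
    induction n with
    | zero => intro t _ h1 h2; omega
    | succ n ih =>
      intro t ht hlt hle
      have ht' := hτ t ht
      refine motion t ht hlt ?_
      -- closed intervals
      have closed : ∀ (l : ℕ) (p : ℤ), t < p → p ≤ τ t → τ t - p ≤ l →
          (∀ i, p ≤ i → i < τ t → p ≤ τ i) → unfolded a N s p = unfolded a N s (τ t) := by
        intro l
        induction l with
        | zero =>
          intro p _ h2 h3 _
          have : p = τ t := by omega
          rw [this]
        | succ l ihl =>
          intro p h1 h2 h3 h4
          rcases eq_or_lt_of_le h2 with h5 | h5
          · rw [h5]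
          have hp : p ∈ Finset.Ico lo hi := by rw [Finset.mem_Ico] at *; omega
          have h6 := (nocross ht h1 h5)
          have h7 : p < τ p := lt_of_le_of_ne (h4 p le_rfl h5) (hne p hp).symm
          -- The sides at p and `τ p` enclose a shorter part, so their motion is known. It shows
          -- that the unfolded walk is at the same node at p and just after `τ p`; such closed
          -- excursions fill the whole interval.
          have h8 := ih p hp h7 (by omega)
          have h9 : unfolded a N s (τ p + 1) = unfolded a N s p := by
            rw [← zoneMotion_act_succ hN, unfolded]
            change _ = (zoneMotion N s p).act Q (ω p)
            rw [← hγ2 p hp, h8, Motion.act_mul, Motion.act_act_inv]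
          rw [← h9]
          refine ihl _ (by omega) (by omega) (by omega) ?_
          intro i hi1 hi2
          have hi3 : i ∈ Finset.Ico lo hi := by rw [Finset.mem_Ico] at *; omega
          have hi4 := h4 i (by omega) hi2
          by_contra hcon
          push Not at hcon
          rcases eq_or_lt_of_le hi4 with h10 | h10
          · have := congrArg τ h10
            rw [hττ i hi3] at this
            omega
          rcases eq_or_ne (τ i) (τ p) with h11 | h11
          · have := congrArg τ h11
            rw [hττ i hi3, hττ p hp] at this
            omega
          · have := (nocross hp h10 (by omega)).2
            rw [hττ i hi3] at this
            omega
      refine closed n (t + 1) (by omega) (by omega) (by omega) ?_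
      intro i hi1 hi2
      have := (nocross ht (by omega) hi2).1
      omega
  have ht : dartPos a N s n₀ k δ ∈ Finset.Ico lo hi := dartPos_mem hn₀ hk δ
  obtain ⟨e1, e2⟩ := hτγ k hk δ k' hk' δ' g hc
  refine ⟨?_, ?_⟩
  · rw [← e1, ← e2]
    exact main _ _ ht (by rw [e1]; exact hlt) (Int.self_le_toNat _)
  · intro k₁ k₁' δ₁ δ₁' g₁ hk₁ hk₁' hc₁ h1 h2
    rw [← e1] at h2 ⊢
    rw [← (hτγ k₁ hk₁ δ₁ k₁' hk₁' δ₁' g₁ hc₁).1]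
    exact (nocross ht h1 h2).2

end Folding

namespace Folding

/-! ### The centre of order two, and the contacts of the later segments -/

variable {a : ℕ → ℤˣ} {N : ℕ} {s : ℤˣ} {n₀ : ℕ}

/-- The centre is not in the orbit of either end of the tile, so it appears strictly inside one of
its two sides. If it is a vertex, the side chosen is the one opposite to the turn, where the label
has not been replaced. -/
theorem IsTiling.exists_side_center (h : IsTiling a N) : ∃ (s : ℤˣ) (n₀ : ℕ), 0 < n₀ ∧ n₀ < 2 * N ∧
    sideLabel a N s n₀ = Sum.inl (Quotient.mk _ ((1 + iPow 1) * ptSeq a N)) := by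
  obtain ⟨k, hk, δ, he⟩ : ∃ k < N, ∃ δ : GaussianIntˣ, Quotient.mk (orbitSetoid (ptSeq a N))
      (midSeq a k + δ) = Quotient.mk _ ((1 + iPow 1) * ptSeq a N) := by
    have := h.mk_mem_nodeOrbits (y := (1 + iPow 1) * ptSeq a N)
      (by rw [mul_comm]; exact (isEven_one_add_iPow 1).mul_left _)
    exact this
  have vertex : ∀ p, p ≤ N → Quotient.mk (orbitSetoid (ptSeq a N)) (2 * ptSeq a p) =
      Quotient.mk _ ((1 + iPow 1) * ptSeq a N) → ∃ (s : ℤˣ) (n₀ : ℕ), 0 < n₀ ∧ n₀ < 2 * N ∧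
      sideLabel a N s n₀ = Sum.inl (Quotient.mk _ ((1 + iPow 1) * ptSeq a N)) := by
    intro p hp he
    obtain ⟨g, hg⟩ := Quotient.exact he
    rcases p with _ | p
    · exact absurd (by simpa [ptSeq_zero] using hg) (h.orbit_zero_ne g)
    rcases eq_or_lt_of_le hp with rfl | hp
    · exact absurd hg (h.orbit_two_mul_ne g)
    refine ⟨-a p, 2 * p + 2, by omega, by omega, ?_⟩
    rw [sideLabel_inl, he]
    intro _ hc
    exact units_ne_neg_self (a p) hc
  rcases dart_cases a 1 k δ with rfl | rfl | rfl | rfl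
  · refine vertex k hk.le ?_
    rw [← he, midSeq]; congr 1; push_cast; ring
  · refine ⟨-1, 2 * k + 1, by omega, by omega, ?_⟩
    rw [sideLabel_odd, ← he, iPow_neg]; push_cast; simp
  · refine vertex (k + 1) hk ?_
    rw [← he, midSeq_eq_sub]; congr 1; ring
  · refine ⟨1, 2 * k + 1, by omega, by omega, ?_⟩
    rw [sideLabel_odd, ← he]; push_cast; simp

/-- This motion is the half-turn around (1 + i^s)Q. -/
theorem rot_mul_endRot (s : ℤˣ) :
    (Motion.rot (iUnit s) * endRot s)⁻¹ = Motion.rot (iUnit s) * endRot s := by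
  rcases Int.units_eq_one_or s with rfl | rfl <;>
  · refine Motion.ext ?_ ?_
    · decide
    · simp [Motion.rot, endRot]; decide

/-- If a segment of index `r` of the first tile touches a later one in a translated tile, before the
node in the orbit of `(1 + i)Q`, then the possible contacts of the later segments are known. -/
theorem IsTiling.contact_later (h : IsTiling a N) : ∃ s : ℤˣ, ∀ r,
    (∀ k ≤ r, ∀ (δ : GaussianIntˣ) (g : Motion),
      g.act (ptSeq a N) ((1 + iPow 1) * ptSeq a N) ≠ midSeq a k + δ) →
    ∀ {k₀ : ℕ} {δ₀ δ₀' : GaussianIntˣ} {g₀ : Motion}, k₀ < N → r < k₀ → g₀.e ≠ 0 →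
      Contact a (ptSeq a N) s r δ₀ k₀ δ₀' g₀ →
      (g₀ = endRot s ∨ g₀ = Motion.rot (iUnit s) * endRot s) ∧
      ∀ {p q : ℕ} {δ δ' : GaussianIntˣ} {g : Motion}, p < N → q < N → r < p → r < q →
        Contact a (ptSeq a N) s p δ q δ' g →
        g = 1 ∨ g = endRot s ∨ g = (endRot s)⁻¹ ∨ g = Motion.rot (iUnit s) * endRot s := by
  obtain ⟨s, n₀, hn₁, hn₀, hlab⟩ := h.exists_side_center
  refine ⟨s, fun r hr k₀ δ₀ δ₀' g₀ hk₀ hrk hg₀ hc₀ => ?_⟩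
  -- Otherwise the node of index n₀ would be a corner of a segment of index at most r. It follows
  -- that the sides of the r-th segment have positions close to 0, between those of the later
  -- segments in the first and the second part of the contour.
  have hn : 2 * r + 2 < n₀ := by
    by_contra hcon
    rcases Nat.even_or_odd' n₀ with ⟨k, rfl | rfl⟩
    · obtain ⟨k, rfl⟩ : ∃ j, k = j + 1 := ⟨k - 1, by omega⟩
      unfold sideLabel at hlab
      split_ifs at hlab
      obtain ⟨g, hg⟩ := Quotient.exact (Sum.inl_injective hlab)
      refine hr k (by omega) (dirSeq a k) g⁻¹ ?_
      rw [← hg, Motion.act_inv_act, sideNode_even, midSeq_eq_sub]; ring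
    · rw [sideLabel_odd] at hlab
      obtain ⟨g, hg⟩ := Quotient.exact (Sum.inl_injective hlab)
      refine hr k (by omega) (iUnit s * dirSeq a k) g⁻¹ ?_
      rw [← hg, Motion.act_inv_act]; push_cast; simp
  have before : ∀ δ, -(2 * r + 2 : ℤ) ≤ dartPos a N s n₀ r δ ∧ dartPos a N s n₀ r δ ≤ 2 * r + 1 := by
    intro δ
    rcases dart_cases a s r δ with rfl | rfl | rfl | rfl
    · rw [dartPos_neg]; omega
    · rw [dartPos_neg_mul]; omega
    · rw [dartPos_self, backPos, if_pos (by omega)]; push_cast; omega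
    · rw [dartPos_mul, backPos, if_pos (by omega)]; push_cast; omega
  have after : ∀ k < N, r < k → ∀ δ, dartPos a N s n₀ k δ ≤ -(2 * r + 3 : ℤ) ∨
      2 * r + 1 < dartPos a N s n₀ k δ := by
    intro k hkN hk δ
    rcases dart_cases a s k δ with rfl | rfl | rfl | rfl
    · rw [dartPos_neg]; omega
    · rw [dartPos_neg_mul]; omega
    · rw [dartPos_self, backPos]; split_ifs <;> push_cast <;> omega
    · rw [dartPos_mul, backPos]; split_ifs <;> push_cast <;> omega
  have hb := before δ₀
  have rot_inv : (Motion.rot (iUnit s)⁻¹)⁻¹ = Motion.rot (iUnit s) := by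
    refine Motion.ext ?_ ?_ <;> simp [Motion.rot]
  have zone : ∀ t : ℤ, (t < 0 ∧ zoneMotion N s t = Motion.rot (iUnit s)⁻¹) ∨
      (0 ≤ t ∧ t < 2 * N ∧ zoneMotion N s t = 1) ∨ (2 * N ≤ t ∧ zoneMotion N s t = endRot s) := by
    intro t
    unfold zoneMotion
    split_ifs <;> simp <;> omega
  have rot_e : ∀ u, (Motion.rot u).e = 0 := fun _ => rfl
  -- the contact at `r`
  have hfar : 2 * (N : ℤ) ≤ dartPos a N s n₀ k₀ δ₀' ∧
      (g₀ = endRot s ∨ g₀ = Motion.rot (iUnit s) * endRot s) := by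
    -- Two sides in the first two parts of the contour are in contact by a rotation around 0, which
    -- is excluded for g₀. As the r-th segment is in these two parts, the other side must be in the
    -- third one.
    rcases lt_trichotomy (dartPos a N s n₀ r δ₀) (dartPos a N s n₀ k₀ δ₀') with hlt | heq | hgt
    · have hm := (h.contact_motion hn₀ hn₁ hlab (hrk.trans hk₀) hk₀ hc₀ hlt).1
      rcases zone (dartPos a N s n₀ k₀ δ₀') with ⟨z1, z2⟩ | ⟨z1, z1', z2⟩ | ⟨z1, z2⟩ <;>
      rcases zone (dartPos a N s n₀ r δ₀) with ⟨y1, y2⟩ | ⟨y1, y1', y2⟩ | ⟨y1, y2⟩ <;>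
      rw [z2, y2] at hm <;> first
        | (exfalso; omega)
        | (exfalso; apply hg₀; rw [hm]; simp [rot_e]; done)
        | (refine ⟨z1, ?_⟩; simp [hm, rot_inv])
    · exact absurd (dartPos_inj (hrk.trans hk₀) hk₀ heq).1 (by omega)
    · have hm := (h.contact_motion hn₀ hn₁ hlab hk₀ (hrk.trans hk₀) hc₀.symm hgt).1
      rw [inv_eq_iff_eq_inv] at hm
      rcases zone (dartPos a N s n₀ k₀ δ₀') with ⟨z1, z2⟩ | ⟨z1, z1', z2⟩ | ⟨z1, z2⟩ <;>
      rcases zone (dartPos a N s n₀ r δ₀) with ⟨y1, y2⟩ | ⟨y1, y1', y2⟩ | ⟨y1, y2⟩ <;>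
      rw [z2, y2] at hm <;> first
        | (exfalso; omega)
        | (exfalso; apply hg₀; rw [hm]; simp [rot_e])
  refine ⟨hfar.2, ?_⟩
  have hlt₀ : dartPos a N s n₀ r δ₀ < dartPos a N s n₀ k₀ δ₀' := by omega
  have ordered : ∀ {p q : ℕ} {δ δ' : GaussianIntˣ} {g : Motion}, p < N → q < N → r < p → r < q →
      Contact a (ptSeq a N) s p δ q δ' g → dartPos a N s n₀ p δ < dartPos a N s n₀ q δ' →
      g = 1 ∨ g = endRot s ∨ g = Motion.rot (iUnit s) * endRot s := by
    intro p q δ δ' g hp hq hrp hrq hc hlt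
    obtain ⟨hm, hcross⟩ := h.contact_motion hn₀ hn₁ hlab hp hq hc hlt
    rcases zone (dartPos a N s n₀ p δ) with ⟨z1, z2⟩ | ⟨z1, z1', z2⟩ | ⟨z1, z2⟩ <;>
    rcases zone (dartPos a N s n₀ q δ') with ⟨y1, y2⟩ | ⟨y1, y1', y2⟩ | ⟨y1, y2⟩ <;>
    rw [z2, y2] at hm <;> first
      | (exfalso; omega)
      | (left; rw [hm]; simp; done)
      | (right; left; rw [hm]; simp; done)
      | (right; right; rw [hm, rot_inv]; done)
      | skip
    -- The remaining contact would join the first part to the second one, beyond the r-th segment on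
    -- both sides. It would cross the contact of r, which ends in the third part.
    exfalso
    have h1 := after p hp hrp δ
    have h2 := after q hq hrq δ'
    have := hcross (hrk.trans hk₀) hk₀ hc₀ (by omega) (by omega)
    omega
  intro p q δ δ' g hp hq hrp hrq hc
  rcases lt_trichotomy (dartPos a N s n₀ p δ) (dartPos a N s n₀ q δ') with hlt | heq | hgt
  · rcases ordered hp hq hrp hrq hc hlt with h1 | h1 | h1 <;> simp [h1]
  · obtain ⟨rfl, rfl⟩ := dartPos_inj hp hq heq
    exact absurd hc Contact.irrefl
  · rcases ordered hq hp hrq hrp hc.symm hgt with h1 | h1 | h1 <;> rw [inv_eq_iff_eq_inv] at h1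
    · simp [h1]
    · simp [h1]
    · rw [rot_mul_endRot] at h1; simp [h1]

end Folding

namespace Folding

open Filter

/-! ### Pairings of the edges at the vertices -/

/-- A pairing at each vertex `v` of the edges `2v + w`, with `w` a unit, such that paired edges are
orthogonal, and which joins the consecutive edges of each tile of level `n`. -/
structure LinkSystem (a : ℕ → ℤˣ) (m : ℕ) (L : GaussianInt → GaussianIntˣ → GaussianIntˣ → Prop) :
    Prop where
  symm : ∀ {v w w'}, L v w w' → L v w' w
  exists_turn : ∀ v w, ∃ σ, L v w (iUnit σ * w)
  unique : ∀ {v w w₁ w₂}, L v w w₁ → L v w w₂ → w₁ = w₂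
  tile : ∀ (n : ℕ) (g : Motion) (k : ℕ), k + 1 < m ^ n →
    L (g.u * ptSeq a (k + 1) + ptSeq a (m ^ n) * g.e) (-(g.u * dirSeq a k)) (g.u * dirSeq a (k + 1))

/-- Two edges are joined by a chain of paired edges. -/
def Joined (L : GaussianInt → GaussianIntˣ → GaussianIntˣ → Prop) : GaussianInt → GaussianInt → Prop :=
  Relation.EqvGen fun α β => ∃ v w w', L v w w' ∧ α = 2 * v + w ∧ β = 2 * v + w'

/-- The edges of the four rays starting from the origin. -/
def IsRayEdge (a : ℕ → ℤˣ) (y : GaussianInt) : Prop :=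
  ∃ (u : GaussianIntˣ) (k : ℕ), y = u * midSeq a k

/-- Two edges in the same tile. -/
def SameTile (a : ℕ → ℤˣ) (N : ℕ) (y z : GaussianInt) : Prop :=
  ∃ (g : Motion) (k l : ℕ), k < N ∧ l < N ∧ g.act (ptSeq a N) (midSeq a k) = y ∧
    g.act (ptSeq a N) (midSeq a l) = z

variable {a : ℕ → ℤˣ} {m : ℕ} {L : GaussianInt → GaussianIntˣ → GaussianIntˣ → Prop}

theorem IsRayEdge.unit_mul {y : GaussianInt} (h : IsRayEdge a y) (u : GaussianIntˣ) :
    IsRayEdge a (u * y) := by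
  obtain ⟨v, k, rfl⟩ := h
  exact ⟨u * v, k, by push_cast; ring⟩

theorem isRayEdge_unit_mul_iff {y : GaussianInt} (u : GaussianIntˣ) :
    IsRayEdge a (u * y) ↔ IsRayEdge a y := by
  refine ⟨fun h => ?_, fun h => h.unit_mul u⟩
  have := h.unit_mul u⁻¹
  rwa [Units.inv_mul_cancel_left] at this

theorem TurnRule.ptSeq_pow (hT : TurnRule a m) (n : ℕ) : ptSeq a (m ^ n) = ptSeq a m ^ n := by
  induction n with
  | zero => simp [ptSeq_one]
  | succ n ih => rw [pow_succ, hT.ptSeq_mul, ih, pow_succ, mul_comm]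

/-- The scale of level n is a power with norm at least 2^n, and the norm of a nonzero multiple is at
least that of the scale. -/
theorem TurnRule.eventually_mul_eq (hT : TurnRule a m) (hP : 1 < (ptSeq a m).norm) (z : GaussianInt) :
    ∀ᶠ n in atTop, ∀ e, ptSeq a (m ^ n) * e = z → e = 0 := by
  filter_upwards [eventually_ge_atTop (z.norm.toNat)] with n hn e he
  by_contra hne
  have h1 : (ptSeq a (m ^ n)).norm = (ptSeq a m).norm ^ n := by
    rw [hT.ptSeq_pow]
    exact map_pow (Zsqrtd.normMonoidHom (d := -1)) _ _
  have h2 : (2 : ℤ) ^ n ≤ (ptSeq a (m ^ n)).norm := by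
    rw [h1]; exact pow_le_pow_left₀ (by norm_num) (by omega) n
  have h3 : 0 < e.norm := GaussianInt.norm_pos.2 hne
  have h4 : z.norm = (ptSeq a (m ^ n)).norm * e.norm := by rw [← he, Zsqrtd.norm_mul]
  have h5 : (n : ℤ) < 2 ^ n := by exact_mod_cast Nat.lt_two_pow_self
  have h6 : (ptSeq a (m ^ n)).norm ≤ z.norm := by nlinarith
  omega

/-- A given edge belongs to the initial parts of the tiles of high level only for the tiles which
start from the origin. -/
theorem TurnRule.eventually_act_ne (hT : TurnRule a m) (hP : 1 < (ptSeq a m).norm) (r : ℕ)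
    (y : GaussianInt) :
    ∀ᶠ n in atTop, ∀ k ≤ r, ∀ g : Motion, g.act (ptSeq a (m ^ n)) (midSeq a k) = y → g.e = 0 := by
  have h1 : ∀ᶠ n in atTop, ∀ k ∈ Set.Iic r, ∀ u : GaussianIntˣ, ∀ e,
      ptSeq a (m ^ n) * e = y - u * midSeq a k → e = 0 := by
    rw [eventually_all_finite (Set.finite_Iic r)]
    intro k _
    rw [eventually_all]
    exact fun u => hT.eventually_mul_eq hP _
  filter_upwards [h1] with n hn k hk g hg
  have := hn k hk g.u (2 * g.e) (by rw [← hg, Motion.act]; ring)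
  rcases mul_eq_zero.1 this with h2 | h2
  · exact absurd h2 (by decide)
  · exact h2

/-- The points in the orbit of (1 + i)Q are multiples of Q by nonzero elements, so they leave every
bounded region as the level grows. This provides the hypothesis of `IsTiling.contact_later`. -/
theorem TurnRule.eventually_center_ne (hT : TurnRule a m) (hP : 1 < (ptSeq a m).norm) (r : ℕ) :
    ∀ᶠ n in atTop, ∀ k ≤ r, ∀ (δ : GaussianIntˣ) (g : Motion),
      g.act (ptSeq a (m ^ n)) ((1 + iPow 1) * ptSeq a (m ^ n)) ≠ midSeq a k + δ := by
  have h1 : ∀ᶠ n in atTop, ∀ k ∈ Set.Iic r, ∀ δ : GaussianIntˣ, ∀ e,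
      ptSeq a (m ^ n) * e = midSeq a k + δ → e = 0 := by
    rw [eventually_all_finite (Set.finite_Iic r)]
    intro k _
    rw [eventually_all]
    exact fun u => hT.eventually_mul_eq hP _
  filter_upwards [h1] with n hn k hk δ g hg
  have := hn k hk δ (g.u * (1 + iPow 1) + 2 * g.e) (by rw [← hg, Motion.act]; ring)
  refine norm_mul_unit_ne (z := g.u * (1 + iPow 1)) ?_ (-g.e) (by linear_combination -this)
  rw [Zsqrtd.norm_mul, norm_unit]; decide

/-- The set of all edges is connected for the contact of the sides. -/
theorem odd_induction {P : GaussianInt → Prop} (h1 : P 1)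
    (hstep : ∀ y, P y → ∀ δ : GaussianIntˣ, P (y + (1 + iPow 1) * δ)) {y : GaussianInt}
    (hy : ¬ IsEven y) : P y := by
  have hre : ∀ x : ℤ, P (1 + (1 + iPow 1) * (x : GaussianInt)) := by
    intro x
    induction x using Int.induction_on with
    | zero => simpa using h1
    | succ x ih =>
      have := hstep _ ih 1
      push_cast at this ⊢
      convert this using 1; ring
    | pred x ih =>
      have := hstep _ ih (-1)
      push_cast at this ⊢
      convert this using 1; ring
  have him : ∀ x z : ℤ, P (1 + (1 + iPow 1) * ((x : GaussianInt) + iPow 1 * z)) := by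
    intro x z
    induction z using Int.induction_on with
    | zero => simpa using hre x
    | succ z ih =>
      have := hstep _ ih (iUnit 1)
      push_cast [val_iUnit] at this ⊢
      convert this using 1; ring
    | pred z ih =>
      have := hstep _ ih (-iUnit 1)
      push_cast [val_iUnit] at this ⊢
      convert this using 1; ring
  obtain ⟨w, hw⟩ : ∃ w, y - 1 = (1 + iPow 1) * w := by
    rw [← isEven_iff_exists]
    have := (isEven_add_unit_iff y (-1)).2 hy
    simpa [sub_eq_add_neg] using this
  have := him w.re w.im
  have e : ((w.re : ℤ) : GaussianInt) + iPow 1 * ((w.im : ℤ) : GaussianInt) = w := by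
    rw [gaussianInt_ext_iff]; simp [iPow]
  rw [e, ← hw] at this
  simpa using this

/-! ### Chains of paired edges -/

theorem Joined.refl (y : GaussianInt) : Joined L y y := Relation.EqvGen.refl y

theorem Joined.symm {y z : GaussianInt} (h : Joined L y z) : Joined L z y := Relation.EqvGen.symm _ _ h

theorem Joined.trans {x y z : GaussianInt} (h : Joined L x y) (h' : Joined L y z) : Joined L x z :=
  Relation.EqvGen.trans _ _ _ h h'

theorem joined_of_link {v : GaussianInt} {w w' : GaussianIntˣ} (h : L v w w') :
    Joined L (2 * v + w) (2 * v + w') :=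
  Relation.EqvGen.rel _ _ ⟨v, w, w', h, rfl, rfl⟩

namespace LinkSystem

/-- The four edges at v are paired at right angles. If w is paired with one neighbour, this
neighbour is no longer available for -w, which has to take the other one. -/
theorem complement (hL : LinkSystem a m L) {v : GaussianInt} {w w' : GaussianIntˣ} (h : L v w w') : L v (-w) (-w') := by
  obtain ⟨σ, h1⟩ := hL.exists_turn v w
  obtain rfl := hL.unique h h1
  obtain ⟨ρ, h2⟩ := hL.exists_turn v (-w)
  rcases eq_or_ne ρ σ with rfl | hne
  · rwa [mul_neg] at h2
  · obtain rfl := Int.units_ne_iff_eq_neg.1 hne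
    rw [iUnit_neg, neg_mul_neg] at h2
    have := hL.unique (hL.symm h) (hL.symm h2)
    exact absurd this (unit_ne_neg w)

theorem tile_joined (hL : LinkSystem a m L) {n : ℕ} {y z : GaussianInt} (h : SameTile a (m ^ n) y z) : Joined L y z := by
  obtain ⟨g, k, l, hk, hl, rfl, rfl⟩ := h
  have h0 : ∀ k, k < m ^ n → Joined L (g.act (ptSeq a (m ^ n)) (midSeq a 0))
      (g.act (ptSeq a (m ^ n)) (midSeq a k)) := by
    intro k
    induction k with
    | zero => exact fun _ => Joined.refl _
    | succ k ih =>
      intro hk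
      refine (ih (by omega)).trans ?_
      have := joined_of_link (hL.tile n g k hk)
      convert this using 1
      · rw [Motion.act, midSeq_eq_sub]; push_cast; ring
      · rw [Motion.act, midSeq]; push_cast; ring
  exact (h0 k hk).symm.trans (h0 l hl)

/-- The pairs of edges at a vertex which is not a vertex of level `n` belong to tiles of level
`n`. -/
theorem sameTile_of_link (hL : LinkSystem a m L) {n : ℕ} (hI : IsTiling a (m ^ n)) {v : GaussianInt} {w w' : GaussianIntˣ}
    (h : L v w w') (hv : ∀ e, ptSeq a (m ^ n) * e ≠ v) :
    SameTile a (m ^ n) (2 * v + w) (2 * v + w') := by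
  obtain ⟨g, k, hk, hg⟩ := hI.cover (2 * v + w) (by
    rw [isEven_add_unit_iff]; exact not_not.2 (isEven_two_mul v))
  have e1 : g.act (ptSeq a (m ^ n)) (midSeq a k) =
      2 * (g.u * ptSeq a k + ptSeq a (m ^ n) * g.e) + (g.u * dirSeq a k : GaussianIntˣ) := by
    rw [Motion.act, midSeq]; push_cast; ring
  rcases mid_eq_cases (e1.symm.trans hg) with ⟨h1, h2⟩ | ⟨h1, h2⟩
  · rcases k with _ | k
    · exact absurd (by rw [h1, ptSeq_zero]; ring) (hv g.e)
    · have := hL.symm (hL.tile n g k hk)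
      rw [← h1, ← h2] at this
      obtain rfl := hL.unique h this
      refine ⟨g, k + 1, k, hk, by omega, hg, ?_⟩
      rw [h1, Motion.act, midSeq_eq_sub]; push_cast; ring
  · have h1' : v = g.u * ptSeq a (k + 1) + ptSeq a (m ^ n) * g.e := by
      rw [h1, ptSeq_succ]; push_cast; ring
    rcases eq_or_lt_of_le (Nat.succ_le_of_lt hk) with h3 | h3
    · refine absurd ?_ (hv (g.u + g.e))
      rw [h1', ← Nat.succ_eq_add_one, h3]; ring
    · have := hL.tile n g k h3
      rw [← h1', ← h2] at this
      obtain rfl := hL.unique h this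
      refine ⟨g, k, k + 1, hk, h3, hg, ?_⟩
      rw [h1', Motion.act, midSeq]; push_cast; ring

theorem ray_link (hL : LinkSystem a m L) (hm : 1 < m) (u : GaussianIntˣ) (k : ℕ) :
    L (u * ptSeq a (k + 1)) (-(u * dirSeq a k)) (u * dirSeq a (k + 1)) := by
  have := hL.tile (k + 1) (Motion.rot u) k (Nat.lt_pow_self hm)
  simpa [Motion.rot] using this

/-- Paired edges which are not at the origin belong to the same ray. -/
theorem ray_of_link (hL : LinkSystem a m L) (hm : 1 < m) {v : GaussianInt} {w w' u : GaussianIntˣ} {k : ℕ} (h : L v w w')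
    (hk : 2 * v + w = u * midSeq a k) :
    (v = 0 ∧ w = u ∧ k = 0) ∨ ∃ l, 2 * v + w' = u * midSeq a l := by
  have e1 : u * midSeq a k = 2 * (u * ptSeq a k) + (u * dirSeq a k : GaussianIntˣ) := by
    rw [midSeq]; push_cast; ring
  rcases mid_eq_cases (e1.symm.trans hk.symm) with ⟨h1, h2⟩ | ⟨h1, h2⟩
  · rcases k with _ | k
    · left; simp [h1, h2, ptSeq_zero, dirSeq_zero]
    · right
      have := hL.symm (hL.ray_link hm u k)
      rw [← h1, ← h2] at this
      obtain rfl := hL.unique h this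
      exact ⟨k, by rw [h1, midSeq_eq_sub]; push_cast; ring⟩
  · right
    have h1' : v = u * ptSeq a (k + 1) := by rw [h1, ptSeq_succ]; push_cast; ring
    have := hL.ray_link hm u k
    rw [← h1', ← h2] at this
    obtain rfl := hL.unique h this
    exact ⟨k + 1, by rw [h1', midSeq]; push_cast; ring⟩

theorem isRayEdge_of_link (hL : LinkSystem a m L) (hm : 1 < m) {v : GaussianInt} {w w' : GaussianIntˣ} (h : L v w w')
    (hk : IsRayEdge a (2 * v + w)) : IsRayEdge a (2 * v + w') := by
  obtain ⟨u, k, hk⟩ := hk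
  rcases hL.ray_of_link hm h hk with ⟨rfl, -, -⟩ | ⟨l, hl⟩
  · exact ⟨w', 0, by simp [midSeq_zero]⟩
  · exact ⟨u, l, hl⟩

theorem isRayEdge_iff_of_joined (hL : LinkSystem a m L) (hm : 1 < m) {y z : GaussianInt} (h : Joined L y z) :
    IsRayEdge a y ↔ IsRayEdge a z := by
  induction h with
  | rel y z h =>
    obtain ⟨v, w, w', h1, rfl, rfl⟩ := h
    exact ⟨hL.isRayEdge_of_link hm h1, hL.isRayEdge_of_link hm (hL.symm h1)⟩
  | refl => rfl
  | symm _ _ _ ih => exact ih.symm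
  | trans _ _ _ _ _ ih1 ih2 => exact ih1.trans ih2

theorem ray_joined (hL : LinkSystem a m L) (hm : 1 < m) (u : GaussianIntˣ) (k : ℕ) : Joined L u (u * midSeq a k) := by
  induction k with
  | zero => simpa [midSeq_zero] using Joined.refl _
  | succ k ih =>
    refine ih.trans ?_
    have := joined_of_link (hL.ray_link hm u k)
    convert this using 1
    · rw [midSeq_eq_sub]; push_cast; ring
    · rw [midSeq]; push_cast; ring

end LinkSystem

end Folding

namespace Folding

open Filter

/-! ### The edges outside the four rays -/

/-- The edge belongs to one of the four tiles which touch the ends of the first tiles of the rays on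
the side `s`. -/
def OnSpoke (a : ℕ → ℤˣ) (N : ℕ) (s : ℤˣ) (y : GaussianInt) : Prop :=
  ∃ (u : GaussianIntˣ) (k : ℕ), k < N ∧
    (Motion.rot u * endRot s).act (ptSeq a N) (midSeq a k) = y

variable {a : ℕ → ℤˣ} {m N : ℕ} {L : GaussianInt → GaussianIntˣ → GaussianIntˣ → Prop}

theorem exists_side_eq (s : ℤˣ) (δ : GaussianIntˣ) :
    ∃ δ' : GaussianIntˣ, (1 + iPow s) * (δ' : GaussianInt) = (1 + iPow 1) * δ := by
  rcases Int.units_eq_one_or s with rfl | rfl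
  · exact ⟨δ, rfl⟩
  · refine ⟨iUnit 1 * δ, ?_⟩
    push_cast [val_iUnit]
    rw [← mul_assoc]
    congr 1

theorem SameTile.symm {y z : GaussianInt} (h : SameTile a N y z) : SameTile a N z y := by
  obtain ⟨g, k, l, hk, hl, h1, h2⟩ := h
  exact ⟨g, l, k, hl, hk, h2, h1⟩

theorem SameTile.trans (hI : IsTiling a N) {x y z : GaussianInt} (h : SameTile a N x y)
    (h' : SameTile a N y z) : SameTile a N x z := by
  obtain ⟨g, k, l, hk, hl, h1, h2⟩ := h
  obtain ⟨g', k', l', hk', hl', h1', h2'⟩ := h'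
  obtain ⟨rfl, rfl⟩ := hI.inj _ _ _ _ hl hk' (h2.trans h1'.symm)
  exact ⟨g, k, l', hk, hl', h1, h2'⟩

theorem OnSpoke.sameTile (hI : IsTiling a N) {s : ℤˣ} {y z : GaussianInt} (h : OnSpoke a N s y)
    (h' : SameTile a N y z) : OnSpoke a N s z := by
  obtain ⟨u, k, hk, h1⟩ := h
  obtain ⟨g, k', l, hk', hl, h2, h3⟩ := h'
  obtain ⟨rfl, rfl⟩ := hI.inj _ _ _ _ hk hk' (h1.trans h2.symm)
  exact ⟨u, l, hl, h3⟩

/-- Rotations do not preserve the tiles. -/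
theorem SameTile.eq_one (hI : IsTiling a N) {u : GaussianIntˣ} {y : GaussianInt}
    (h : SameTile a N y (u * y)) : u = 1 := by
  obtain ⟨g, k, l, hk, hl, h1, h2⟩ := h
  have h3 : (Motion.rot u * g).act (ptSeq a N) (midSeq a k) = u * y := by
    rw [Motion.act_mul, h1, Motion.act_rot]
  have h4 := congrArg Motion.u (hI.inj _ _ _ _ hk hl (h3.trans h2.symm)).1
  simpa [Motion.rot] using h4

theorem Motion.act_rot_mul (Q : GaussianInt) (u : GaussianIntˣ) (g : Motion) (y : GaussianInt) :
    (Motion.rot u * g).act Q y = u * g.act Q y := by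
  rw [Motion.act_mul, Motion.act_rot]

theorem isRayEdge_rot (Q : GaussianInt) {g : Motion} (hg : g.e = 0) (k : ℕ) :
    IsRayEdge a (g.act Q (midSeq a k)) :=
  ⟨g.u, k, by rw [Motion.act, hg]; ring⟩

theorem midSeq_last (hN : 0 < N) : midSeq a (N - 1) = 2 * ptSeq a N - dirSeq a (N - 1) := by
  rw [midSeq_eq_sub, Nat.sub_add_cancel hN]

theorem TurnRule.last (h : TurnRule a N) : a (N - 1) = a 0 := by
  have := h.sep 0
  simpa using this

theorem TurnRule.dirSeq_eq (h : TurnRule a N) :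
    dirSeq a N = iUnit (a 0) * dirSeq a (N - 1) := by
  conv_lhs => rw [← Nat.sub_add_cancel h.pos]
  rw [dirSeq_succ, h.last]

/-- With this turn at the first vertex, `endRot s` is the motion of the second block of the ray. -/
theorem TurnRule.isRayEdge_of_turn (h : TurnRule a N) {s : ℤˣ} (hs : a 0 = -s)
    (u : GaussianIntˣ) {k : ℕ} (hk : k < N) :
    IsRayEdge a ((Motion.rot u * endRot s).act (ptSeq a N) (midSeq a k)) := by
  have h1 : blockMotion a 1 = endRot s := by
    refine blockMotion_eq ?_
    simp only [midSeq, endRot, ptSeq_one, dirSeq_succ, dirSeq_zero, mul_one, val_iUnit, hs, iPow_neg]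
    ring
  rw [Motion.act_rot_mul, ← h1, ← h.midSeq_block 1 hk]
  exact ⟨u, _, rfl⟩

theorem OnSpoke.congr_unit {s : ℤˣ} {y : GaussianInt} (u : GaussianIntˣ) (h : OnSpoke a N s y) :
    OnSpoke a N s (u * y) := by
  obtain ⟨v, k, hk, rfl⟩ := h
  refine ⟨u * v, k, hk, ?_⟩
  rw [Motion.act_rot_mul, Motion.act_rot_mul]; push_cast; ring

namespace LinkSystem

/-- The two tiles which touch the end of the first tile of a ray, and do not belong to the ray, are
joined. -/
theorem spoke_joined (hL : LinkSystem a m L) (hm : 1 < m) {n : ℕ} (hT : TurnRule a (m ^ n)) {s : ℤˣ}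
    (hs : a 0 = s) (u : GaussianIntˣ) :
    Joined L ((Motion.rot u * endRot s).act (ptSeq a (m ^ n)) (midSeq a (m ^ n - 1)))
      ((Motion.rot u * endRot s * endRot s).act (ptSeq a (m ^ n)) (midSeq a (m ^ n - 1))) := by
  -- At the end of its first block the ray takes two of the four edges. The other two, which are the
  -- last edges of the two tiles, are therefore paired.
  have h1 := hL.complement (hL.ray_link hm u (m ^ n - 1))
  rw [Nat.sub_add_cancel hT.pos, neg_neg, hT.dirSeq_eq, hs] at h1
  have h2 := (joined_of_link h1).symm
  rw [midSeq_last hT.pos]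
  convert h2 using 1
  · simp only [Motion.act, Motion.mul_u, Motion.mul_e, Motion.rot, endRot]
    push_cast [val_iUnit]; ring
  · simp only [Motion.act, Motion.mul_u, Motion.mul_e, Motion.rot, endRot]
    push_cast [val_iUnit]
    linear_combination (u : GaussianInt) * (-2 * ptSeq a (m ^ n) - dirSeq a (m ^ n - 1) + 2 * ptSeq a (m ^ n)) * iPow_mul_self s

theorem eventually_sameTile_of_link (hL : LinkSystem a m L) (hT : TurnRule a m)
    (hP : 1 < (ptSeq a m).norm) (hI : ∀ n, IsTiling a (m ^ n)) {v : GaussianInt}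
    {w w' : GaussianIntˣ} (h : L v w w') (hr : ¬ IsRayEdge a (2 * v + w)) :
    ∀ᶠ n in atTop, SameTile a (m ^ n) (2 * v + w) (2 * v + w') := by
  filter_upwards [hT.eventually_mul_eq hP v] with n hn
  refine hL.sameTile_of_link (hI n) h ?_
  intro e he
  have := hn e he
  subst this
  rw [mul_zero] at he
  subst he
  exact hr ⟨w, 0, by simp [midSeq_zero]⟩

/-- A chain of paired edges passes through finitely many vertices, none of which is the origin if
the chain starts outside the rays. At high levels none of them is an end of a tile, so the chain
stays in one tile. -/
theorem eventually_sameTile (hL : LinkSystem a m L) (hm : 1 < m) (hT : TurnRule a m)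
    (hP : 1 < (ptSeq a m).norm) (hI : ∀ n, IsTiling a (m ^ n)) {y z : GaussianInt}
    (h : Joined L y z) : ¬ IsRayEdge a y → y = z ∨ ∀ᶠ n in atTop, SameTile a (m ^ n) y z := by
  induction h with
  | rel y z h =>
    obtain ⟨v, w, w', h1, rfl, rfl⟩ := h
    exact fun hr => Or.inr (hL.eventually_sameTile_of_link hT hP hI h1 hr)
  | refl => exact fun _ => Or.inl rfl
  | symm y z h ih =>
    intro hr
    rcases ih (by rwa [hL.isRayEdge_iff_of_joined hm h]) with h1 | h1
    · exact Or.inl h1.symm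
    · exact Or.inr (h1.mono fun n hn => hn.symm)
  | trans x y z h _ ih1 ih2 =>
    intro hr
    rcases ih1 hr with rfl | h1
    · exact ih2 hr
    · rcases ih2 (by rwa [← hL.isRayEdge_iff_of_joined hm h]) with rfl | h2
      · exact Or.inr h1
      · right
        filter_upwards [h1, h2] with n h3 h4 using h3.trans (hI n) h4

theorem spoke_of_joined (hL : LinkSystem a m L) (hm : 1 < m) (hT : TurnRule a m)
    (hP : 1 < (ptSeq a m).norm) (hI : ∀ n, IsTiling a (m ^ n)) {s : ℕ → ℤˣ} {y z : GaussianInt}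
    (h : Joined L y z) (hr : ¬ IsRayEdge a y) (hy : ∀ᶠ n in atTop, OnSpoke a (m ^ n) (s n) y) :
    ∀ᶠ n in atTop, OnSpoke a (m ^ n) (s n) z := by
  rcases hL.eventually_sameTile hm hT hP hI h hr with rfl | h1
  · exact hy
  · filter_upwards [hy, h1] with n h2 h3 using h2.sameTile (hI n) h3

/-- All the edges outside the rays belong to the four tiles `OnSpoke` of high level. -/
theorem exists_spoke (hL : LinkSystem a m L) (hm : 1 < m) (hT : TurnRule a m)
    (hP : 1 < (ptSeq a m).norm) (hI : ∀ n, IsTiling a (m ^ n)) :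
    ∃ s : ℕ → ℤˣ, ∀ y, ¬ IsEven y → IsRayEdge a y ∨ ∀ᶠ n in atTop, OnSpoke a (m ^ n) (s n) y := by
  choose s hs using fun n => (hI n).contact_later
  refine ⟨s, ?_⟩
  -- the contacts of a ray
  have contact : ∀ (r : ℕ) (δ : GaussianIntˣ), ¬ IsRayEdge a (midSeq a r + (1 + iPow 1) * δ) →
      ∀ᶠ n in atTop, ∃ k₀ < m ^ n, ∃ δ₀ δ₀' g₀, r < k₀ ∧ g₀.e ≠ 0 ∧
        Contact a (ptSeq a (m ^ n)) (s n) r δ₀ k₀ δ₀' g₀ ∧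
        g₀.act (ptSeq a (m ^ n)) (midSeq a k₀) = midSeq a r + (1 + iPow 1) * δ := by
    intro r δ hr
    filter_upwards [hT.eventually_act_ne hP r (midSeq a r + (1 + iPow 1) * δ)] with n hn
    obtain ⟨δ₀, hδ₀⟩ := exists_side_eq (s n) δ
    obtain ⟨k₀, hk₀, δ₀', g₀, hc⟩ := (hI n).exists_contact (s n) r δ₀
    have h1 := hc.mid
    rw [hδ₀] at h1
    have h2 : g₀.e ≠ 0 := fun h0 => hr (by rw [← h1]; exact isRayEdge_rot _ h0 _)
    refine ⟨k₀, hk₀, δ₀, δ₀', g₀, ?_, h2, hc, h1⟩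
    by_contra hcon
    exact h2 (hn k₀ (by omega) g₀ h1)
  -- If no contact leaves the first ray, then, by rotation, none leaves the four rays, which contain
  -- all the edges. Otherwise one contact which leaves the ray is fixed: it is present at all high
  -- levels, where it limits the contacts of the later segments.
  by_cases hall : ∀ (r : ℕ) (δ : GaussianIntˣ), IsRayEdge a (midSeq a r + (1 + iPow 1) * δ)
  · intro y hy
    left
    refine odd_induction (P := IsRayEdge a) ⟨1, 0, by simp [midSeq_zero]⟩ ?_ hy
    rintro _ ⟨u, k, rfl⟩ δ
    have := (hall k (u⁻¹ * δ)).unit_mul u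
    convert this using 1
    push_cast
    linear_combination -(1 + iPow 1) * (δ : GaussianInt) * u.mul_inv
  push Not at hall
  obtain ⟨r, δr, hr⟩ := hall
  intro y hy
  refine odd_induction (P := fun y => IsRayEdge a y ∨ ∀ᶠ n in atTop, OnSpoke a (m ^ n) (s n) y)
    (Or.inl ⟨1, 0, by simp [midSeq_zero]⟩) ?_ hy
  intro y hy δ
  by_cases hray' : IsRayEdge a (y + (1 + iPow 1) * δ)
  · exact Or.inl hray'
  right
  by_cases hray : IsRayEdge a y
  · obtain ⟨u, k, rfl⟩ := hray
    have e : u * midSeq a k + (1 + iPow 1) * δ =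
        u * (midSeq a k + (1 + iPow 1) * (u⁻¹ * δ : GaussianIntˣ)) := by
      push_cast
      linear_combination -(1 + iPow 1) * (δ : GaussianInt) * u.mul_inv
    rw [e] at hray' ⊢
    rw [isRayEdge_unit_mul_iff] at hray'
    filter_upwards [contact _ _ hray', hT.eventually_center_ne hP k] with n hn hn'
    obtain ⟨k₀, hk₀, δ₀, δ₀', g₀, h1, h2, h3, h4⟩ := hn
    rw [← h4]
    refine OnSpoke.congr_unit u ?_
    rcases (hs n k hn' hk₀ h1 h2 h3).1 with rfl | rfl
    · exact ⟨1, k₀, hk₀, by rw [Motion.act_rot_mul]; simp⟩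
    · exact ⟨_, k₀, hk₀, rfl⟩
  replace hy := hy.resolve_left hray
  by_cases hj : Joined L y (y + (1 + iPow 1) * δ)
  · exact hL.spoke_of_joined hm hT hP hI hj hray hy
  filter_upwards [contact _ _ hr, hT.eventually_center_ne hP r, hy, hT.eventually_act_ne hP r y,
    hT.eventually_act_ne hP r (y + (1 + iPow 1) * δ)] with n hn hn' hyn hn₁ hn₂
  obtain ⟨k₀, hk₀, δ₀, δ₀', g₀, h1, h2, h3, -⟩ := hn
  obtain ⟨-, key⟩ := hs n r hn' hk₀ h1 h2 h3
  obtain ⟨u, p, hp, hpy⟩ := hyn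
  have hrp : r < p := by
    by_contra hcon
    refine hray ?_
    rw [← hpy]
    exact isRayEdge_rot _ (hn₁ p (by omega) _ hpy) _
  obtain ⟨δ', hδ'⟩ := exists_side_eq (s n) ((u * iUnit (s n))⁻¹ * δ)
  obtain ⟨q, hq, δ'', g, hc⟩ := (hI n).exists_contact (s n) p δ'
  have hgy : (Motion.rot u * endRot (s n) * g).act (ptSeq a (m ^ n)) (midSeq a q) =
      y + (1 + iPow 1) * δ := by
    rw [Motion.act_mul, hc.mid, Motion.act_add, hpy, hδ']
    simp only [Motion.mul_u, Motion.rot, endRot]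
    rw [Units.val_mul _ δ]
    linear_combination (1 + iPow 1) * (δ : GaussianInt) * (u * iUnit (s n)).mul_inv
  have hrq : r < q := by
    by_contra hcon
    refine hray' ?_
    rw [← hgy]
    exact isRayEdge_rot _ (hn₂ q (by omega) _ hgy) _
  -- The neighbouring edge may lie in the same tile. It may lie in the other tile ending at the end
  -- of the first block of the ray: the two tiles are joined, unless the starting one belongs to a
  -- ray. In the last two cases its tile starts from the origin, hence it is a ray edge.
  rcases key hp hq hrp hrq hc with rfl | rfl | rfl | rfl
  · exact ⟨u, q, hq, by rw [← hgy, mul_one]⟩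
  · exfalso
    rcases Int.units_eq_one_or (a 0 * s n) with h0 | h0
    · have h0' : a 0 = s n := by
        rw [mul_eq_one_iff_eq_inv, Int.units_inv_eq_self] at h0; exact h0
      refine hj (Joined.trans (hL.tile_joined (n := n) ?_) (Joined.trans
        (hL.spoke_joined hm (hT.pow n) h0' u) (hL.tile_joined (n := n) ?_)))
      · exact ⟨_, p, m ^ n - 1, hp, by have := (hI n).pos; omega, hpy, rfl⟩
      · exact ⟨_, m ^ n - 1, q, by have := (hI n).pos; omega, hq, rfl, hgy⟩
    · have h0' : a 0 = -s n := by
        rw [← Int.units_ne_iff_eq_neg]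
        rintro h
        rw [h, Int.units_mul_self] at h0
        exact absurd h0 (by decide)
      refine hray ?_
      rw [← hpy]
      exact (hT.pow n).isRayEdge_of_turn h0' u hp
  · refine absurd ?_ hray'
    rw [← hgy]
    refine isRayEdge_rot _ ?_ _
    rw [mul_inv_cancel_right]; rfl
  · refine absurd ?_ hray'
    rw [← hgy]
    refine isRayEdge_rot _ ?_ _
    simp only [Motion.mul_e, Motion.mul_u, Motion.rot, endRot]
    push_cast [val_iUnit]
    linear_combination (u : GaussianInt) * (1 - iPow (s n)) * iPow_mul_self (s n)

theorem ray_inj (hm : 1 < m) (hI : ∀ n, IsTiling a (m ^ n)) {u u' : GaussianIntˣ} {k k' : ℕ}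
    (h : u * midSeq a k = u' * midSeq a k') : u = u' ∧ k = k' := by
  have hlt := Nat.lt_pow_self (n := k + k') hm
  obtain ⟨h1, h2⟩ := (hI (k + k')).inj (Motion.rot u) (Motion.rot u') k k' (by omega) (by omega)
    (by simpa [Motion.act_rot] using h)
  exact ⟨congrArg Motion.u h1, h2⟩

/-- The two rays which start with paired edges are joined to no other ray. -/
theorem half_of_joined (hL : LinkSystem a m L) (hm : 1 < m) {w₀ : GaussianIntˣ} (h₀ : L 0 1 w₀)
    {y z : GaussianInt} (h : Joined L y z) :
    (∃ u k, (u = 1 ∨ u = w₀) ∧ y = (u : GaussianIntˣ) * midSeq a k) ↔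
      ∃ u k, (u = 1 ∨ u = w₀) ∧ z = (u : GaussianIntˣ) * midSeq a k := by
  have step : ∀ {v : GaussianInt} {w w' : GaussianIntˣ}, L v w w' →
      (∃ u k, (u = 1 ∨ u = w₀) ∧ 2 * v + w = (u : GaussianIntˣ) * midSeq a k) →
      ∃ u k, (u = 1 ∨ u = w₀) ∧ 2 * v + w' = (u : GaussianIntˣ) * midSeq a k := by
    rintro v w w' hw ⟨u, k, hu, hk⟩
    rcases hL.ray_of_link hm hw hk with ⟨rfl, rfl, rfl⟩ | ⟨l, hl⟩
    · refine ⟨w', 0, ?_, by simp [midSeq_zero]⟩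
      rcases hu with rfl | rfl
      · exact Or.inr (hL.unique hw h₀)
      · exact Or.inl (hL.unique hw (hL.symm h₀))
    · exact ⟨u, l, hu, hl⟩
  induction h with
  | rel y z h =>
    obtain ⟨v, w, w', h1, rfl, rfl⟩ := h
    exact ⟨step h1, step (hL.symm h1)⟩
  | refl => rfl
  | symm _ _ _ ih => exact ih.symm
  | trans _ _ _ _ _ ih1 ih2 => exact ih1.trans ih2

/-- If the four rays do not contain all the edges, then there are six classes of joined edges: two
classes contain two rays each, and the other ones are exchanged by the rotations. -/
theorem exists_representatives (hL : LinkSystem a m L) (hm : 1 < m) (hT : TurnRule a m)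
    (hP : 1 < (ptSeq a m).norm) (hI : ∀ n, IsTiling a (m ^ n))
    (hne : ∃ y, ¬ IsEven y ∧ ¬ IsRayEdge a y) :
    ∃ f : ℤˣ ⊕ GaussianIntˣ → GaussianInt, (∀ i, ¬ IsEven (f i)) ∧
      (∀ i j, Joined L (f i) (f j) → i = j) ∧ ∀ y, ¬ IsEven y → ∃ i, Joined L y (f i) := by
  obtain ⟨A, hA, hAr⟩ := hne
  obtain ⟨s, hs⟩ := hL.exists_spoke hm hT hP hI
  obtain ⟨σ, h₀⟩ := hL.exists_turn 0 1
  rw [mul_one] at h₀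
  let ι : ℤˣ → GaussianIntˣ := fun e => if e = 1 then 1 else -1
  have hray : ∀ e, IsRayEdge a (ι e) := fun e => ⟨ι e, 0, by simp [midSeq_zero]⟩
  have h1 : ¬ Joined L 1 (-1) := by
    intro hj
    obtain ⟨u, k, hu, hk⟩ := (hL.half_of_joined hm h₀ hj).1 ⟨1, 0, Or.inl rfl, by simp [midSeq_zero]⟩
    obtain ⟨rfl, -⟩ := ray_inj hm hI (u := -1) (k := 0) (u' := u) (by rw [← hk]; simp [midSeq_zero])
    rcases hu with hu | hu
    · exact unit_ne_neg 1 hu.symm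
    · have := iUnit_mul_ne_neg σ 1
      rw [mul_one] at this
      exact this hu.symm
  -- The pairing at the origin is by right angles, so 1 and -1 represent the two pairs of rays. The
  -- rotated images of one edge A outside the rays represent the other classes.
  refine ⟨Sum.elim (fun e => ι e) (fun u => u * A), ?_, ?_, ?_⟩
  · rintro (e | u)
    · exact not_isEven_unit _
    · exact fun h => hA ((IsEven.unit_mul_iff u).1 h)
  · rintro (e | u) (e' | u') hj
    · rcases Int.units_eq_one_or e with rfl | rfl <;> rcases Int.units_eq_one_or e' with rfl | rfl
      · rfl
      · exact absurd (by simpa [ι] using hj) h1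
      · exact absurd (by simpa [ι] using hj.symm) h1
      · rfl
    · have := (hL.isRayEdge_iff_of_joined hm hj).1 (hray e)
      exact absurd ((isRayEdge_unit_mul_iff u').1 this) hAr
    · have := (hL.isRayEdge_iff_of_joined hm hj).2 (hray e')
      exact absurd ((isRayEdge_unit_mul_iff u).1 this) hAr
    · congr 1
      rcases hL.eventually_sameTile hm hT hP hI hj
        (fun h => hAr ((isRayEdge_unit_mul_iff u).1 h)) with h | h
      · have hA0 : A ≠ 0 := by rintro rfl; exact hA isEven_zero
        exact Units.ext (mul_right_cancel₀ hA0 h)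
      · obtain ⟨n, hn⟩ := h.exists
        have e : (u' : GaussianInt) * A = (u' * u⁻¹ : GaussianIntˣ) * (u * A) := by
          rw [← mul_assoc, ← Units.val_mul, inv_mul_cancel_right]
        simp only [Sum.elim_inr] at hn
        rw [e] at hn
        exact (mul_inv_eq_one.1 (hn.eq_one (hI n))).symm
  · intro y hy
    rcases hs y hy with ⟨u, k, rfl⟩ | hsy
    · have hj := (hL.ray_joined hm u k).symm
      have h2 : Joined L 1 (iUnit σ) := by simpa using joined_of_link h₀
      have h3 : Joined L (-1) (-iUnit σ) := by simpa using joined_of_link (hL.complement h₀)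
      rcases unit_cases_mul u 1 σ with rfl | rfl | rfl | rfl
      · exact ⟨Sum.inl 1, by simpa [ι] using hj⟩
      · exact ⟨Sum.inl (-1), by simpa [ι] using hj⟩
      · exact ⟨Sum.inl 1, by simpa [ι] using hj.trans (by simpa using h2.symm)⟩
      · exact ⟨Sum.inl (-1), by simpa [ι] using hj.trans (by simpa using h3.symm)⟩
    · obtain ⟨n, ⟨u, k, hk, rfl⟩, ⟨v, l, hl, hv⟩⟩ := (hsy.and ((hs A hA).resolve_left hAr)).exists
      refine ⟨Sum.inr (u * v⁻¹), hL.tile_joined (n := n) ⟨Motion.rot u * endRot (s n), k, l, hk, hl, rfl, ?_⟩⟩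
      rw [Motion.act_rot_mul] at hv ⊢
      rw [Sum.elim_inr, ← hv, ← mul_assoc, ← Units.val_mul, inv_mul_cancel_right]

end LinkSystem

end Folding

namespace Folding

/-! ### The turns of the ray -/

variable {a : ℕ → ℤˣ} {m N : ℕ}

theorem iUnit_injective : Function.Injective iUnit := by
  intro s t h
  have := congrArg (fun u : GaussianIntˣ => (u : GaussianInt).im) h
  exact Units.ext (by simpa [val_iUnit, iPow] using this)

/-- If j is not a multiple of N, the separators of the initial run are compared with terms at a
constant place inside alternating blocks. Then `a p` depends only on the parity of p for p ≤ m. This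
is impossible since `a m`, which starts a reversed block, is the opposite of `a (m - 2)`, which ends
the initial block. -/
theorem TurnRule.dvd_of_run (hm : TurnRule a m) (h1 : 1 < m) (hN : TurnRule a N) {j : ℕ}
    (h : ∀ k < (m + 1) * N, a (j + k) = a k) : N ∣ j := by
  by_contra hd
  have hpos := hN.pos
  obtain ⟨q, r, hr, hrN, rfl⟩ : ∃ q r, 0 < r ∧ r < N ∧ j = q * N + r :=
    ⟨j / N, j % N, Nat.pos_of_ne_zero fun h0 => hd (Nat.dvd_of_mod_eq_zero h0), Nat.mod_lt _ hpos,
      by rw [mul_comm]; exact (Nat.div_add_mod j N).symm⟩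
  have key : ∀ p < m + 1, a p = if Even (q + p + 1) then a (r - 1) else -a (N - 2 - (r - 1)) := by
    intro p hp
    have hlt : p * N + (N - 1) < (m + 1) * N := by
      have : (p + 1) * N ≤ (m + 1) * N := Nat.mul_le_mul_right _ hp
      rw [add_mul, one_mul] at this
      omega
    have e : q * N + r + (p * N + (N - 1)) = (q + p + 1) * N + (r - 1) := by
      rw [add_mul, add_mul, one_mul]; omega
    rw [← hN.sep p, ← h _ hlt, e]
    split_ifs with hev
    · exact hN.even _ _ hev (by omega)
    · exact hN.odd _ _ hev (by omega)
  have h2 := key (m - 2) (by omega)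
  have h3 := key m (by omega)
  have e : Even (q + (m - 2) + 1) ↔ Even (q + m + 1) := by
    rw [show q + m + 1 = q + (m - 2) + 1 + 2 by omega]; simp [Nat.even_add]
  simp only [e] at h2
  have h4 := hm.odd 1 0 (by decide) (by omega)
  rw [one_mul, add_zero, Nat.sub_zero, h3, h2] at h4
  exact units_ne_neg_self _ h4

/-- If q were odd, N would be even and the blocks would have a middle term, which reversal replaces
by its opposite. -/
theorem TurnRule.even_of_run (hN : TurnRule a N) {q : ℕ} (hq : Even (q * N))
    (h : ∀ k < N, a (q * N + k) = a k) : Even q := by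
  by_contra hodd
  rw [Nat.even_mul] at hq
  obtain ⟨t, ht⟩ := hq.resolve_left hodd
  have hpos := hN.pos
  have h1 := h (t - 1) (by omega)
  rw [hN.odd q (t - 1) hodd (by omega), show N - 2 - (t - 1) = t - 1 by omega] at h1
  exact units_ne_neg_self _ h1.symm

theorem dirSeq_im (k : ℕ) : ((dirSeq a k : GaussianInt).im = 0 ↔ Even k) ∧
    ((dirSeq a k : GaussianInt).re = 0 ↔ ¬ Even k) := by
  induction k with
  | zero => simp [dirSeq_zero]
  | succ k ih =>
    rw [dirSeq_succ, Nat.even_add_one, not_not]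
    rcases Int.units_eq_one_or (a k) with h | h <;> simp [h, val_iUnit, iPow, ih.1, ih.2]

theorem even_of_dirSeq_eq_one {k : ℕ} (h : dirSeq a k = 1) : Even k := by
  rw [← (dirSeq_im k).1, h]; rfl

theorem TurnRule.eq_blockIndex (h : TurnRule a N) (hI : IsTiling a N) {g : Motion} {k p : ℕ}
    (hk : k < N) (he : g.act (ptSeq a N) (midSeq a k) = midSeq a p) :
    ∃ q, g = blockMotion a q ∧ p = q * N + blockIndex N q k := by
  have hp : p = p / N * N + p % N := by rw [mul_comm]; exact (Nat.div_add_mod p N).symm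
  have hlt : p % N < N := Nat.mod_lt _ hI.pos
  have h1 := h.midSeq_block (p / N) (blockIndex_lt (q := p / N) hlt)
  rw [blockIndex_blockIndex hlt, ← hp] at h1
  obtain ⟨h2, h3⟩ := hI.inj _ _ _ _ hk (blockIndex_lt hlt) (he.trans h1)
  exact ⟨p / N, h2, by rw [h3, blockIndex_blockIndex hlt]; exact hp⟩

/-- A tile with an edge on the ray is a block of the ray, travelled in one direction or the other.
-/
theorem TurnRule.index_succ (h : TurnRule a N) (hI : IsTiling a N)
    (hi : Function.Injective (midSeq a)) {g : Motion} {k p p' : ℕ} (hk : k + 1 < N)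
    (he : g.act (ptSeq a N) (midSeq a k) = midSeq a p)
    (he' : g.act (ptSeq a N) (midSeq a (k + 1)) = midSeq a p') : p' = p + 1 ∨ p = p' + 1 := by
  obtain ⟨q, rfl, rfl⟩ := h.eq_blockIndex hI (by omega) he
  have := hi ((h.midSeq_block q hk).trans he')
  rw [← this]
  unfold blockIndex
  split_ifs <;> omega

/-! ### Rays and segments -/

theorem IsRayOf.eq {c : ℕ → Segment} (h : IsRayOf a c) (k : ℕ) :
    (c k).start = (c 0).start + (c 0).dir * ptSeq a k ∧ (c k).dir = (c 0).dir * dirSeq a k := by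
  induction k with
  | zero => simp [ptSeq_zero, dirSeq_zero]
  | succ k ih =>
    obtain ⟨h1, h2⟩ := h k
    rw [h1, h2, Segment.endPt, ih.1, ih.2, ptSeq_succ, dirSeq_succ]
    push_cast [val_iUnit]
    exact ⟨by ring, by ring⟩

theorem IsRayOf.mid_eq {c : ℕ → Segment} (h : IsRayOf a c) (k : ℕ) :
    (c k).mid = 2 * (c 0).start + (c 0).dir * midSeq a k := by
  rw [Segment.mid, (h.eq k).1, (h.eq k).2, midSeq]; ring

theorem Segment.mid_translate (u : GaussianInt) (A : Segment) :
    (A.translate u).mid = A.mid + 2 * u := by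
  simp only [Segment.mid, Segment.translate]; ring

theorem Segment.mid_eq_endPt (A : Segment) : A.mid = 2 * A.endPt - A.dir := by
  simp only [Segment.mid, Segment.endPt]; ring

theorem fillsSquares_infPow {S : FoldingString} (h2 : IsPlaneFilling S) : FillsSquares (infPow S) := by
  intro r hr
  obtain ⟨x, hx⟩ := h2 _ (isRayOf_stdRay _) r hr
  exact ⟨x, fun A hA hA' => hx.exists_mid hA hA'⟩

theorem midSeq_injective {S : FoldingString} (h1 : IsSelfAvoidingString S) :
    Function.Injective (midSeq (infPow S)) := by
  intro k l h
  exact h1 _ (isRayOf_stdRay _) ((Segment.support_eq_iff _ _).2 h)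

/-! ### Coverings -/

section covering

variable {𝒞 : Set (ℤ → Segment)} {x₀ : GaussianInt} {d₀ : GaussianIntˣ}

theorem CoversPlane.unique (h : CoversPlane 𝒞) {c c' : ℤ → Segment} (hc : c ∈ 𝒞) (hc' : c' ∈ 𝒞)
    {k k' : ℤ} (he : (c k).mid = (c' k').mid) : c = c' ∧ k = k' := by
  obtain ⟨p, -, hp⟩ := h _ (c k).support_mem_unitIntervals
  have h1 := hp (c, k) ⟨hc, rfl⟩
  have h2 := hp (c', k') ⟨hc', (Segment.support_eq_iff _ _).2 he.symm⟩
  exact Prod.ext_iff.1 (h1.trans h2.symm)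

theorem CoversPlane.exists_mid (h : CoversPlane 𝒞) {y : GaussianInt} (hy : ¬ IsEven y) :
    ∃ c ∈ 𝒞, ∃ k, (c k).mid = y := by
  obtain ⟨A, rfl⟩ := exists_segment_mid hy
  obtain ⟨p, ⟨hp, hp'⟩, -⟩ := h _ A.support_mem_unitIntervals
  exact ⟨p.1, hp, p.2, (Segment.support_eq_iff _ _).1 hp'⟩

/-- The position of the edge `y` in the coordinates with origin `x₀` and first direction `d₀`. -/
def place (x₀ : GaussianInt) (d₀ : GaussianIntˣ) (y : GaussianInt) : GaussianInt := 2 * x₀ + d₀ * y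

theorem place_injective : Function.Injective (place x₀ d₀) := by
  intro y z h
  exact d₀.isUnit.mul_left_cancel (add_left_cancel h)

theorem exists_place_eq (y : GaussianInt) : ∃ z, place x₀ d₀ z = y :=
  ⟨(d₀⁻¹ : GaussianIntˣ) * (y - 2 * x₀), by simp [place]⟩

theorem isEven_place_iff {y : GaussianInt} : IsEven (place x₀ d₀ y) ↔ IsEven y := by
  rw [place, add_comm, isEven_add_iff (isEven_two_mul _), IsEven.unit_mul_iff]

/-- A curve of `𝒞` arrives at `v` on the edge `2v + w` and leaves on the edge `2v + w'`. -/
def Passage (𝒞 : Set (ℤ → Segment)) (x₀ : GaussianInt) (d₀ : GaussianIntˣ) (v : GaussianInt)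
    (w w' : GaussianIntˣ) : Prop :=
  ∃ A B, Consecutive 𝒞 A B ∧ A.endPt = x₀ + d₀ * v ∧ A.dir = -(d₀ * w) ∧ B.start = x₀ + d₀ * v ∧
    B.dir = d₀ * w'

/-- The pairing of the edges by the curves of `𝒞`. -/
def Linked (𝒞 : Set (ℤ → Segment)) (x₀ : GaussianInt) (d₀ : GaussianIntˣ) (v : GaussianInt)
    (w w' : GaussianIntˣ) : Prop :=
  Passage 𝒞 x₀ d₀ v w w' ∨ Passage 𝒞 x₀ d₀ v w' w

theorem Passage.exists_curve {v : GaussianInt} {w w' : GaussianIntˣ} (h : Passage 𝒞 x₀ d₀ v w w') :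
    ∃ c ∈ 𝒞, ∃ k, (c k).dir = -(d₀ * w) ∧ (c (k + 1)).dir = d₀ * w' ∧
      (c k).mid = place x₀ d₀ (2 * v + w) ∧ (c (k + 1)).mid = place x₀ d₀ (2 * v + w') := by
  obtain ⟨A, B, ⟨c, hc, k, rfl, rfl⟩, h1, h2, h3, h4⟩ := h
  refine ⟨c, hc, k, h2, h4, ?_, ?_⟩
  · rw [Segment.mid_eq_endPt, h1, h2, place]; ring
  · rw [Segment.mid, h3, h4, place]; ring

theorem passage_of_follows {c : ℤ → Segment} (hc : c ∈ 𝒞) {k : ℤ}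
    (hf : (c (k + 1)).start = (c k).endPt) {v : GaussianInt} {w w' : GaussianIntˣ} (hne : w ≠ w')
    (h1 : (c k).mid = place x₀ d₀ (2 * v + w)) (h2 : (c (k + 1)).mid = place x₀ d₀ (2 * v + w')) :
    Passage 𝒞 x₀ d₀ v w w' := by
  obtain ⟨α, hα⟩ := (c k).isUnit_dir
  obtain ⟨β, hβ⟩ := (c (k + 1)).isUnit_dir
  have e1 : 2 * (c k).start + (α : GaussianInt) = 2 * (x₀ + d₀ * v) + (d₀ * w : GaussianIntˣ) := by
    rw [hα, ← Segment.mid, h1, place]; push_cast; ring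
  have e2 : 2 * (c (k + 1)).start + (β : GaussianInt) =
      2 * (x₀ + d₀ * v) + (d₀ * w' : GaussianIntˣ) := by
    rw [hβ, ← Segment.mid, h2, place]; push_cast; ring
  rw [Segment.endPt, ← hα] at hf
  rcases mid_eq_cases e1 with ⟨p1, p2⟩ | ⟨p1, p2⟩ <;> rcases mid_eq_cases e2 with ⟨q1, q2⟩ | ⟨q1, q2⟩
  · exfalso
    rw [← q1, p1] at hf
    exact α.ne_zero (by linear_combination -hf)
  · exfalso
    rw [hf, p1] at q1
    have : (α : GaussianInt) = (-β : GaussianIntˣ) := by push_cast; linear_combination -q1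
    rw [← q2, ← p2] at this
    exact hne (mul_left_cancel (Units.ext this))
  · refine ⟨_, _, ⟨c, hc, k, rfl, rfl⟩, ?_, ?_, q1.symm, ?_⟩
    · rw [Segment.endPt, ← hα, p1]
    · rw [← hα, ← Units.val_mul, p2]; simp
    · rw [← hβ, ← q2]; push_cast; ring
  · exfalso
    rw [p1, hf] at q1
    exact β.ne_zero (by linear_combination -q1)

theorem exists_linked (h : CoversPlane 𝒞) (hf : ∀ c ∈ 𝒞, ∀ k, ∃ b, Follows b (c k) (c (k + 1)))
    (v : GaussianInt) (w : GaussianIntˣ) : ∃ σ, Linked 𝒞 x₀ d₀ v w (iUnit σ * w) := by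
  obtain ⟨c, hc, k, hk⟩ := h.exists_mid (y := place x₀ d₀ (2 * v + w)) (by
    rw [isEven_place_iff, isEven_add_unit_iff]; exact not_not.2 (isEven_two_mul v))
  obtain ⟨α, hα⟩ := (c k).isUnit_dir
  have e1 : 2 * (c k).start + (α : GaussianInt) = 2 * (x₀ + d₀ * v) + (d₀ * w : GaussianIntˣ) := by
    rw [hα, ← Segment.mid, hk, place]; push_cast; ring
  rcases mid_eq_cases e1 with ⟨p1, p2⟩ | ⟨p1, p2⟩
  · obtain ⟨b, h1, h2⟩ := hf c hc (k - 1)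
    rw [sub_add_cancel] at h1 h2
    refine ⟨b, Or.inr ⟨_, _, ⟨c, hc, k - 1, rfl, rfl⟩, by rw [← h1, p1], ?_, ?_, ?_⟩⟩
    · rw [← hα, ← p2] at h2
      push_cast [val_iUnit] at h2 ⊢
      linear_combination iPow b * h2 + (c (k - 1)).dir * iPow_mul_self b
    · rw [sub_add_cancel, p1]
    · rw [sub_add_cancel, ← hα, ← p2]; push_cast; ring
  · obtain ⟨b, h1, h2⟩ := hf c hc k
    refine ⟨-b, Or.inl ⟨_, _, ⟨c, hc, k, rfl, rfl⟩, ?_, ?_, ?_, ?_⟩⟩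
    · rw [Segment.endPt, ← hα, p1]
    · rw [← hα, ← Units.val_mul, p2]; simp
    · rw [h1, Segment.endPt, ← hα, p1]
    · have : (c k).dir = -(d₀ * w) := by rw [← hα, ← Units.val_mul, p2]; simp
      rw [h2, this]; push_cast [val_iUnit, iPow_neg]; ring

theorem Linked.unique (h : CoversPlane 𝒞) {v : GaussianInt} {w w₁ w₂ : GaussianIntˣ}
    (h₁ : Linked 𝒞 x₀ d₀ v w w₁) (h₂ : Linked 𝒞 x₀ d₀ v w w₂) : w₁ = w₂ := by
  have opposite : ∀ {w₁ w₂}, Passage 𝒞 x₀ d₀ v w w₁ → Passage 𝒞 x₀ d₀ v w₂ w → False := by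
    intro w₁ w₂ h₁ h₂
    obtain ⟨c, hc, k, p1, p2, p3, p4⟩ := h₁.exists_curve
    obtain ⟨c', hc', k', q1, q2, q3, q4⟩ := h₂.exists_curve
    obtain ⟨rfl, rfl⟩ := h.unique hc hc' (p3.trans q4.symm)
    rw [q2] at p1
    exact unit_ne_neg (d₀ * w) (Units.ext (by push_cast; exact p1))
  rcases h₁ with h₁ | h₁ <;> rcases h₂ with h₂ | h₂
  · obtain ⟨c, hc, k, p1, p2, p3, p4⟩ := h₁.exists_curve
    obtain ⟨c', hc', k', q1, q2, q3, q4⟩ := h₂.exists_curve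
    obtain ⟨rfl, rfl⟩ := h.unique hc hc' (p3.trans q3.symm)
    exact Units.ext (d₀.isUnit.mul_left_cancel (p2.symm.trans q2))
  · exact (opposite h₁ h₂).elim
  · exact (opposite h₂ h₁).elim
  · obtain ⟨c, hc, k, p1, p2, p3, p4⟩ := h₁.exists_curve
    obtain ⟨c', hc', k', q1, q2, q3, q4⟩ := h₂.exists_curve
    obtain ⟨rfl, hkk⟩ := h.unique hc hc' (p4.trans q4.symm)
    obtain rfl : k = k' := by omega
    exact Units.ext (d₀.isUnit.mul_left_cancel (neg_injective (p1.symm.trans q1)))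

end covering

end Folding

namespace Folding

/-! ### Tiles in a covering with the local isomorphism property -/

variable {S : FoldingString} {𝒞 : Set (ℤ → Segment)}

/-- By the local isomorphism property, two segments of curves of `𝒞` and an initial part of the ray
`C z, C (z + 1), …` can be translated together into this ray. -/
theorem exists_run (h2 : IsPlaneFilling S) (h : CoversPlane 𝒞) (hloc : LocalIsomorphismProperty 𝒞)
    {C : ℤ → Segment} (hC : C ∈ 𝒞) {z : ℤ} (hR : IsRayOf (infPow S) fun k : ℕ => C (z + k))
    {A B : Segment} (hA : IsSegmentOf 𝒞 A) (hB : IsSegmentOf 𝒞 B) (K : ℕ) :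
    ∃ (u : GaussianInt) (j p q : ℕ), (∀ k ≤ K, (C (z + k)).translate u = C (z + (j + k : ℕ))) ∧
      A.translate u = C (z + p) ∧ B.translate u = C (z + q) ∧
      (q = p + 1 → Consecutive 𝒞 A B) ∧ (p = q + 1 → Consecutive 𝒞 B A) := by
  let F : Set Segment := {A, B} ∪ (fun k : ℕ => C (z + k)) '' Set.Iic K
  have hF : F.Finite := ((Set.finite_singleton B).insert A).union ((Set.finite_Iic K).image _)
  have hAF : A ∈ F := Or.inl (Or.inl rfl)
  have hBF : B ∈ F := Or.inl (Or.inr rfl)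
  have hCF : ∀ k : ℕ, k ≤ K → C (z + k) ∈ F := fun k hk => Or.inr ⟨k, hk, rfl⟩
  obtain ⟨r, hr⟩ := hloc F hF (by
    rintro D ((rfl | rfl) | ⟨k, -, rfl⟩)
    · exact hA
    · exact hB
    · exact ⟨C, hC, _, rfl⟩)
  obtain ⟨x, hx⟩ := h2 _ hR (r + 1) r.succ_pos
  obtain ⟨u, hu1, hu2⟩ := hr x
  have hsq : ∀ y, y ∈ square x r → y ∈ square x (r + 1) := by
    rintro y ⟨p1, p2, p3, p4⟩
    refine ⟨p1, ?_, p3, ?_⟩ <;> push_cast <;> omega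
  have inRay : ∀ D ∈ F, ∃ k : ℕ, D.translate u = C (z + k) := by
    intro D hD
    obtain ⟨⟨c, hc, l, hl⟩, hs, he⟩ := hu1 D hD
    obtain ⟨k, hk⟩ := hx.exists_mid (hsq _ hs) (hsq _ he)
    rw [← hl] at hk
    obtain ⟨rfl, rfl⟩ := h.unique hC hc hk
    exact ⟨k, hl.symm⟩
  -- A segment has only one curve and one index, so the translated initial part stays in order along
  -- the ray.
  have next : ∀ {k l : ℤ}, Consecutive 𝒞 (C k) (C l) → l = k + 1 := by
    rintro k l ⟨c, hc, i, h3, h4⟩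
    obtain ⟨rfl, rfl⟩ := h.unique hc hC (congrArg Segment.mid h3)
    exact (h.unique hc hc (congrArg Segment.mid h4)).2.symm
  obtain ⟨p, hp⟩ := inRay A hAF
  obtain ⟨q, hq⟩ := inRay B hBF
  obtain ⟨j, hj⟩ := inRay _ (hCF 0 (Nat.zero_le _))
  refine ⟨u, j, p, q, ?_, hp, hq, ?_, ?_⟩
  · intro k
    induction k with
    | zero => intro _; exact hj
    | succ k ih =>
      intro hk
      obtain ⟨l, hl⟩ := inRay _ (hCF (k + 1) hk)
      have hcons : Consecutive 𝒞 (C (z + k)) (C (z + (k + 1 : ℕ))) :=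
        ⟨C, hC, z + k, rfl, by push_cast; rw [add_assoc]⟩
      rw [← hu2 _ (hCF k (by omega)) _ (hCF (k + 1) hk), hl, ih (by omega)] at hcons
      rw [hl]
      congr 1
      have := next hcons
      push_cast at this ⊢
      omega
  · rintro rfl
    rw [← hu2 A hAF B hBF, hp, hq]
    exact ⟨C, hC, z + p, rfl, by push_cast; rw [add_assoc]⟩
  · rintro rfl
    rw [← hu2 B hBF A hAF, hp, hq]
    exact ⟨C, hC, z + q, rfl, by push_cast; rw [add_assoc]⟩

theorem IsFoldingCovering.follows (h : IsFoldingCovering S 𝒞) :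
    ∀ c ∈ 𝒞, ∀ k, ∃ b, Follows b (c k) (c (k + 1)) := by
  intro c hc k
  obtain ⟨b, -, hb⟩ := h.1 c hc
  exact ⟨b k, hb k⟩

/-- Two consecutive edges of a tile are translated into the ray together with an initial part of the
ray. The repetition of this initial part shows that the translation respects the subdivision into
blocks. So the tile becomes a block of the ray, where the two edges are consecutive, and local
isomorphism carries this back. -/
theorem linkSystem_of_covering (hS : S ≠ []) (h1 : IsSelfAvoidingString S) (h2 : IsPlaneFilling S)
    (h : IsFoldingCovering S 𝒞) (hloc : LocalIsomorphismProperty 𝒞)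
    {C : ℤ → Segment} (hC : C ∈ 𝒞) {z : ℤ} (hR : IsRayOf (infPow S) fun k : ℕ => C (z + k))
    {d₀ : GaussianIntˣ} (hd₀ : (C z).dir = d₀) :
    LinkSystem (infPow S) (S.length + 1) (Linked 𝒞 (C z).start d₀) := by
  set x₀ := (C z).start with hx₀
  refine ⟨fun hl => hl.symm, exists_linked h.2 h.follows, fun hl hl' => hl.unique h.2 hl', ?_⟩
  intro n g k hk
  set a := infPow S
  set m := S.length + 1
  set N := m ^ n
  have hm : 1 < m := Nat.succ_lt_succ (List.length_pos_iff.2 hS)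
  have hT : TurnRule a m := turnRule_infPow hS
  have hTN : TurnRule a N := hT.pow n
  have hi := midSeq_injective h1
  have hI : IsTiling a N := hTN.isTiling (fillsSquares_infPow h2) hi
  set v := g.u * ptSeq a (k + 1) + ptSeq a N * g.e with hv
  have e1 : 2 * v + (-(g.u * dirSeq a k) : GaussianIntˣ) = g.act (ptSeq a N) (midSeq a k) := by
    rw [Motion.act, midSeq_eq_sub]; push_cast; ring
  have e2 : 2 * v + (g.u * dirSeq a (k + 1) : GaussianIntˣ) =
      g.act (ptSeq a N) (midSeq a (k + 1)) := by
    rw [Motion.act, midSeq]; push_cast; ring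
  have hodd : ∀ l, ¬ IsEven (place x₀ d₀ (g.act (ptSeq a N) (midSeq a l))) := fun l => by
    rw [isEven_place_iff, Motion.isEven_act_iff]; exact not_isEven_midSeq l
  obtain ⟨c, hc, i, hci⟩ := h.2.exists_mid (hodd k)
  obtain ⟨c', hc', i', hci'⟩ := h.2.exists_mid (hodd (k + 1))
  -- The length (m + 1)N of the repeated part is what `TurnRule.dvd_of_run` needs. Translations also
  -- preserve directions, which makes j even.
  obtain ⟨u, j, p, q, hrun, hp, hq, hpq, hqp⟩ := exists_run h2 h.2 hloc hC hR ⟨c, hc, i, rfl⟩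
    ⟨c', hc', i', rfl⟩ ((m + 1) * N)
  have hz : z + ((0 : ℕ) : ℤ) = z := by simp
  have hstart : ∀ k : ℕ, (C (z + k)).start = x₀ + d₀ * ptSeq a k := fun k => by
    have := (hR.eq k).1; simp only [hz] at this; rw [this, hd₀]
  have hdir : ∀ k : ℕ, (C (z + k)).dir = d₀ * dirSeq a k := fun k => by
    have := (hR.eq k).2; simp only [hz] at this; rw [this, hd₀]
  have hmid : ∀ k : ℕ, (C (z + k)).mid = place x₀ d₀ (midSeq a k) := fun k => by
    have := hR.mid_eq k; simp only [hz] at this; rw [this, hd₀]; rfl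
  have hD : ∀ k ≤ (m + 1) * N, dirSeq a (j + k) = dirSeq a k := by
    intro k hk
    have := congrArg Segment.dir (hrun k hk)
    rw [hdir, Segment.translate, hdir] at this
    exact (Units.ext (d₀.isUnit.mul_left_cancel this)).symm
  have hturn : ∀ k < (m + 1) * N, a (j + k) = a k := by
    intro k hk
    have h3 := hD (k + 1) hk
    rw [← add_assoc, dirSeq_succ, dirSeq_succ, hD k hk.le] at h3
    exact iUnit_injective (mul_right_cancel h3)
  obtain ⟨t, ht⟩ := hT.dvd_of_run hm hTN hturn
  rw [mul_comm] at ht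
  have hjeven : Even j := even_of_dirSeq_eq_one (by
    have := hD 0 (Nat.zero_le _); rwa [add_zero, dirSeq_zero] at this)
  have hteven : Even t := by
    refine hTN.even_of_run (by rwa [← ht]) fun k hk => ?_
    rw [← ht]
    exact hturn k (hk.trans_le (Nat.le_mul_of_pos_left _ (by omega)))
  have hu : u = d₀ * (ptSeq a N * ptSeq a t) := by
    have := congrArg Segment.start (hrun 0 (Nat.zero_le _))
    rw [Segment.translate, hstart, hstart, add_zero, ptSeq_zero, ht, hTN.ptSeq_mul] at this
    linear_combination this
  -- The tile translated by u, seen from the origin of the ray; it is the image by a motion because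
  -- t is even.
  let g' : Motion := ⟨g.u, g.e + ptSeq a t, g.isEven_e.add ((isEven_ptSeq t).2 hteven)⟩
  have shift : ∀ (D : Segment) (l i : ℕ), D.mid = place x₀ d₀ (g.act (ptSeq a N) (midSeq a l)) →
      D.translate u = C (z + i) → g'.act (ptSeq a N) (midSeq a l) = midSeq a i := by
    intro D l i h3 h4
    have h5 := congrArg Segment.mid h4
    rw [Segment.mid_translate, h3, hmid] at h5
    refine place_injective (x₀ := x₀) (d₀ := d₀) ?_
    rw [← h5, hu]
    simp only [place, Motion.act, g']
    ring
  have hne : -(g.u * dirSeq a k) ≠ g.u * dirSeq a (k + 1) := by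
    rw [dirSeq_succ, mul_left_comm]
    exact (iUnit_mul_ne_neg _ _).symm
  rw [← e1] at hci
  rw [← e2] at hci'
  have toPassage : ∀ {A B : Segment} {w w' : GaussianIntˣ}, Consecutive 𝒞 A B → w ≠ w' →
      A.mid = place x₀ d₀ (2 * v + w) → B.mid = place x₀ d₀ (2 * v + w') →
      Passage 𝒞 x₀ d₀ v w w' := by
    rintro A B w w' ⟨c, hc, i, rfl, rfl⟩ hww h3 h4
    obtain ⟨b, hb, -⟩ := h.follows c hc i
    exact passage_of_follows hc hb hww h3 h4
  rcases hTN.index_succ hI hi hk (shift _ _ _ (by rw [hci, e1]) hp) (shift _ _ _ (by rw [hci', e2]) hq)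
    with h3 | h3
  · exact Or.inl (toPassage (hpq h3) hne hci hci')
  · exact Or.inr (toPassage (hqp h3) hne.symm hci' hci)

/-! ### Perfect strings -/

theorem exists_pow_eq (u : GaussianIntˣ) : ∃ j : Fin 4, iPow 1 ^ (j : ℕ) = (u : GaussianInt) := by
  rcases unit_cases u with rfl | rfl | rfl | rfl
  · exact ⟨0, rfl⟩
  · exact ⟨2, by decide⟩
  · exact ⟨1, by decide⟩
  · exact ⟨3, by decide⟩

/-- The four rays never overlap, by `LinkSystem.ray_inj`, so if they contained all the edges they
would cover the plane in the sense of `IsPerfect`. -/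
theorem exists_not_isRayEdge (hS : S ≠ []) (h1 : IsSelfAvoidingString S) (h2 : IsPlaneFilling S)
    (h3 : ¬ IsPerfect S) : ∃ y, ¬ IsEven y ∧ ¬ IsRayEdge (infPow S) y := by
  by_contra hcon
  push Not at hcon
  refine h3 fun c hc e he => ?_
  have hm : 1 < S.length + 1 := Nat.succ_lt_succ (List.length_pos_iff.2 hS)
  have hI : ∀ n, IsTiling (infPow S) ((S.length + 1) ^ n) := fun n =>
    ((turnRule_infPow hS).pow n).isTiling (fillsSquares_infPow h2) (midSeq_injective h1)
  obtain ⟨d, hd⟩ := (c 0).isUnit_dir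
  have hmid : ∀ (j k : ℕ), ((c k).rotate (c 0).start j).mid =
      place (c 0).start d (iPow 1 ^ j * midSeq (infPow S) k) := by
    intro j k
    simp only [Segment.mid, Segment.rotate]
    rw [(hc.eq k).1, (hc.eq k).2, place, midSeq, hd]
    ring
  have hpow : ∀ j : ℕ, iPow 1 ^ j = ((iUnit 1 ^ j : GaussianIntˣ) : GaussianInt) := fun j => by
    rw [Units.val_pow_eq_pow_val, val_iUnit]
  obtain ⟨A, rfl⟩ := exists_support_eq he
  obtain ⟨y, hy⟩ := exists_place_eq (x₀ := (c 0).start) (d₀ := d) A.mid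
  obtain ⟨u, k, rfl⟩ := hcon y (by
    rw [← isEven_place_iff (x₀ := (c 0).start) (d₀ := d), hy]; exact A.not_isEven_mid)
  obtain ⟨j, hj⟩ := exists_pow_eq u
  refine ⟨(fun k => (c k).rotate (c 0).start j, k), ⟨⟨j, rfl⟩, ?_⟩, ?_⟩
  · rw [Segment.support_eq_iff, hmid, hj, hy]
  · rintro ⟨c', k'⟩ ⟨⟨j', rfl⟩, h4⟩
    rw [Segment.support_eq_iff, hmid, ← hy] at h4
    have h5 := place_injective h4
    rw [hpow] at h5
    obtain ⟨h6, rfl⟩ := LinkSystem.ray_inj hm hI h5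
    have h7 : iPow 1 ^ (j' : ℕ) = iPow 1 ^ (j : ℕ) := by rw [hpow, h6, hj]
    refine Prod.ext (funext fun k => Segment.ext ?_ ?_) rfl
    · simp only [Segment.rotate, h7]
    · simp only [Segment.rotate, h7]

/-! ### The curves of a covering -/

section curves

variable {x₀ : GaussianInt} {d₀ : GaussianIntˣ}

theorem Linked.mem_curve (h : CoversPlane 𝒞) {v : GaussianInt} {w w' : GaussianIntˣ}
    (hl : Linked 𝒞 x₀ d₀ v w w') {c : ℤ → Segment} (hc : c ∈ 𝒞)
    (hk : ∃ k, (c k).mid = place x₀ d₀ (2 * v + w)) :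
    ∃ k, (c k).mid = place x₀ d₀ (2 * v + w') := by
  obtain ⟨k, hk⟩ := hk
  rcases hl with hl | hl <;> obtain ⟨c', hc', k', -, -, p1, p2⟩ := hl.exists_curve
  · obtain ⟨rfl, -⟩ := h.unique hc hc' (hk.trans p1.symm)
    exact ⟨_, p2⟩
  · obtain ⟨rfl, -⟩ := h.unique hc hc' (hk.trans p2.symm)
    exact ⟨_, p1⟩

theorem mem_curve_iff_of_joined (h : CoversPlane 𝒞) {y z : GaussianInt}
    (hj : Joined (Linked 𝒞 x₀ d₀) y z) {c : ℤ → Segment} (hc : c ∈ 𝒞) :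
    (∃ k, (c k).mid = place x₀ d₀ y) ↔ ∃ k, (c k).mid = place x₀ d₀ z := by
  induction hj with
  | rel y z hl =>
    obtain ⟨v, w, w', hl, rfl, rfl⟩ := hl
    exact ⟨hl.mem_curve h hc, Linked.mem_curve h hl.symm hc⟩
  | refl => rfl
  | symm _ _ _ ih => exact ih.symm
  | trans _ _ _ _ _ ih1 ih2 => exact ih1.trans ih2

theorem joined_of_mem_curve {c : ℤ → Segment} (hc : c ∈ 𝒞)
    (hf : ∀ k, ∃ b, Follows b (c k) (c (k + 1))) {y z : GaussianInt} {k l : ℤ}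
    (hy : (c k).mid = place x₀ d₀ y) (hz : (c l).mid = place x₀ d₀ z) :
    Joined (Linked 𝒞 x₀ d₀) y z := by
  choose f hfk using fun k => exists_place_eq (x₀ := x₀) (d₀ := d₀) (c k).mid
  have step : ∀ k, Joined (Linked 𝒞 x₀ d₀) (f k) (f (k + 1)) := by
    intro k
    obtain ⟨b, h1, h2⟩ := hf k
    obtain ⟨α, hα⟩ := (c k).isUnit_dir
    obtain ⟨β, hβ⟩ := (c (k + 1)).isUnit_dir
    have hv : (d₀ : GaussianInt) * ((d₀⁻¹ : GaussianIntˣ) * ((c k).endPt - x₀)) = (c k).endPt - x₀ :=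
      Units.mul_inv_cancel_left _ _
    have hw : ∀ γ : GaussianIntˣ, (d₀ : GaussianInt) * (d₀⁻¹ * γ : GaussianIntˣ) = γ := fun γ => by
      push_cast; exact Units.mul_inv_cancel_left _ _
    have hp : Passage 𝒞 x₀ d₀ ((d₀⁻¹ : GaussianIntˣ) * ((c k).endPt - x₀)) (d₀⁻¹ * -α) (d₀⁻¹ * β) := by
      refine ⟨_, _, ⟨c, hc, k, rfl, rfl⟩, ?_, ?_, ?_, ?_⟩
      · rw [hv]; ring
      · rw [hw, ← hα]; push_cast; ring
      · rw [hv, h1]; ring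
      · rw [hw, hβ]
    obtain ⟨c', hc', k', -, -, p1, p2⟩ := hp.exists_curve
    have hj := joined_of_link (L := Linked 𝒞 x₀ d₀) (Or.inl hp)
    convert hj using 1
    · refine place_injective (x₀ := x₀) (d₀ := d₀) ?_
      rw [hfk, place, mul_add, hw, mul_left_comm, hv, Segment.mid_eq_endPt, ← hα]; push_cast; ring
    · refine place_injective (x₀ := x₀) (d₀ := d₀) ?_
      rw [hfk, place, mul_add, hw, mul_left_comm, hv, Segment.mid, ← hβ, h1]; ring
  have all : ∀ k, Joined (Linked 𝒞 x₀ d₀) (f 0) (f k) := by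
    intro k
    induction k using Int.induction_on with
    | zero => exact Joined.refl _
    | succ k ih => exact ih.trans (step _)
    | pred k ih =>
      have := step (-k - 1)
      rw [sub_add_cancel] at this
      exact ih.trans this.symm
  have e1 : f k = y := place_injective ((hfk k).trans hy)
  have e2 : f l = z := place_injective ((hfk l).trans hz)
  rw [← e1, ← e2]
  exact (all k).symm.trans (all l)

/-- The curves of a covering correspond to the classes of joined edges. -/
theorem encard_eq_of_representatives (h : IsFoldingCovering S 𝒞) {ι : Type} [Fintype ι]
    {f : ι → GaussianInt} (hodd : ∀ i, ¬ IsEven (f i))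
    (hinj : ∀ i j, Joined (Linked 𝒞 x₀ d₀) (f i) (f j) → i = j)
    (hsurj : ∀ y, ¬ IsEven y → ∃ i, Joined (Linked 𝒞 x₀ d₀) y (f i)) :
    𝒞.encard = Fintype.card ι := by
  choose F hF k hk using fun i => h.2.exists_mid (y := place x₀ d₀ (f i))
    (by rw [isEven_place_iff]; exact hodd i)
  have hFinj : Function.Injective F := by
    intro i j hij
    refine hinj i j (joined_of_mem_curve (hF i) (h.follows _ (hF i)) (hk i) (l := k j) ?_)
    rw [hij]; exact hk j
  have hrange : 𝒞 = Set.range F := by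
    refine Set.Subset.antisymm (fun c hc => ?_) (Set.range_subset_iff.2 hF)
    obtain ⟨y, hy⟩ := exists_place_eq (x₀ := x₀) (d₀ := d₀) (c 0).mid
    obtain ⟨i, hi⟩ := hsurj y (by
      rw [← isEven_place_iff (x₀ := x₀) (d₀ := d₀), hy]; exact (c 0).not_isEven_mid)
    obtain ⟨l, hl⟩ := (mem_curve_iff_of_joined h.2 hi hc).1 ⟨0, hy.symm⟩
    exact ⟨i, (h.2.unique (hF i) hc ((hk i).trans hl.symm)).1⟩
  rw [hrange, ← Set.image_univ, hFinj.encard_image, Set.encard_univ, ENat.card_eq_coe_fintype_card]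

end curves

/-- The turn ε is between the segments of indices -n and 1 - n, so the ray starts with the latter.
Its k-th turn, counted from 0, is the term of index k + 1 of the two-sided sequence. -/
theorem isRayOf_of_twoSided {a : ℕ → ℤˣ} {ε : ℤˣ} {n : ℤ} {C : ℤ → Segment}
    (h : IsCompleteCurveOf (fun k => twoSided a ε (k + n)) C) :
    IsRayOf a fun k : ℕ => C (1 - n + k) := by
  intro k
  have h1 := h (1 - n + k)
  have e : twoSided a ε (1 - n + k + n) = a k := by
    rw [show 1 - n + (k : ℤ) + n = k + 1 by ring, twoSided, if_neg (by omega), if_pos (by omega)]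
    congr 1
  simp only [e] at h1
  rw [add_assoc] at h1
  exact_mod_cast h1

end Folding

open Folding

theorem theorem2 (S : FoldingString) (hS : S ≠ [])
    (h1 : IsSelfAvoidingString S) (h2 : IsPlaneFilling S) (h3 : ¬ IsPerfect S)
    (𝒞 : Set (ℤ → Segment)) (h𝒞 : IsFoldingCovering S 𝒞)
    (hloc : LocalIsomorphismProperty 𝒞)
    (C : ℤ → Segment) (hC : C ∈ 𝒞) (ε : ℤˣ) (n : ℤ)
    (hCS : IsCompleteCurveOf (fun k => twoSided (infPow S) ε (k + n)) C) :
    𝒞.encard = 6 := by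
  have hm : 1 < S.length + 1 := Nat.succ_lt_succ (List.length_pos_iff.2 hS)
  have hT := turnRule_infPow hS
  have hI : ∀ n, IsTiling (infPow S) ((S.length + 1) ^ n) := fun n =>
    (hT.pow n).isTiling (fillsSquares_infPow h2) (midSeq_injective h1)
  have hP : 1 < (ptSeq (infPow S) (S.length + 1)).norm := by
    have := hI 1
    rw [pow_one] at this
    exact this.one_lt_norm hm
  obtain ⟨d₀, hd₀⟩ := (C (1 - n)).isUnit_dir
  have hL := linkSystem_of_covering hS h1 h2 h𝒞 hloc hC (isRayOf_of_twoSided hCS) hd₀.symm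
  obtain ⟨f, hodd, hinj, hsurj⟩ :=
    hL.exists_representatives hm hT hP hI (exists_not_isRayEdge hS h1 h2 h3)
  -- Two classes of rays, indexed by the signs, and four other classes, indexed by the units.
  rw [encard_eq_of_representatives h𝒞 hodd hinj hsurj, Fintype.card_sum, card_gaussianInt_units]
  rfl
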